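/- Let $\omega=e^{2\pi i/3}$ and, for $n\ge 1$, let $$Q_n(z_1,\dots,z_n,y)=y+\prod_{j=1}^n\frac{z_j+\omega}{z_j+1}.$$ For a nonzero rational function $P$ in $m$ variables let $$\mathrm m(P)=\frac1{(2\pi i)^m}\int_{|x_1|=\cdots=|x_m|=1}\log|P(x_1,\dots,x_m)|\,\frac{dx_1}{x_1}\cdots\frac{dx_m}{x_m}$$ be its logarithmic Mahler measure. Let $\zeta$ be the Riemann zeta function, $\chi_{-3}$ the odd Dirichlet character of conductor $3$, $L(\chi_{-3},s)$ its $L$-function, and put $$\mathcal C(h)=(2h)!\Bigl(1-\frac1{3^{2h+1}}\Bigr)\Bigl(1-\frac1{2^{2h+1}}\Bigr)\zeta(2h+1),\qquad \mathcal D(h)=(2h+1)!\Bigl(1+\frac1{2^{2h+2}}\Bigr)L(\chi_{-3},2h+2).$$ Define polynomials recursively for $k\ge0$ (with no initial values needed): for a number $m$ and a family $(W_k)$ write $$\Phi_m(W)_k=\frac1{k+1}\sum_{1<j\le k+1,\ j\text{ odd}}(-1)^{\frac{j+1}2}\binom{k+1}{j}m^{j-1}W_{k+1-j}(x),$$ and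 let $$R_k=\Phi_3(R)_k+\frac1{2(k+1)}\sum_{0\le j\le k+1,\ j\text{ even}}(-1)^{\frac j2}\binom{k+1}j(2^j+1)x^{k+1-j},$$ $$S_k=\Phi_3(S)_k+\frac1{2(k+1)}\sum_{1\le j\le k+1,\ j\text{ odd}}(-1)^{\frac{j+1}2}\binom{k+1}j(2^j-1)x^{k+1-j},$$ $$P_k=\Phi_6(P)_k+\frac1{2(k+1)}\sum_{0\le j\le k+1,\ j\text{ even}}(-1)^{\frac j2}\binom{k+1}j(5^j+1)x^{k+1-j},$$ $$T_k=\Phi_6(T)_k+\frac1{2(k+1)}\sum_{1\le j\le k+1,\ j\text{ odd}}(-1)^{\frac{j-1}2}\binom{k+1}j(5^j-1)x^{k+1-j},$$ $$Y_k=\Phi_3(Y)_k-\frac1{k+1}\Bigl[x^{k+1}+\sum_{0\le j\le k+1,\ j\text{ even}}(-1)^{\frac j2}\binom{k+1}j3^jx^{k+1-j}\Bigr],$$ $$Z_k=\Phi_6(Z)_k-\frac2{k+1}\sum_{0\le j\le k+1,\ j\text{ even}}(-1)^{\frac j2}\binom{k+1}j3^jx^{k+1-j}.$$ For each of these families denote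 the coefficients by the corresponding small letter ($r,s,p,t,y,z$): for $W=R,P,Y,Z$, $w_{2l,j}$ is the coefficient of $x^{2j-1}$ in $W_{2l}$ and $w_{2l-1,j}$ that of $x^{2j}$ in $W_{2l-1}$; for $W=S,T$, $w_{2l-1,j}$ is the coefficient of $x^{2j-1}$ in $W_{2l-1}$ and $w_{2l,j}$ that of $x^{2j}$ in $W_{2l}$. Put $$A_{l,h}=2^{2l-2h+1}s_{2l-1,h}+t_{2l-1,h},\quad B_{l,h}=2^{2l-2h+2}r_{2l,h}+p_{2l,h},\quad C_{l,h}=2^{2l-2h}r_{2l-1,h}+p_{2l-1,h},\quad D_{l,h}=2^{2l-2h+1}s_{2l,h}+t_{2l,h},$$ $$E_l=2^{2l}(2r_{2l-1,0}+y_{2l-1,0})+2p_{2l-1,0}+z_{2l-1,0},\qquad G_l=2^{2l+1}s_{2l,0}+t_{2l,0}.$$ Define real numbers $a_{n,j},b_{n,j}$ ($n\ge1$, $0\le j\le n-1$), $c_{n,j}$ ($n\ge1$, $0\le j\le n-1$) and $d_{n,j}$ ($n\ge0$, $0\le j\le n$) recursively, starting from $d_{0,0}=1$: for $n\ge0$,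 $$a_{n+1,h-1}=\frac1{\sqrt3}\sum_{l=h}^nc_{n,l-1}A_{l,h}+\sum_{l=h-1}^nd_{n,l}B_{l,h}\quad(1\le h\le n+1),$$ $$b_{n+1,h}=\sum_{l=h}^nc_{n,l-1}C_{l,h}+\frac1{\sqrt3}\sum_{l=h-1}^nd_{n,l}D_{l,h}\quad(1\le h\le n),\qquad b_{n+1,0}=\frac13\sum_{l=1}^nc_{n,l-1}E_l+\frac2{\sqrt3}\sum_{l=0}^nd_{n,l}G_l,$$ and for $n\ge1$, $$c_{n,h-1}=\frac1{\sqrt3}\sum_{l=h}^na_{n,l-1}A_{l,h}+\sum_{l=h-1}^{n-1}b_{n,l}B_{l,h}\quad(1\le h\le n),$$ $$d_{n,h}=\sum_{l=h}^na_{n,l-1}C_{l,h}+\frac1{\sqrt3}\sum_{l=h}^{n-1}b_{n,l}D_{l,h}\quad(1\le h\le n),\qquad d_{n,0}=\frac13\sum_{l=1}^na_{n,l-1}E_l+\frac2{\sqrt3}\sum_{l=0}^{n-1}b_{n,l}G_l.$$ Theorem. The integrals defining $\mathrm m(Q_n)$, $n\ge1$, converge absolutely. For $n\ge1$, $$\mathrm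 m(Q_{2n})=\frac2{12^n}\Bigl(\sum_{h=1}^na_{n,h-1}\Bigl(\frac3\pi\Bigr)^{2h}\mathcal C(h)+\sum_{h=0}^{n-1}b_{n,h}\Bigl(\frac3\pi\Bigr)^{2h+1}\mathcal D(h)\Bigr),$$ and for $n\ge0$, $$\mathrm m(Q_{2n+1})=\frac1{12^n}\Bigl(\frac1{\sqrt3}\sum_{h=1}^nc_{n,h-1}\Bigl(\frac3\pi\Bigr)^{2h}\mathcal C(h)+\frac1{\sqrt3}\sum_{h=0}^{n}d_{n,h}\Bigl(\frac3\pi\Bigr)^{2h+1}\mathcal D(h)\Bigr).$$ In particular, $$\mathrm m(Q_1)=\frac{5\sqrt3}{4\pi}L(\chi_{-3},2)=\frac53L'(\chi_{-3},-1),$$ $$\mathrm m(Q_2)=\frac{91}{18\pi^2}\zeta(3)+\frac5{4\sqrt3\,\pi}L(\chi_{-3},2)=-\frac{182}9\zeta'(-2)+\frac59L'(\chi_{-3},-1),$$ $$\mathrm m(Q_3)=\frac{91}{36\pi^2}\zeta(3)+\frac5{4\sqrt3\,\pi}L(\chi_{-3},2)+\frac{153\sqrt3}{16\pi^3}L(\chi_{-3},4)=-\frac{91}9\zeta'(-2)+\frac59L'(\chi_{-3},-1)-\frac{17}{18}L'(\chi_{-3},-3),$$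 $$\mathrm m(Q_4)=\frac{91}{36\pi^2}\zeta(3)+\frac{3751}{108\pi^4}\zeta(5)+\frac{35}{36\sqrt3\,\pi}L(\chi_{-3},2)+\frac{51\sqrt3}{8\pi^3}L(\chi_{-3},4)$$ $$=-\frac{91}9\zeta'(-2)+\frac{3751}{81}\zeta'(-4)+\frac{35}{81}L'(\chi_{-3},-1)-\frac{17}{27}L'(\chi_{-3},-3).$$ -/

import Mathlib

open scoped BigOperators Nat Polynomial

noncomputable section

namespace MahlerQ

/-! ## Mahler measure on the unit torus -/

/-- Logarithmic Mahler measure of a function `P` of `n` complex variables: the average of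
`log |P|` over the unit torus, with `x_j = exp (i θ_j)`, `0 ≤ θ_j ≤ 2π`, so that
`dx_j / (2π i x_j) = dθ_j / (2π)`. A rational function enters through its values, which are
defined off a null set of the torus. -/
def mahler {n : ℕ} (P : (Fin n → ℂ) → ℂ) : ℝ :=
  ((2 * Real.pi) ^ n)⁻¹ *
    ∫ θ in Set.Icc (0 : Fin n → ℝ) (fun _ => 2 * Real.pi), Real.log ‖P (torusMap 0 1 θ)‖

/-- The integral defining the Mahler measure converges absolutely. -/
def MahlerConverges {n : ℕ} (P : (Fin n → ℂ) → ℂ) : Prop :=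
  TorusIntegrable (fun x => Real.log ‖P x‖) 0 1

/-- The primitive third root of unity `exp (2π i / 3)`. -/
def om : ℂ := Complex.exp (2 * Real.pi * Complex.I / 3)

/-- `Q_n (z_1, …, z_n, y) = y + ∏ (z_j + ω) / (z_j + 1)`; the last coordinate is `y`. -/
def Q (n : ℕ) (x : Fin (n + 1) → ℂ) : ℂ :=
  x (Fin.last n) + ∏ j : Fin n, (x j.castSucc + om) / (x j.castSucc + 1)

/-! ## The special values -/

/-- The odd Dirichlet character of conductor 3 (the Legendre symbol modulo 3). -/
def chi : DirichletCharacter ℂ 3 := (quadraticChar (ZMod 3)).ringHomComp (Int.castRingHom ℂ)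

/-- The Dirichlet `L`-function of `chi` (the entire continuation of the Dirichlet series). -/
def L (s : ℂ) : ℂ := DirichletCharacter.LFunction chi s

/-- `𝒞(h) = (2h)! (1 - 3^{-(2h+1)}) (1 - 2^{-(2h+1)}) ζ(2h+1)`. -/
def calC (h : ℕ) : ℂ :=
  ((2 * h)! : ℂ) * (1 - 1 / 3 ^ (2 * h + 1)) * (1 - 1 / 2 ^ (2 * h + 1)) *
    riemannZeta (2 * h + 1)

/-- `𝒟(h) = (2h+1)! (1 + 2^{-(2h+2)}) L(χ₋₃, 2h+2)`. -/
def calD (h : ℕ) : ℂ :=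
  ((2 * h + 1)! : ℂ) * (1 + 1 / 2 ^ (2 * h + 2)) * L (2 * h + 2)

/-! ## The six families of polynomials -/

/-- The family given by
`W_k = 1/(k+1) ∑_{1 < j ≤ k+1, j odd} (-1)^{(j+1)/2} binom(k+1, j) m^{j-1} W_{k+1-j} + g_k`. -/
def recPoly (m : ℝ) (g : ℕ → ℝ[X]) (k : ℕ) : ℝ[X] :=
  Polynomial.C (1 / ((k : ℝ) + 1)) *
      ∑ j ∈ ((Finset.Icc 2 (k + 1)).filter Odd).attach,
        Polynomial.C ((-1) ^ ((j.1 + 1) / 2) * ((k + 1).choose j.1 : ℝ) * m ^ (j.1 - 1)) *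
          recPoly m g (k + 1 - j.1)
    + g k
termination_by k
decreasing_by
  have := j.2
  simp only [Finset.mem_filter, Finset.mem_Icc] at this
  omega

theorem recPoly_eq (m : ℝ) (g : ℕ → ℝ[X]) (k : ℕ) :
    recPoly m g k =
      Polynomial.C (1 / ((k : ℝ) + 1)) *
        ∑ j ∈ (Finset.Icc 2 (k + 1)).filter Odd,
          Polynomial.C ((-1) ^ ((j + 1) / 2) * ((k + 1).choose j : ℝ) * m ^ (j - 1)) *
            recPoly m g (k + 1 - j)
      + g k := by
  rw [recPoly]
  congr 2
  exact Finset.sum_attach _ (fun j => Polynomial.C ((-1) ^ ((j + 1) / 2) *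
    ((k + 1).choose j : ℝ) * m ^ (j - 1)) * recPoly m g (k + 1 - j))

/-- `R_k`. -/
def polyR : ℕ → ℝ[X] := recPoly 3 fun k =>
  Polynomial.C (1 / (2 * ((k : ℝ) + 1))) *
    ∑ j ∈ (Finset.range (k + 2)).filter Even,
      Polynomial.C ((-1) ^ (j / 2) * ((k + 1).choose j : ℝ) * (2 ^ j + 1)) *
        Polynomial.X ^ (k + 1 - j)

/-- `S_k`. -/
def polyS : ℕ → ℝ[X] := recPoly 3 fun k =>
  Polynomial.C (1 / (2 * ((k : ℝ) + 1))) *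
    ∑ j ∈ (Finset.range (k + 2)).filter Odd,
      Polynomial.C ((-1) ^ ((j + 1) / 2) * ((k + 1).choose j : ℝ) * (2 ^ j - 1)) *
        Polynomial.X ^ (k + 1 - j)

/-- `P_k`. -/
def polyP : ℕ → ℝ[X] := recPoly 6 fun k =>
  Polynomial.C (1 / (2 * ((k : ℝ) + 1))) *
    ∑ j ∈ (Finset.range (k + 2)).filter Even,
      Polynomial.C ((-1) ^ (j / 2) * ((k + 1).choose j : ℝ) * (5 ^ j + 1)) *
        Polynomial.X ^ (k + 1 - j)

/-- The polynomial `Q_k` in one variable (unrelated to the rational function `Q_n`). -/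
def polyQ : ℕ → ℝ[X] := recPoly 6 fun k =>
  Polynomial.C (1 / (2 * ((k : ℝ) + 1))) *
    ∑ j ∈ (Finset.range (k + 2)).filter Odd,
      Polynomial.C ((-1) ^ ((j - 1) / 2) * ((k + 1).choose j : ℝ) * (5 ^ j - 1)) *
        Polynomial.X ^ (k + 1 - j)

/-- `Y_k`. -/
def polyY : ℕ → ℝ[X] := recPoly 3 fun k =>
  -(Polynomial.C (1 / ((k : ℝ) + 1)) *
    (Polynomial.X ^ (k + 1) +
      ∑ j ∈ (Finset.range (k + 2)).filter Even,
        Polynomial.C ((-1) ^ (j / 2) * ((k + 1).choose j : ℝ) * 3 ^ j) *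
          Polynomial.X ^ (k + 1 - j)))

/-- `Z_k`. -/
def polyZ : ℕ → ℝ[X] := recPoly 6 fun k =>
  -(Polynomial.C (2 / ((k : ℝ) + 1)) *
    ∑ j ∈ (Finset.range (k + 2)).filter Even,
      Polynomial.C ((-1) ^ (j / 2) * ((k + 1).choose j : ℝ) * 3 ^ j) *
        Polynomial.X ^ (k + 1 - j))

/-- Coefficient of `x^{2j-1}` of the `k`-th polynomial of a family (used for `j ≥ 1`). -/
def oddCoeff (W : ℕ → ℝ[X]) (k j : ℕ) : ℝ := (W k).coeff (2 * j - 1)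

/-- Coefficient of `x^{2j}` of the `k`-th polynomial of a family. -/
def evenCoeff (W : ℕ → ℝ[X]) (k j : ℕ) : ℝ := (W k).coeff (2 * j)

/-! ## The coefficients `a`, `b`, `c`, `d`

The powers of two have integer exponents. The following abbreviations are the factors which occur
in the recursions (`1 ≤ l` in `facA`, `facC`, `facE`). -/

/-- `2^{2l-2h+1} s_{2l-1,h} + q_{2l-1,h}`. -/
def facA (l h : ℕ) : ℝ :=
  (2 : ℝ) ^ (2 * (l : ℤ) - 2 * h + 1) * oddCoeff polyS (2 * l - 1) h
    + oddCoeff polyQ (2 * l - 1) h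

/-- `2^{2l-2h+2} r_{2l,h} + p_{2l,h}`. -/
def facB (l h : ℕ) : ℝ :=
  (2 : ℝ) ^ (2 * (l : ℤ) - 2 * h + 2) * oddCoeff polyR (2 * l) h + oddCoeff polyP (2 * l) h

/-- `2^{2l-2h} r_{2l-1,h} + p_{2l-1,h}`. -/
def facC (l h : ℕ) : ℝ :=
  (2 : ℝ) ^ (2 * (l : ℤ) - 2 * h) * evenCoeff polyR (2 * l - 1) h
    + evenCoeff polyP (2 * l - 1) h

/-- `2^{2l-2h+1} s_{2l,h} + q_{2l,h}`. -/
def facD (l h : ℕ) : ℝ :=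
  (2 : ℝ) ^ (2 * (l : ℤ) - 2 * h + 1) * evenCoeff polyS (2 * l) h + evenCoeff polyQ (2 * l) h

/-- `2^{2l} (2 r_{2l-1,0} + y_{2l-1,0}) + 2 p_{2l-1,0} + z_{2l-1,0}`. -/
def facE (l : ℕ) : ℝ :=
  (2 : ℝ) ^ (2 * l) * (2 * evenCoeff polyR (2 * l - 1) 0 + evenCoeff polyY (2 * l - 1) 0)
    + 2 * evenCoeff polyP (2 * l - 1) 0 + evenCoeff polyZ (2 * l - 1) 0

/-- `2^{2l+1} s_{2l,0} + q_{2l,0}`. -/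
def facG (l : ℕ) : ℝ :=
  (2 : ℝ) ^ (2 * l + 1) * evenCoeff polyS (2 * l) 0 + evenCoeff polyQ (2 * l) 0

mutual

/-- `a_{n,i}`, with `i = h - 1` in the recursion; only `n ≥ 1`, `i < n` is used. -/
def a : ℕ → ℕ → ℝ
  | 0, _ => 0
  | n + 1, i =>
      1 / √3 * ∑ l ∈ Finset.Icc (i + 1) n, c n (l - 1) * facA l (i + 1)
        + ∑ l ∈ Finset.Icc i n, d n l * facB l (i + 1)
termination_by n _ => 2 * n

/-- `b_{n,h}`; only `n ≥ 1`, `h < n` is used. -/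
def b : ℕ → ℕ → ℝ
  | 0, _ => 0
  | n + 1, 0 =>
      1 / 3 * ∑ l ∈ Finset.Icc 1 n, c n (l - 1) * facE l
        + 2 / √3 * ∑ l ∈ Finset.Icc 0 n, d n l * facG l
  | n + 1, h + 1 =>
      ∑ l ∈ Finset.Icc (h + 1) n, c n (l - 1) * facC l (h + 1)
        + 1 / √3 * ∑ l ∈ Finset.Icc h n, d n l * facD l (h + 1)
termination_by n _ => 2 * n

/-- `c_{n,i}`, with `i = h - 1` in the recursion; only `n ≥ 1`, `i < n` is used. The sum over
`h - 1 ≤ l ≤ n - 1` is written for `n + 1` in place of `n`. -/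
def c : ℕ → ℕ → ℝ
  | 0, _ => 0
  | n + 1, i =>
      1 / √3 * ∑ l ∈ Finset.Icc (i + 1) (n + 1), a (n + 1) (l - 1) * facA l (i + 1)
        + ∑ l ∈ Finset.Icc i n, b (n + 1) l * facB l (i + 1)
termination_by n _ => 2 * n + 1

/-- `d_{n,h}`; only `h ≤ n` is used. The initial value is `d_{0,0} = 1`. -/
def d : ℕ → ℕ → ℝ
  | 0, 0 => 1
  | 0, _ + 1 => 0
  | n + 1, 0 =>
      1 / 3 * ∑ l ∈ Finset.Icc 1 (n + 1), a (n + 1) (l - 1) * facE l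
        + 2 / √3 * ∑ l ∈ Finset.Icc 0 n, b (n + 1) l * facG l
  | n + 1, h + 1 =>
      ∑ l ∈ Finset.Icc (h + 1) (n + 1), a (n + 1) (l - 1) * facC l (h + 1)
        + 1 / √3 * ∑ l ∈ Finset.Icc (h + 1) n, b (n + 1) l * facD l (h + 1)
termination_by n _ => 2 * n + 1

end

end MahlerQ

end

noncomputable section

namespace MahlerQ

/-! ## Trigonometric power series -/

-- Jensen's formula in `y` gives m(Q_N) = E[max(S_N, 0)], where S_N is the sum of N independent
-- copies of X = log |(e^{iθ} + ω)/(e^{iθ} + 1)| with θ uniform (`mahler_Q_eq`). The substitution |1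
-- + √3 tan(θ/2)| = 2e^t shows that X has a density proportional to sinh 2t / sinh 3t. Its
-- characteristic function is w(x) = 1/(2 cosh(πx/3) - 1), so that of S_N is w^N. It remains to
-- write w^N as a finite combination of explicit cosine transforms and to take first moments on the
-- half line.
--
-- The right family is g_j(t) = t^j sinh 2t / sinh 3t for even j, with cosh 2t in the numerator for
-- odd j. It is generated by one kernel: ∑ u^j/j! g_j(t) = sinh((2+u)t)/sinh 3t, whose cosine
-- transform is elementary (`integral_ker_mul_cos`). With u = 3v/π, the normalized transforms γ_j
-- satisfy ∑ γ_j v^j/j! = sin(2π/3 + v)/(cosh(πx/3) + cos(2π/3 + v)), and γ_0 = √3 w. Call the left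
-- side Γ(v) and put D(v) = cos v - 1 + √3 sin v. Clearing the denominator gives D·wΓ = Γ - γ_0 (cos
-- v - sin v/√3). Dividing by D expresses every w γ_j through γ_0, …, γ_{j+1}, with coefficients
-- independent of x; the sum stops there because D has a simple zero at 0. This is
-- `isConv_of_series`, and `isConv_gam` applies it.
--
-- The recursive polynomials encode the division by D. A recursion with parameter m says that the
-- exponential generating function of the coefficients is a quotient by sin(mx)
-- (`sinS_mul_egf_recPoly`). The combinations in A, …, G add up to (sin v + √3(1 + cos v))/(2 sin v
-- (2 cos v + 1)), which is 1/D, and to its analogue for γ_0 (`symbolD_mul_convS`,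
-- `symbolD_mul_convS_zero`). Hence one step of the recursion for a, b, c, d is multiplication by
-- 2√3 w, and two steps account for the 12 in 12^n (`IsConv.combOdd_eq`, `IsConv.combEven_eq`).
--
-- Uniqueness of characteristic functions turns the formula for w^N into a density of S_N
-- (`integral_map_logSum`). The moments ∫ t g_j(t) dt are evaluated by expanding the kernels as ∑
-- ψ(n) e^{-nt} with ψ a character modulo 6; the Mellin transform gives `calC` and `calD`
-- (`integral_mul_basis_odd`, `integral_mul_basis_even`). For N ≤ 4 the first coefficients are
-- computed, and the derivative forms follow from the functional equations of ζ and L(χ₋₃, s).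

open PowerSeries in
/-- The power series of `sin (m x)`. -/
def sinS (m : ℝ) : PowerSeries ℝ := rescale m (PowerSeries.sin ℝ)

open PowerSeries in
/-- The power series of `cos (m x)`. -/
def cosS (m : ℝ) : PowerSeries ℝ := rescale m (PowerSeries.cos ℝ)

theorem coeff_sinS (m : ℝ) (n : ℕ) :
    PowerSeries.coeff n (sinS m) = if Even n then 0 else (-1) ^ (n / 2) * m ^ n / n ! := by
  rw [sinS, PowerSeries.coeff_rescale, PowerSeries.sin, PowerSeries.coeff_mk]
  split_ifs with h
  · simp
  · simp; ring

theorem coeff_cosS (m : ℝ) (n : ℕ) :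
    PowerSeries.coeff n (cosS m) = if Even n then (-1) ^ (n / 2) * m ^ n / n ! else 0 := by
  rw [cosS, PowerSeries.coeff_rescale, PowerSeries.cos, PowerSeries.coeff_mk]
  split_ifs with h
  · simp; ring
  · simp

/-- Euler's formula as formal series. It reduces the addition theorems to the exponential law, with
real and imaginary parts compared coefficientwise. -/
theorem map_trigS (m : ℝ) :
    PowerSeries.map Complex.ofRealHom (cosS m) +
        PowerSeries.C Complex.I * PowerSeries.map Complex.ofRealHom (sinS m) =
      PowerSeries.rescale (m * Complex.I) (PowerSeries.exp ℂ) := by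
  ext n
  simp only [map_add, PowerSeries.coeff_map, PowerSeries.coeff_C_mul, coeff_cosS, coeff_sinS,
    PowerSeries.coeff_rescale, PowerSeries.coeff_exp]
  rcases Nat.even_or_odd' n with ⟨k, rfl | rfl⟩
  · simp [mul_pow, pow_mul]; ring
  · have : (2 * k + 1) / 2 = k := by omega
    have hI : Complex.I ^ (2 * k) = (-1) ^ k := by rw [pow_mul, Complex.I_sq]
    simp [mul_pow, pow_succ _ (2 * k), hI, this]; ring

theorem trigS_add (a b : ℝ) :
    sinS (a + b) = sinS a * cosS b + cosS a * sinS b ∧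
      cosS (a + b) = cosS a * cosS b - sinS a * sinS b := by
  set f := PowerSeries.map Complex.ofRealHom
  have h := PowerSeries.exp_mul_exp_eq_exp_add (A := ℂ) (a * Complex.I) (b * Complex.I)
  rw [← map_trigS, ← map_trigS, ← add_mul, ← Complex.ofReal_add, ← map_trigS] at h
  have key : ∀ u v : PowerSeries ℝ,
      f u + PowerSeries.C Complex.I * f v = 0 → u = 0 ∧ v = 0 := by
    intro u v huv
    have h1 : ∀ n, PowerSeries.coeff n u = 0 ∧ PowerSeries.coeff n v = 0 := by
      intro n
      have := congrArg (PowerSeries.coeff n) huv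
      simp only [f, map_add, PowerSeries.coeff_map, PowerSeries.coeff_C_mul, map_zero] at this
      have h1 := congrArg Complex.re this
      have h2 := congrArg Complex.im this
      simp at h1 h2
      exact ⟨h1, h2⟩
    exact ⟨PowerSeries.ext fun n => by simp [(h1 n).1], PowerSeries.ext fun n => by simp [(h1 n).2]⟩
  have hI : (PowerSeries.C Complex.I : PowerSeries ℂ) * PowerSeries.C Complex.I = -1 := by
    rw [← map_mul]; simp
  have := key (cosS a * cosS b - sinS a * sinS b - cosS (a + b))
    (sinS a * cosS b + cosS a * sinS b - sinS (a + b)) (by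
      simp only [map_sub, map_add, map_mul]
      linear_combination h - f (sinS a) * f (sinS b) * hI)
  exact ⟨(sub_eq_zero.1 this.2).symm, (sub_eq_zero.1 this.1).symm⟩

theorem cosS_zero : cosS 0 = 1 := by
  ext n
  rw [coeff_cosS, PowerSeries.coeff_one]
  rcases eq_or_ne n 0 with rfl | h
  · simp
  · simp [h]

theorem cosS_sq_add_sinS_sq (a : ℝ) : sinS a ^ 2 = 1 - cosS a ^ 2 := by
  have h := (trigS_add a (-a)).2
  have h1 : sinS (-a) = - sinS a := by
    ext n
    rw [map_neg, coeff_sinS, coeff_sinS]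
    split_ifs with h
    · simp
    · rw [Odd.neg_pow (show Odd n by simpa using h)]; ring
  have h2 : cosS (-a) = cosS a := by
    ext n
    rw [coeff_cosS, coeff_cosS]
    split_ifs with h
    · rw [Even.neg_pow h]
    · rfl
  rw [add_neg_cancel, cosS_zero, h1, h2] at h
  linear_combination -h

theorem sinS_ne_zero {m : ℝ} (hm : m ≠ 0) : sinS m ≠ 0 := by
  intro h
  have := congrArg (PowerSeries.coeff 1) h
  rw [coeff_sinS] at this
  simp [hm] at this

theorem rescale_sinS (a m : ℝ) : PowerSeries.rescale a (sinS m) = sinS (a * m) := by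
  rw [sinS, sinS, PowerSeries.rescale_rescale, mul_comm]

theorem rescale_cosS (a m : ℝ) : PowerSeries.rescale a (cosS m) = cosS (a * m) := by
  rw [cosS, cosS, PowerSeries.rescale_rescale, mul_comm]

/-! ## Exponential generating functions of the coefficients of a family of polynomials -/

/-- The exponential generating function of the coefficients of `x ^ i`. -/
def egf (W : ℕ → ℝ[X]) (i : ℕ) : PowerSeries ℝ :=
  PowerSeries.mk fun k => (W k).coeff i / k !

theorem coeff_egf (W : ℕ → ℝ[X]) (i k : ℕ) :
    PowerSeries.coeff k (egf W i) = (W k).coeff i / k ! := by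
  rw [egf, PowerSeries.coeff_mk]

/-- In the recursion, W_k is the missing j = 1 term of the sum over odd j. Moving everything to one
side and multiplying by m (k+1) gives ∑_{j odd} (-1)^{(j-1)/2} binom(k+1, j) m^j W_{k+1-j} = m (k+1)
g_k, a binomial convolution with the coefficients of sin(mx). -/
theorem sinS_mul_egf_recPoly (m : ℝ) (g : ℕ → ℝ[X]) (i : ℕ) :
    sinS m * egf (recPoly m g) i =
      PowerSeries.C m * (PowerSeries.X * egf g i) := by
  ext n
  rw [PowerSeries.coeff_C_mul]
  cases n with
  | zero => simp [PowerSeries.coeff_mul, coeff_sinS]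
  | succ k =>
    rw [PowerSeries.coeff_succ_X_mul, coeff_egf, PowerSeries.coeff_mul,
      Finset.Nat.sum_antidiagonal_eq_sum_range_succ_mk]
    have hk : ((k : ℝ) + 1) ≠ 0 := by positivity
    have hrec := congrArg (fun p => Polynomial.coeff p i) (recPoly_eq m g k)
    simp only [Polynomial.coeff_add, Polynomial.coeff_C_mul, Polynomial.finsetSum_coeff] at hrec
    have hsplit : ∑ j ∈ Finset.range (k + 1).succ,
        PowerSeries.coeff j (sinS m) * PowerSeries.coeff (k + 1 - j) (egf (recPoly m g) i) =
      PowerSeries.coeff 1 (sinS m) * PowerSeries.coeff k (egf (recPoly m g) i) +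
      ∑ j ∈ (Finset.Icc 2 (k + 1)).filter Odd,
        PowerSeries.coeff j (sinS m) * PowerSeries.coeff (k + 1 - j) (egf (recPoly m g) i) := by
      -- The index 0 contributes nothing to a sine, the index 1 isolates W_k, and the even indices
      -- of the remaining interval vanish.
      have hset : (Finset.range (k + 1).succ) = insert 0 (insert 1 (Finset.Icc 2 (k + 1))) := by
        ext x; simp; omega
      rw [hset, Finset.sum_insert (by simp), Finset.sum_insert (by simp), Finset.sum_filter]
      have h0 : PowerSeries.coeff 0 (sinS m) = 0 := by rw [coeff_sinS]; simp
      rw [h0, zero_mul, zero_add]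
      congr 1
      refine Finset.sum_congr rfl fun j _ => ?_
      split_ifs with h
      · rfl
      · rw [coeff_sinS, if_pos (by simpa using h), zero_mul]
    rw [hsplit, coeff_egf, coeff_sinS]
    have hterm : ∑ j ∈ (Finset.Icc 2 (k + 1)).filter Odd,
        PowerSeries.coeff j (sinS m) * PowerSeries.coeff (k + 1 - j) (egf (recPoly m g) i) =
      -(m / (k + 1)!) * ∑ j ∈ (Finset.Icc 2 (k + 1)).filter Odd,
        (-1) ^ ((j + 1) / 2) * ((k + 1).choose j : ℝ) * m ^ (j - 1) *
            (recPoly m g (k + 1 - j)).coeff i := by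
      rw [Finset.mul_sum]
      refine Finset.sum_congr rfl fun j hj => ?_
      simp only [Finset.mem_filter, Finset.mem_Icc] at hj
      obtain ⟨⟨h2, hle⟩, hodd⟩ := hj
      rw [coeff_sinS, coeff_egf, if_neg (by simpa using hodd), Nat.cast_choose ℝ hle]
      obtain ⟨q, rfl⟩ := hodd
      have e1 : (2 * q + 1) / 2 = q := by omega
      have e2 : (2 * q + 1 + 1) / 2 = q + 1 := by omega
      have e3 : 2 * q + 1 - 1 = 2 * q := by omega
      rw [e1, e2, e3]
      have f1 : ((2 * q + 1)! : ℝ) ≠ 0 := by positivity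
      have f2 : ((k + 1 - (2 * q + 1))! : ℝ) ≠ 0 := by positivity
      have f3 : ((k + 1)! : ℝ) ≠ 0 := by positivity
      field_simp
      ring
    rw [hterm]
    have f3 : ((k + 1)! : ℝ) = (k + 1) * k ! := by push_cast [Nat.factorial_succ]; ring
    have f4 : (k ! : ℝ) ≠ 0 := by positivity
    rw [hrec, f3]
    simp
    field_simp
    ring

theorem coeff_sum_filter (p : ℕ → Prop) [DecidablePred p] (f : ℕ → ℝ) (n i : ℕ) :
    (∑ j ∈ (Finset.range (n + 1)).filter p,
        Polynomial.C (f j) * Polynomial.X ^ (n - j)).coeff i =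
      if i ≤ n ∧ p (n - i) then f (n - i) else 0 := by
  rw [Polynomial.finsetSum_coeff]
  simp only [Polynomial.coeff_C_mul_X_pow]
  split_ifs with h
  · rw [Finset.sum_eq_single (n - i)]
    · rw [if_pos (by omega)]
    · intro j hj hne
      simp only [Finset.mem_filter, Finset.mem_range] at hj
      rw [if_neg (by omega)]
    · intro hn
      simp only [Finset.mem_filter, Finset.mem_range] at hn
      exact absurd ⟨by omega, h.2⟩ hn
  · refine Finset.sum_eq_zero fun j hj => ?_
    simp only [Finset.mem_filter, Finset.mem_range] at hj
    rw [if_neg]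
    rintro rfl
    apply h
    have : n - (n - j) = j := by omega
    rw [this]
    exact ⟨by omega, hj.2⟩

/-- The series `X * egf` of the inhomogeneous terms of the families, up to the constant term. -/
theorem X_mul_egf_filter (p : ℕ → Prop) [DecidablePred p] (q : ℝ) (s f : ℕ → ℝ) (i : ℕ) :
    PowerSeries.X * egf (fun k => Polynomial.C (q / ((k : ℝ) + 1)) *
        ∑ j ∈ (Finset.range (k + 2)).filter p,
          Polynomial.C (s j * ((k + 1).choose j : ℝ) * f j) * Polynomial.X ^ (k + 1 - j)) i =
      PowerSeries.C (q / i !) * (PowerSeries.X ^ i *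
        PowerSeries.mk fun j => if p j then s j * f j / j ! else 0) -
      PowerSeries.C (if i = 0 ∧ p 0 then q * (s 0 * f 0) else 0) := by
  ext n
  rw [map_sub, PowerSeries.coeff_C_mul, PowerSeries.coeff_X_pow_mul', PowerSeries.coeff_mk]
  cases n with
  -- The left side is divisible by X, so for i = 0 the constant term of the trigonometric series has
  -- to be removed. This correction is what makes the constant coefficients of the families
  -- exceptional.
  | zero =>
    rcases eq_or_ne i 0 with rfl | hi
    · by_cases h : p 0 <;> simp [h]
    · simp [hi]
  | succ k =>
    rw [PowerSeries.coeff_succ_X_mul, coeff_egf, Polynomial.coeff_C_mul, coeff_sum_filter,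
      PowerSeries.coeff_C, if_neg (Nat.succ_ne_zero k)]
    by_cases hi : i ≤ k + 1
    · by_cases h : p (k + 1 - i)
      · rw [if_pos ⟨hi, h⟩, if_pos hi, if_pos h, Nat.cast_choose ℝ (Nat.sub_le _ _)]
        have e : k + 1 - (k + 1 - i) = i := by omega
        have f3 : ((k + 1)! : ℝ) = (k + 1) * k ! := by push_cast [Nat.factorial_succ]; ring
        have f4 : (k ! : ℝ) ≠ 0 := by positivity
        have f5 : (i ! : ℝ) ≠ 0 := by positivity
        have f6 : ((k + 1 - i)! : ℝ) ≠ 0 := by positivity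
        have hk : ((k : ℝ) + 1) ≠ 0 := by positivity
        rw [e, f3]
        field_simp
        ring
      · rw [if_neg (fun hh => h hh.2), if_pos hi, if_neg h]; simp
    · rw [if_neg (fun hh => hi hh.1), if_neg hi]; simp

/-- The monomial `x ^ i / i!`. -/
def mono (i : ℕ) : PowerSeries ℝ := PowerSeries.C (1 / (i ! : ℝ)) * PowerSeries.X ^ i

theorem mono_zero : mono 0 = 1 := by simp [mono]

theorem sinS_mul_egf_recPoly_filter (p : ℕ → Prop) [DecidablePred p] (m q : ℝ) (s f : ℕ → ℝ)
    (i : ℕ) :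
    sinS m * egf (recPoly m fun k => Polynomial.C (q / ((k : ℝ) + 1)) *
        ∑ j ∈ (Finset.range (k + 2)).filter p,
          Polynomial.C (s j * ((k + 1).choose j : ℝ) * f j) * Polynomial.X ^ (k + 1 - j)) i =
      PowerSeries.C (m * q) * (mono i *
        (PowerSeries.mk fun j => if p j then s j * f j / j ! else 0) -
      PowerSeries.C (if i = 0 ∧ p 0 then s 0 * f 0 else 0)) := by
  rw [sinS_mul_egf_recPoly, X_mul_egf_filter, mono]
  have e1 : PowerSeries.C (q / i ! : ℝ) = PowerSeries.C q * PowerSeries.C (1 / i ! : ℝ) := by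
    rw [← map_mul]; congr 1; ring
  have e2 : (if i = 0 ∧ p 0 then q * (s 0 * f 0) else 0) =
      q * (if i = 0 ∧ p 0 then s 0 * f 0 else 0) := by split_ifs <;> simp
  rw [e1, e2, map_mul, map_mul]
  ring

theorem mk_even_pow (r : ℝ) :
    (PowerSeries.mk fun j => if Even j then (-1) ^ (j / 2) * r ^ j / j ! else 0) = cosS r := by
  ext n
  rw [PowerSeries.coeff_mk, coeff_cosS]

theorem mk_even_add (r : ℝ) :
    (PowerSeries.mk fun j => if Even j then (-1) ^ (j / 2) * (r ^ j + 1) / j ! else 0) =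
      cosS r + cosS 1 := by
  ext n
  rw [PowerSeries.coeff_mk, map_add, coeff_cosS, coeff_cosS]
  split_ifs <;> simp
  ring

theorem mk_odd_sub (r : ℝ) :
    (PowerSeries.mk fun j => if Odd j then (-1) ^ ((j - 1) / 2) * (r ^ j - 1) / j ! else 0) =
      sinS r - sinS 1 := by
  ext n
  rw [PowerSeries.coeff_mk, map_sub, coeff_sinS, coeff_sinS]
  rcases Nat.even_or_odd' n with ⟨k, rfl | rfl⟩
  · simp
  · have e : (2 * k + 1) / 2 = k := by omega
    simp [e]
    ring

theorem mk_odd_sub' (r : ℝ) :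
    (PowerSeries.mk fun j => if Odd j then (-1) ^ ((j + 1) / 2) * (r ^ j - 1) / j ! else 0) =
      -(sinS r - sinS 1) := by
  ext n
  rw [PowerSeries.coeff_mk, map_neg, map_sub, coeff_sinS, coeff_sinS]
  rcases Nat.even_or_odd' n with ⟨k, rfl | rfl⟩
  · simp
  · have e : (2 * k + 1) / 2 = k := by omega
    have e' : (2 * k + 1 + 1) / 2 = k + 1 := by omega
    simp [e, e', pow_succ (-1 : ℝ) k]
    ring

theorem ofNat_eq_C (n : ℕ) [n.AtLeastTwo] :
    (OfNat.ofNat n : PowerSeries ℝ) = PowerSeries.C (OfNat.ofNat n : ℝ) :=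
  (map_ofNat (PowerSeries.C (R := ℝ)) n).symm

theorem ofNat_ne_zero_series (n : ℕ) [n.AtLeastTwo] : (OfNat.ofNat n : PowerSeries ℝ) ≠ 0 := by
  rw [ofNat_eq_C]
  intro h
  have := congrArg (PowerSeries.coeff 0) h
  simp at this

-- Generating functions of the six families as quotients by sin 3x and sin 6x

theorem sinS_mul_egf_polyR (i : ℕ) :
    2 * (sinS 3 * egf polyR i) =
      3 * (mono i * (cosS 2 + cosS 1) - PowerSeries.C (if i = 0 then 2 else 0)) := by
  have h := sinS_mul_egf_recPoly_filter Even 3 (1 / 2) (fun j => (-1) ^ (j / 2))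
    (fun j => 2 ^ j + 1) i
  rw [mk_even_add] at h
  have e : (recPoly 3 fun k => Polynomial.C (1 / 2 / ((k : ℝ) + 1)) *
        ∑ j ∈ (Finset.range (k + 2)).filter Even,
          Polynomial.C ((-1) ^ (j / 2) * ((k + 1).choose j : ℝ) * (2 ^ j + 1)) *
            Polynomial.X ^ (k + 1 - j)) = polyR := by
    unfold polyR; simp only [div_div]
  rw [e] at h
  norm_num at h ⊢
  rw [h, mul_comm (2 : PowerSeries ℝ), mul_right_comm, ofNat_eq_C 2, ← map_mul, ofNat_eq_C 3]
  norm_num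

theorem sinS_mul_egf_polyP (i : ℕ) :
    sinS 6 * egf polyP i =
      3 * (mono i * (cosS 5 + cosS 1) - PowerSeries.C (if i = 0 then 2 else 0)) := by
  have h := sinS_mul_egf_recPoly_filter Even 6 (1 / 2) (fun j => (-1) ^ (j / 2))
    (fun j => 5 ^ j + 1) i
  rw [mk_even_add] at h
  have e : (recPoly 6 fun k => Polynomial.C (1 / 2 / ((k : ℝ) + 1)) *
        ∑ j ∈ (Finset.range (k + 2)).filter Even,
          Polynomial.C ((-1) ^ (j / 2) * ((k + 1).choose j : ℝ) * (5 ^ j + 1)) *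
            Polynomial.X ^ (k + 1 - j)) = polyP := by
    unfold polyP; simp only [div_div]
  rw [e] at h
  norm_num at h ⊢
  exact h

theorem sinS_mul_egf_polyS (i : ℕ) :
    2 * (sinS 3 * egf polyS i) = -3 * (mono i * (sinS 2 - sinS 1)) := by
  have h := sinS_mul_egf_recPoly_filter Odd 3 (1 / 2) (fun j => (-1) ^ ((j + 1) / 2))
    (fun j => 2 ^ j - 1) i
  rw [mk_odd_sub'] at h
  have e : (recPoly 3 fun k => Polynomial.C (1 / 2 / ((k : ℝ) + 1)) *
        ∑ j ∈ (Finset.range (k + 2)).filter Odd,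
          Polynomial.C ((-1) ^ ((j + 1) / 2) * ((k + 1).choose j : ℝ) * (2 ^ j - 1)) *
            Polynomial.X ^ (k + 1 - j)) = polyS := by
    unfold polyS; simp only [div_div]
  rw [e] at h
  norm_num at h ⊢
  rw [h, mul_comm (2 : PowerSeries ℝ), mul_right_comm, ofNat_eq_C 2, ← map_mul, ofNat_eq_C 3]
  norm_num
  ring

theorem sinS_mul_egf_polyQ (i : ℕ) :
    sinS 6 * egf polyQ i = 3 * (mono i * (sinS 5 - sinS 1)) := by
  have h := sinS_mul_egf_recPoly_filter Odd 6 (1 / 2) (fun j => (-1) ^ ((j - 1) / 2))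
    (fun j => 5 ^ j - 1) i
  rw [mk_odd_sub] at h
  have e : (recPoly 6 fun k => Polynomial.C (1 / 2 / ((k : ℝ) + 1)) *
        ∑ j ∈ (Finset.range (k + 2)).filter Odd,
          Polynomial.C ((-1) ^ ((j - 1) / 2) * ((k + 1).choose j : ℝ) * (5 ^ j - 1)) *
            Polynomial.X ^ (k + 1 - j)) = polyQ := by
    unfold polyQ; simp only [div_div]
  rw [e] at h
  norm_num at h ⊢
  exact h

theorem sinS_mul_egf_polyZ : sinS 6 * egf polyZ 0 = 12 * (1 - cosS 3) := by
  have h := sinS_mul_egf_recPoly_filter Even 6 (-2) (fun j => (-1) ^ (j / 2))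
    (fun j => 3 ^ j) 0
  rw [mk_even_pow] at h
  have e : (recPoly 6 fun k => Polynomial.C (-2 / ((k : ℝ) + 1)) *
        ∑ j ∈ (Finset.range (k + 2)).filter Even,
          Polynomial.C ((-1) ^ (j / 2) * ((k + 1).choose j : ℝ) * 3 ^ j) *
            Polynomial.X ^ (k + 1 - j)) = polyZ := by
    unfold polyZ; simp only [neg_div, map_neg, neg_mul]
  rw [e, mono_zero] at h
  norm_num at h ⊢
  rw [h, ofNat_eq_C 12]
  ring

theorem sinS_mul_egf_polyY : sinS 3 * egf polyY 0 = 3 * (1 - cosS 3) := by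
  rw [polyY, sinS_mul_egf_recPoly]
  have h := X_mul_egf_filter Even (-1) (fun j => (-1) ^ (j / 2)) (fun j => 3 ^ j) 0
  rw [mk_even_pow] at h
  -- The extra monomial x^{k+1} has no constant coefficient, so it is invisible in the only series
  -- of this family that is used.
  have e : egf (fun k => -(Polynomial.C (1 / ((k : ℝ) + 1)) *
      (Polynomial.X ^ (k + 1) +
        ∑ j ∈ (Finset.range (k + 2)).filter Even,
          Polynomial.C ((-1) ^ (j / 2) * ((k + 1).choose j : ℝ) * 3 ^ j) *
            Polynomial.X ^ (k + 1 - j)))) 0 =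
      egf (fun k => Polynomial.C (-1 / ((k : ℝ) + 1)) *
        ∑ j ∈ (Finset.range (k + 2)).filter Even,
          Polynomial.C ((-1) ^ (j / 2) * ((k + 1).choose j : ℝ) * 3 ^ j) *
            Polynomial.X ^ (k + 1 - j)) 0 := by
    ext n
    rw [coeff_egf, coeff_egf, mul_add]
    congr 1
    simp only [neg_div, map_neg, neg_mul, Polynomial.coeff_neg, Polynomial.coeff_add,
      Polynomial.coeff_C_mul_X_pow]
    simp
  rw [e, h, ofNat_eq_C 3]
  norm_num
  ring

/-! ## The coefficients of the convolution operator -/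

/-- The even part of the factors, uniformly in the parities. -/
def facS (i : ℕ) : PowerSeries ℝ :=
  PowerSeries.C (2 / 2 ^ i : ℝ) * PowerSeries.rescale 2 (egf polyS i) + egf polyQ i

/-- The odd part of the factors, uniformly in the parities. -/
def facR (i : ℕ) : PowerSeries ℝ :=
  PowerSeries.C (2 / 2 ^ i : ℝ) * PowerSeries.rescale 2 (egf polyR i) + egf polyP i

/-- The odd part of the factors for the constant coefficient. -/
def facY : PowerSeries ℝ :=
  2 * PowerSeries.rescale 2 (2 * egf polyR 0 + egf polyY 0) + 2 * egf polyP 0 + egf polyZ 0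

/-- Rescaling x to 2x brings the families over sin 3x to the denominator sin 6x. It also multiplies
x^i by 2^i, which the weight 2/2^i undoes; this explains the powers of two in A, …, G. -/
theorem C_mul_rescale_mono (i : ℕ) :
    PowerSeries.C (2 / 2 ^ i : ℝ) * PowerSeries.rescale 2 (mono i) = 2 * mono i := by
  have e : PowerSeries.rescale 2 (PowerSeries.C (1 / i ! : ℝ)) = PowerSeries.C (1 / i ! : ℝ) := by
    ext n
    rw [PowerSeries.coeff_rescale, PowerSeries.coeff_C]
    split_ifs with h <;> simp [h]
  rw [mono, map_mul, e, map_pow, PowerSeries.rescale_X, mul_pow, ofNat_eq_C 2]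
  have : PowerSeries.C (2 / 2 ^ i : ℝ) * PowerSeries.C 2 ^ i = PowerSeries.C 2 := by
    rw [← map_pow, ← map_mul]; congr 1; field_simp
  linear_combination PowerSeries.C (1 / (i ! : ℝ)) * PowerSeries.X ^ i * this

theorem sinS_mul_facS (i : ℕ) :
    sinS 6 * facS i = 3 * (mono i * (sinS 5 - sinS 1 - sinS 4 + sinS 2)) := by
  have h := congrArg (PowerSeries.rescale 2) (sinS_mul_egf_polyS i)
  simp only [map_mul, map_sub, rescale_sinS, map_neg, map_ofNat] at h
  norm_num at h
  have h2 := sinS_mul_egf_polyQ i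
  have h3 := C_mul_rescale_mono i
  have two := ofNat_ne_zero_series 2
  apply mul_left_cancel₀ two
  rw [facS]
  linear_combination PowerSeries.C (2 / 2 ^ i : ℝ) * h + 2 * h2 - 3 * (sinS 4 - sinS 2) * h3

theorem sinS_mul_facR {i : ℕ} (hi : i ≠ 0) :
    sinS 6 * facR i = 3 * (mono i * (cosS 5 + cosS 1 + cosS 4 + cosS 2)) := by
  have h := congrArg (PowerSeries.rescale 2) (sinS_mul_egf_polyR i)
  simp only [map_mul, map_add, rescale_sinS, rescale_cosS, map_ofNat, if_neg hi,
    map_zero, sub_zero] at h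
  norm_num at h
  have h2 := sinS_mul_egf_polyP i
  simp only [if_neg hi, map_zero, sub_zero] at h2
  have h3 := C_mul_rescale_mono i
  have two := ofNat_ne_zero_series 2
  apply mul_left_cancel₀ two
  rw [facR]
  linear_combination PowerSeries.C (2 / 2 ^ i : ℝ) * h + 2 * h2 + 3 * (cosS 4 + cosS 2) * h3

theorem sinS_mul_facY :
    sinS 6 * facY = 6 * (cosS 4 + cosS 2 + cosS 5 + cosS 1 - 1 - cosS 6 - 2 * cosS 3) := by
  have h := congrArg (PowerSeries.rescale 2) (sinS_mul_egf_polyR 0)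
  have h1 := congrArg (PowerSeries.rescale 2) sinS_mul_egf_polyY
  simp only [map_mul, map_sub, map_add, rescale_sinS, rescale_cosS, map_ofNat, if_true, mono_zero,
    map_one] at h h1
  norm_num at h h1
  have h2 := sinS_mul_egf_polyP 0
  simp only [if_true, mono_zero, map_ofNat] at h2
  have h3 := sinS_mul_egf_polyZ
  rw [facY, map_add, map_mul, map_ofNat]
  linear_combination 2 * h + 2 * h1 + 2 * h2 + h3

-- Multiple angles and inversion of the symbol

theorem trigS_multiples :
    (sinS 2 = 2 * sinS 1 * cosS 1 ∧ cosS 2 = 2 * cosS 1 ^ 2 - 1) ∧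
    (sinS 3 = sinS 1 * (4 * cosS 1 ^ 2 - 1) ∧ cosS 3 = 4 * cosS 1 ^ 3 - 3 * cosS 1) ∧
    (sinS 4 = 2 * sinS 2 * cosS 2 ∧ cosS 4 = 2 * cosS 2 ^ 2 - 1) ∧
    (sinS 5 = sinS 3 * cosS 2 + cosS 3 * sinS 2 ∧ cosS 5 = cosS 3 * cosS 2 - sinS 3 * sinS 2) ∧
    (sinS 6 = 2 * sinS 3 * cosS 3 ∧ cosS 6 = 2 * cosS 3 ^ 2 - 1) := by
  have h2 := trigS_add 1 1
  have h3 := trigS_add 1 2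
  have h4 := trigS_add 2 2
  have h5 := trigS_add 3 2
  have h6 := trigS_add 3 3
  have q1 := cosS_sq_add_sinS_sq 1
  have q2 := cosS_sq_add_sinS_sq 2
  have q3 := cosS_sq_add_sinS_sq 3
  norm_num at h2 h3 h4 h5 h6
  have e2 : sinS 2 = 2 * sinS 1 * cosS 1 ∧ cosS 2 = 2 * cosS 1 ^ 2 - 1 :=
    ⟨by linear_combination h2.1, by linear_combination h2.2 - q1⟩
  refine ⟨e2, ⟨?_, ?_⟩, ⟨?_, ?_⟩, h5, ⟨?_, ?_⟩⟩
  · linear_combination h3.1 + cosS 1 * e2.1 + sinS 1 * e2.2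
  · linear_combination h3.2 - sinS 1 * e2.1 + cosS 1 * e2.2 - 2 * cosS 1 * q1
  · linear_combination h4.1
  · linear_combination h4.2 - q2
  · linear_combination h6.1
  · linear_combination h6.2 - q3

/-- The symbol `cos v - 1 + √3 sin v` of the inverse of the convolution. -/
def symbolD : PowerSeries ℝ := cosS 1 - 1 + PowerSeries.C √3 * sinS 1

/-- The exponential generating function in `j` of the coefficient of `g_i` in the convolution of
the basic density with `g_j`. -/
def convS (i : ℕ) : PowerSeries ℝ :=
  if i = 0 then PowerSeries.C (1 / 3 : ℝ) * facS 0 + PowerSeries.C (1 / (6 * √3)) * facY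
  else PowerSeries.C (1 / 6 : ℝ) * facS i + PowerSeries.C (1 / (2 * √3)) * facR i

theorem C_sqrt_three_sq : (PowerSeries.C √3) ^ 2 = (3 : PowerSeries ℝ) := by
  rw [← map_pow, Real.sq_sqrt (by norm_num), ofNat_eq_C 3]

theorem C_div_sqrt_three (n : ℕ) [n.AtLeastTwo] (x y : ℝ) (hxy : OfNat.ofNat n * x = y) :
    (OfNat.ofNat n : PowerSeries ℝ) * PowerSeries.C x = PowerSeries.C y := by
  rw [ofNat_eq_C, ← map_mul, hxy]

/-- Everything is reduced to polynomials in sin v and cos v. The common factor 2 cos 3v (2 cos v -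
1) then cancels against sin 6v, leaving the denominator sin v (2 cos v + 1). -/
theorem sinS_combination :
    sinS 5 - sinS 1 - sinS 4 + sinS 2 = 2 * cosS 3 * sinS 1 * (2 * cosS 1 - 1) ∧
    cosS 5 + cosS 1 + cosS 4 + cosS 2 = 2 * cosS 3 * (2 * cosS 1 - 1) * (cosS 1 + 1) ∧
    sinS 6 = 2 * cosS 3 * sinS 1 * (2 * cosS 1 - 1) * (2 * cosS 1 + 1) ∧
    cosS 4 + cosS 2 + cosS 5 + cosS 1 - 1 - cosS 6 - 2 * cosS 3 =
      -(4 * cosS 3 * (2 * cosS 1 - 1) * (cosS 1 ^ 2 - 1)) := by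
  obtain ⟨⟨s2, c2⟩, ⟨s3, c3⟩, ⟨s4, c4⟩, ⟨s5, c5⟩, ⟨s6, c6⟩⟩ := trigS_multiples
  have q1 := cosS_sq_add_sinS_sq 1
  refine ⟨?_, ?_, ?_, ?_⟩
  · rw [s5, s4, s3, c3, s2, c2]; ring
  · rw [c5, c4, s3, c3, s2, c2]
    linear_combination -(4 * cosS 1 ^ 2 - 1) * (2 * cosS 1) * q1
  · rw [s6, s3, c3]; ring
  · rw [c6, c5, c4, s3, c3, s2, c2]
    linear_combination -(4 * cosS 1 ^ 2 - 1) * (2 * cosS 1) * q1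

/-- After cancellation `convS i` is `mono i` times (sin v + √3 (cos v + 1))/(2 sin v (2 cos v + 1)),
and (cos v - 1 + √3 sin v)(sin v + √3 (cos v + 1)) = 2 sin v (2 cos v + 1). -/
theorem symbolD_mul_convS {i : ℕ} (hi : i ≠ 0) : symbolD * convS i = mono i := by
  apply mul_left_cancel₀ (sinS_ne_zero (show (6 : ℝ) ≠ 0 by norm_num))
  apply mul_left_cancel₀ (ofNat_ne_zero_series 6)
  rw [convS, if_neg hi, symbolD]
  have hS := sinS_mul_facS i
  have hR := sinS_mul_facR hi
  obtain ⟨t1, t2, t3, -⟩ := sinS_combination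
  have q1 := cosS_sq_add_sinS_sq 1
  have k1 := C_sqrt_three_sq
  have hs : √3 * √3 = 3 := Real.mul_self_sqrt (by norm_num)
  have k2 := C_div_sqrt_three 6 (1 / (2 * √3)) √3 (by field_simp; linarith)
  have k3 := C_div_sqrt_three 6 (1 / 6) 1 (by norm_num)
  rw [map_one] at k3
  have : 6 * (sinS 6 * ((cosS 1 - 1 + PowerSeries.C √3 * sinS 1) *
      (PowerSeries.C (1 / 6 : ℝ) * facS i + PowerSeries.C (1 / (2 * √3)) * facR i))) =
      (cosS 1 - 1 + PowerSeries.C √3 * sinS 1) *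
        ((sinS 6 * facS i) + PowerSeries.C √3 * (sinS 6 * facR i)) := by
    linear_combination (cosS 1 - 1 + PowerSeries.C √3 * sinS 1) * sinS 6 * (facS i * k3 + facR i * k2)
  rw [this, hS, hR, t1, t2, t3]
  linear_combination 6 * mono i * cosS 3 * (2 * cosS 1 - 1) *
    (PowerSeries.C √3 * q1 + sinS 1 * (cosS 1 + 1) * k1)

/-- The right side is 1 - (cos v - sin v/√3). The subtracted term is the numerator √3/2 cos v - 1/2
sin v of the generating function of the transforms, normalized to 1 at v = 0; it enters with the
factor γ_0 and so belongs to the index 0. -/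
theorem symbolD_mul_convS_zero :
    symbolD * convS 0 = 1 - cosS 1 + PowerSeries.C (1 / √3) * sinS 1 := by
  apply mul_left_cancel₀ (sinS_ne_zero (show (6 : ℝ) ≠ 0 by norm_num))
  apply mul_left_cancel₀ (ofNat_ne_zero_series 18)
  rw [convS, if_pos rfl, symbolD]
  have hS := sinS_mul_facS 0
  have hY := sinS_mul_facY
  rw [mono_zero, one_mul] at hS
  obtain ⟨t1, -, t3, t4⟩ := sinS_combination
  have q1 := cosS_sq_add_sinS_sq 1
  have k1 := C_sqrt_three_sq
  have hs : √3 * √3 = 3 := Real.mul_self_sqrt (by norm_num)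
  have k2 := C_div_sqrt_three 18 (1 / (6 * √3)) √3 (by field_simp; linarith)
  have k3 := C_div_sqrt_three 3 (1 / 3) 1 (by norm_num)
  have k4 := C_div_sqrt_three 3 (1 / √3) √3 (by field_simp; linarith)
  rw [map_one] at k3
  have : 18 * (sinS 6 * ((cosS 1 - 1 + PowerSeries.C √3 * sinS 1) *
      (PowerSeries.C (1 / 3 : ℝ) * facS 0 + PowerSeries.C (1 / (6 * √3)) * facY))) =
      (cosS 1 - 1 + PowerSeries.C √3 * sinS 1) *
        (6 * (sinS 6 * facS 0) + PowerSeries.C √3 * (sinS 6 * facY)) := by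
    linear_combination (cosS 1 - 1 + PowerSeries.C √3 * sinS 1) * sinS 6 *
      (6 * facS 0 * k3 + facY * k2)
  rw [this, hS, hY, t1, t4, t3]
  linear_combination 12 * cosS 3 * (2 * cosS 1 - 1) *
    (-2 * sinS 1 * (cosS 1 ^ 2 - 1) * k1 + (2 - 2 * cosS 1) * PowerSeries.C √3 * q1)
    - 12 * cosS 3 * sinS 1 ^ 2 * (2 * cosS 1 - 1) * (2 * cosS 1 + 1) * k4

/-- The symbol has a simple zero at the origin, with derivative √3 there, so dividing v^i by it
gives a series starting at v^{i-1}. Thus convolution raises the index by at most one. -/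
theorem coeff_convS_eq_zero {i j : ℕ} (h : j + 1 < i) : PowerSeries.coeff j (convS i) = 0 := by
  have hD : PowerSeries.X ∣ symbolD := by
    rw [PowerSeries.X_dvd_iff, symbolD, ← PowerSeries.coeff_zero_eq_constantCoeff_apply]
    simp only [map_add, map_sub, PowerSeries.coeff_C_mul, coeff_cosS, coeff_sinS,
      PowerSeries.coeff_one]
    simp
  obtain ⟨u, hu⟩ := hD
  have hu0 : PowerSeries.constantCoeff u ≠ 0 := by
    have := congrArg (PowerSeries.coeff 1) hu
    rw [PowerSeries.coeff_succ_X_mul, symbolD] at this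
    simp only [map_add, map_sub, PowerSeries.coeff_C_mul, coeff_cosS, coeff_sinS,
      PowerSeries.coeff_one] at this
    simp at this
    rw [← this]
    positivity
  have h1 := symbolD_mul_convS (show i ≠ 0 by omega)
  rw [hu] at h1
  have h2 : PowerSeries.X * convS i = u⁻¹ * mono i := by
    rw [← h1, ← mul_assoc, mul_left_comm u⁻¹, PowerSeries.inv_mul_cancel _ hu0, mul_one]
  rw [← PowerSeries.coeff_succ_X_mul, h2, mono, mul_left_comm, PowerSeries.coeff_C_mul, mul_comm,
    PowerSeries.coeff_mul_X_pow', if_neg (by omega), zero_mul]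

end MahlerQ
end

noncomputable section

namespace MahlerQ

/-! ## Identification of the factors in the recursions -/

/-- Since j is odd, k + 1 - j has the parity of k, so the recursion preserves the parity pattern of
its inhomogeneous terms. -/
theorem coeff_recPoly_eq_zero {m : ℝ} {g : ℕ → ℝ[X]} {e : ℕ}
    (hg : ∀ k i, Even (k + i + e) → (g k).coeff i = 0) (k i : ℕ) (hk : Even (k + i + e)) :
    (recPoly m g k).coeff i = 0 := by
  induction k using Nat.strong_induction_on with
  | _ k ih =>
    rw [recPoly_eq, Polynomial.coeff_add, hg k i hk, add_zero, Polynomial.coeff_C_mul,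
      Polynomial.finsetSum_coeff, Finset.sum_eq_zero, mul_zero]
    intro j hj
    simp only [Finset.mem_filter, Finset.mem_Icc] at hj
    rw [Polynomial.coeff_C_mul, ih _ (by omega), mul_zero]
    obtain ⟨⟨h2, hle⟩, q, rfl⟩ := hj
    obtain ⟨r, hr⟩ := hk
    exact ⟨r - q, by omega⟩

theorem coeff_filter_eq_zero (p : ℕ → Prop) [DecidablePred p] (q : ℕ → ℝ) (f : ℕ → ℕ → ℝ)
    {k i : ℕ} (h : i ≤ k + 1 → ¬ p (k + 1 - i)) :
    (Polynomial.C (q k) * ∑ j ∈ (Finset.range (k + 2)).filter p,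
        Polynomial.C (f k j) * Polynomial.X ^ (k + 1 - j)).coeff i = 0 := by
  rw [Polynomial.coeff_C_mul, coeff_sum_filter, if_neg (fun hh => h hh.1 hh.2), mul_zero]

theorem not_even_sub {k i : ℕ} (h : Even (k + i)) (hi : i ≤ k + 1) : ¬ Even (k + 1 - i) := by
  rw [Nat.even_iff] at *
  omega

theorem not_odd_sub {k i : ℕ} (h : Even (k + i + 1)) (hi : i ≤ k + 1) : ¬ Odd (k + 1 - i) := by
  rw [Nat.odd_iff]
  rw [Nat.even_iff] at *
  omega

theorem coeff_polyR_eq_zero {k i : ℕ} (h : Even (k + i)) : (polyR k).coeff i = 0 :=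
  coeff_recPoly_eq_zero (e := 0) (fun k i h => coeff_filter_eq_zero Even (fun k : ℕ => 1 / (2 * ((k : ℝ) + 1)))
    (fun k j => (-1) ^ (j / 2) * ((k + 1).choose j : ℝ) * (2 ^ j + 1)) (not_even_sub (k := k) (i := i) h)) k i h

theorem coeff_polyP_eq_zero {k i : ℕ} (h : Even (k + i)) : (polyP k).coeff i = 0 :=
  coeff_recPoly_eq_zero (e := 0) (fun k i h => coeff_filter_eq_zero Even (fun k : ℕ => 1 / (2 * ((k : ℝ) + 1)))
    (fun k j => (-1) ^ (j / 2) * ((k + 1).choose j : ℝ) * (5 ^ j + 1)) (not_even_sub (k := k) (i := i) h)) k i h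

theorem coeff_polyS_eq_zero {k i : ℕ} (h : Even (k + i + 1)) : (polyS k).coeff i = 0 :=
  coeff_recPoly_eq_zero (e := 1) (fun k i h => coeff_filter_eq_zero Odd (fun k : ℕ => 1 / (2 * ((k : ℝ) + 1)))
    (fun k j => (-1) ^ ((j + 1) / 2) * ((k + 1).choose j : ℝ) * (2 ^ j - 1)) (not_odd_sub (k := k) (i := i) h)) k i h

theorem coeff_polyQ_eq_zero {k i : ℕ} (h : Even (k + i + 1)) : (polyQ k).coeff i = 0 :=
  coeff_recPoly_eq_zero (e := 1) (fun k i h => coeff_filter_eq_zero Odd (fun k : ℕ => 1 / (2 * ((k : ℝ) + 1)))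
    (fun k j => (-1) ^ ((j - 1) / 2) * ((k + 1).choose j : ℝ) * (5 ^ j - 1)) (not_odd_sub (k := k) (i := i) h)) k i h

theorem coeff_polyZ_eq_zero {k i : ℕ} (h : Even (k + i)) : (polyZ k).coeff i = 0 :=
  coeff_recPoly_eq_zero (e := 0) (fun k i h => by
    rw [Polynomial.coeff_neg, neg_eq_zero]
    exact coeff_filter_eq_zero Even (fun k : ℕ => 2 / ((k : ℝ) + 1))
      (fun k j => (-1) ^ (j / 2) * ((k + 1).choose j : ℝ) * 3 ^ j) (not_even_sub (k := k) (i := i) h)) k i h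

theorem coeff_polyY_eq_zero {k i : ℕ} (h : Even (k + i)) : (polyY k).coeff i = 0 :=
  coeff_recPoly_eq_zero (e := 0) (fun k i h => by
    rw [Polynomial.coeff_neg, neg_eq_zero, mul_add, Polynomial.coeff_add,
      coeff_filter_eq_zero Even (fun k : ℕ => 1 / ((k : ℝ) + 1))
      (fun k j => (-1) ^ (j / 2) * ((k + 1).choose j : ℝ) * 3 ^ j) (not_even_sub (k := k) (i := i) h),
      Polynomial.coeff_C_mul, Polynomial.coeff_X_pow, if_neg, mul_zero, add_zero]
    rintro rfl
    rw [Nat.even_iff] at h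
    omega) k i h

/-- The coefficient of `g_i` in the convolution of the basic density with `g_j`. -/
def conv (j i : ℕ) : ℝ := j ! * PowerSeries.coeff j (convS i)

theorem conv_eq_zero {i j : ℕ} (h : j + 1 < i) : conv j i = 0 := by
  rw [conv, coeff_convS_eq_zero h, mul_zero]

theorem factorial_mul_coeff_facS (i j : ℕ) : j ! * PowerSeries.coeff j (facS i) =
    2 / 2 ^ i * 2 ^ j * (polyS j).coeff i + (polyQ j).coeff i := by
  rw [facS, map_add, PowerSeries.coeff_C_mul, PowerSeries.coeff_rescale, coeff_egf, coeff_egf]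
  have : (j ! : ℝ) ≠ 0 := by positivity
  field_simp

theorem factorial_mul_coeff_facR (i j : ℕ) : j ! * PowerSeries.coeff j (facR i) =
    2 / 2 ^ i * 2 ^ j * (polyR j).coeff i + (polyP j).coeff i := by
  rw [facR, map_add, PowerSeries.coeff_C_mul, PowerSeries.coeff_rescale, coeff_egf, coeff_egf]
  have : (j ! : ℝ) ≠ 0 := by positivity
  field_simp

theorem factorial_mul_coeff_facY (j : ℕ) : j ! * PowerSeries.coeff j facY =
    2 * 2 ^ j * (2 * (polyR j).coeff 0 + (polyY j).coeff 0) + 2 * (polyP j).coeff 0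
      + (polyZ j).coeff 0 := by
  rw [facY, map_add, map_add, ofNat_eq_C 2, PowerSeries.coeff_C_mul, PowerSeries.coeff_C_mul,
    PowerSeries.coeff_rescale, map_add, PowerSeries.coeff_C_mul, coeff_egf, coeff_egf, coeff_egf,
    coeff_egf]
  have : (j ! : ℝ) ≠ 0 := by positivity
  field_simp

theorem conv_of_ne_zero (j : ℕ) {i : ℕ} (hi : i ≠ 0) : conv j i =
    1 / 6 * (2 / 2 ^ i * 2 ^ j * (polyS j).coeff i + (polyQ j).coeff i) +
    1 / (2 * √3) * (2 / 2 ^ i * 2 ^ j * (polyR j).coeff i + (polyP j).coeff i) := by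
  rw [← factorial_mul_coeff_facS, ← factorial_mul_coeff_facR, conv, convS, if_neg hi, map_add,
    PowerSeries.coeff_C_mul, PowerSeries.coeff_C_mul]
  ring

theorem conv_zero (j : ℕ) : conv j 0 =
    1 / 3 * (2 * 2 ^ j * (polyS j).coeff 0 + (polyQ j).coeff 0) +
    1 / (6 * √3) * (2 * 2 ^ j * (2 * (polyR j).coeff 0 + (polyY j).coeff 0)
      + 2 * (polyP j).coeff 0 + (polyZ j).coeff 0) := by
  have h := factorial_mul_coeff_facS 0 j
  rw [pow_zero, div_one] at h
  rw [← h, ← factorial_mul_coeff_facY, conv, convS, if_pos rfl, map_add,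
    PowerSeries.coeff_C_mul, PowerSeries.coeff_C_mul]
  ring

/-- The normalization 2√3 turns the weights 1/6, 1/(2√3), 1/3 and 1/(6√3) of the convolution series
into 1/√3, 1, 2/√3 and 1/3, the scalars of the recursions for a, b, c, d. -/
theorem two_sqrt_three_mul {x : ℝ} : 2 * √3 * (1 / 6 * x) = 1 / √3 * x := by
  have hs : √3 * √3 = 3 := Real.mul_self_sqrt (by norm_num)
  field_simp
  linear_combination 2 * x * hs

/-- By parity, only the S and T families survive when the two indices have the same parity, and only
R, P, Y, Z when they differ. This and the next five lemmas match the cases with the factors A, …, G.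
-/
theorem conv_odd_odd (l h : ℕ) :
    2 * √3 * conv (2 * l + 1) (2 * h + 1) = 1 / √3 * facA (l + 1) (h + 1) := by
  rw [conv_of_ne_zero _ (by omega), coeff_polyR_eq_zero (by rw [Nat.even_iff]; omega),
    coeff_polyP_eq_zero (by rw [Nat.even_iff]; omega), mul_zero, add_zero, mul_zero, add_zero,
    two_sqrt_three_mul, facA, oddCoeff, oddCoeff]
  have e1 : 2 * (l + 1) - 1 = 2 * l + 1 := by omega
  have e2 : 2 * (h + 1) - 1 = 2 * h + 1 := by omega
  have e3 : (2 * ((l + 1 : ℕ) : ℤ) - 2 * ((h + 1 : ℕ) : ℤ) + 1) =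
      1 - ((2 * h + 1 : ℕ) : ℤ) + ((2 * l + 1 : ℕ) : ℤ) := by push_cast; ring
  rw [e1, e2, e3, zpow_add₀ two_ne_zero, zpow_sub₀ two_ne_zero, zpow_natCast, zpow_natCast, zpow_one]

theorem conv_even_odd (l h : ℕ) :
    2 * √3 * conv (2 * l) (2 * h + 1) = facB l (h + 1) := by
  rw [conv_of_ne_zero _ (by omega), coeff_polyS_eq_zero (by rw [Nat.even_iff]; omega),
    coeff_polyQ_eq_zero (by rw [Nat.even_iff]; omega), mul_zero, add_zero, mul_zero, zero_add,
    facB, oddCoeff, oddCoeff, ← mul_assoc, mul_one_div_cancel (by positivity), one_mul]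
  have e2 : 2 * (h + 1) - 1 = 2 * h + 1 := by omega
  have e3 : (2 * (l : ℤ) - 2 * ((h + 1 : ℕ) : ℤ) + 2) =
      1 - ((2 * h + 1 : ℕ) : ℤ) + ((2 * l : ℕ) : ℤ) := by push_cast; ring
  rw [e2, e3, zpow_add₀ two_ne_zero, zpow_sub₀ two_ne_zero, zpow_natCast, zpow_natCast, zpow_one]

theorem conv_odd_even (l h : ℕ) :
    2 * √3 * conv (2 * l + 1) (2 * (h + 1)) = facC (l + 1) (h + 1) := by
  rw [conv_of_ne_zero _ (by omega), coeff_polyS_eq_zero (by rw [Nat.even_iff]; omega),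
    coeff_polyQ_eq_zero (by rw [Nat.even_iff]; omega), mul_zero, add_zero, mul_zero, zero_add,
    facC, evenCoeff, evenCoeff, ← mul_assoc, mul_one_div_cancel (by positivity), one_mul]
  have e1 : 2 * (l + 1) - 1 = 2 * l + 1 := by omega
  have e3 : (2 * ((l + 1 : ℕ) : ℤ) - 2 * ((h + 1 : ℕ) : ℤ)) =
      1 - ((2 * (h + 1) : ℕ) : ℤ) + ((2 * l + 1 : ℕ) : ℤ) := by push_cast; ring
  rw [e1, e3, zpow_add₀ two_ne_zero, zpow_sub₀ two_ne_zero, zpow_natCast, zpow_natCast, zpow_one]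

theorem conv_even_even (l h : ℕ) :
    2 * √3 * conv (2 * l) (2 * (h + 1)) = 1 / √3 * facD l (h + 1) := by
  rw [conv_of_ne_zero _ (by omega), coeff_polyR_eq_zero (by rw [Nat.even_iff]; omega),
    coeff_polyP_eq_zero (by rw [Nat.even_iff]; omega), mul_zero, add_zero, mul_zero, add_zero,
    two_sqrt_three_mul, facD, evenCoeff, evenCoeff]
  have e3 : (2 * (l : ℤ) - 2 * ((h + 1 : ℕ) : ℤ) + 1) =
      1 - ((2 * (h + 1) : ℕ) : ℤ) + ((2 * l : ℕ) : ℤ) := by push_cast; ring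
  rw [e3, zpow_add₀ two_ne_zero, zpow_sub₀ two_ne_zero, zpow_natCast, zpow_natCast, zpow_one]

theorem conv_odd_zero (l : ℕ) :
    2 * √3 * conv (2 * l + 1) 0 = 1 / 3 * facE (l + 1) := by
  rw [conv_zero, coeff_polyS_eq_zero (by rw [Nat.even_iff]; omega),
    coeff_polyQ_eq_zero (by rw [Nat.even_iff]; omega), mul_zero, add_zero, mul_zero, zero_add,
    facE]
  have e1 : 2 * (l + 1) - 1 = 2 * l + 1 := by omega
  have e2 : 2 * (l + 1) = 2 * l + 1 + 1 := by omega
  rw [e1, e2, pow_succ]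
  simp only [evenCoeff, mul_zero]
  field_simp
  ring

theorem conv_even_zero (l : ℕ) :
    2 * √3 * conv (2 * l) 0 = 2 / √3 * facG l := by
  rw [conv_zero, coeff_polyR_eq_zero (by rw [Nat.even_iff]; omega),
    coeff_polyP_eq_zero (by rw [Nat.even_iff]; omega),
    coeff_polyY_eq_zero (by rw [Nat.even_iff]; omega),
    coeff_polyZ_eq_zero (by rw [Nat.even_iff]; omega), facG, pow_succ]
  simp only [evenCoeff, mul_zero]
  have hs : √3 * √3 = 3 := Real.mul_self_sqrt (by norm_num)
  field_simp
  linear_combination 6 * (2 * 2 ^ (2 * l) * (polyS (2 * l)).coeff 0 + (polyQ (2 * l)).coeff 0) * hs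

/-! ## The recursion in terms of an abstract family of transforms -/

theorem sum_Icc_eq_range (n lo : ℕ) (f : ℕ → ℝ) (hf : ∀ l < lo, f l = 0) :
    ∑ l ∈ Finset.Icc lo n, f l = ∑ l ∈ Finset.range (n + 1), f l := by
  refine Finset.sum_subset (fun x hx => ?_) fun x _ hx => hf x ?_
  · simp only [Finset.mem_Icc] at hx; simp only [Finset.mem_range]; omega
  · simp only [Finset.mem_Icc, Finset.mem_range] at *; omega

theorem sum_Icc_succ_eq_range (n lo : ℕ) (f : ℕ → ℝ) (hf : ∀ l < lo, f (l + 1) = 0) :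
    ∑ l ∈ Finset.Icc (lo + 1) n, f l = ∑ l ∈ Finset.range n, f (l + 1) := by
  cases n with
  | zero => simp
  | succ n =>
    rw [← sum_Icc_eq_range n lo (fun l => f (l + 1)) hf]
    exact Finset.sum_bij' (fun l _ => l - 1) (fun l _ => l + 1)
      (by intro x hx; simp only [Finset.mem_Icc] at *; omega)
      (by intro x hx; simp only [Finset.mem_Icc] at *; omega)
      (by intro x hx; simp only [Finset.mem_Icc] at *; omega)
      (by intro x hx; simp)
      (by intro x hx; simp only [Finset.mem_Icc] at *; congr 1; omega)

/-- `w` acts on the family `γ` by the convolution matrix. -/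
def IsConv (w : ℝ) (γ : ℕ → ℝ) : Prop :=
  ∀ j, w * γ j = ∑ i ∈ Finset.range (j + 2), conv j i * γ i

/-- The matrix entries with column above j + 1 vanish, so both parity classes may be summed up to
any sufficiently large bound. The freedom in N and N' lets all terms of a combination share one
range. -/
theorem IsConv.apply {w : ℝ} {γ : ℕ → ℝ} (h : IsConv w γ) {j N N' : ℕ} (hN : j < 2 * N)
    (hN' : j + 1 < 2 * N') :
    w * γ j = ∑ k ∈ Finset.range N, conv j (2 * k + 1) * γ (2 * k + 1) +
      ∑ k ∈ Finset.range N', conv j (2 * k) * γ (2 * k) := by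
  have ext : ∀ {A B : ℕ} (f : ℕ → ℝ), A ≤ B → (∀ k, A ≤ k → f k = 0) →
      ∑ k ∈ Finset.range A, f k = ∑ k ∈ Finset.range B, f k := by
    intro A B f hAB hf
    refine Finset.sum_subset (Finset.range_mono hAB) fun x _ hx => hf x ?_
    simpa using hx
  have hsplit : ∀ (K : ℕ) (f : ℕ → ℝ), ∑ i ∈ Finset.range (2 * K), f i =
      ∑ k ∈ Finset.range K, f (2 * k + 1) + ∑ k ∈ Finset.range K, f (2 * k) := by
    intro K f
    induction K with
    | zero => simp
    | succ K ih =>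
      rw [show 2 * (K + 1) = 2 * K + 1 + 1 by ring, Finset.sum_range_succ, Finset.sum_range_succ,
        ih, Finset.sum_range_succ, Finset.sum_range_succ]
      ring
  rw [h j, ext (B := 2 * (N + N')) (fun i => conv j i * γ i) (by omega)
    (fun k hk => by rw [conv_eq_zero (by omega), zero_mul]), hsplit,
    ext (A := N) (B := N + N') (fun k => conv j (2 * k + 1) * γ (2 * k + 1)) (by omega)
      (fun k hk => by rw [conv_eq_zero (by omega), zero_mul]),
    ext (A := N') (B := N + N') (fun k => conv j (2 * k) * γ (2 * k)) (by omega)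
      (fun k hk => by rw [conv_eq_zero (by omega), zero_mul])]

/-- One step of the recursion. -/
theorem IsConv.step {w : ℝ} {γ : ℕ → ℝ} (h : IsConv w γ) (p q : ℕ → ℝ) {n n' N N' : ℕ}
    (h1 : n ≤ N) (h2 : n' ≤ N) (h3 : n + 1 ≤ N') (h4 : n' ≤ N') :
    2 * √3 * w * (∑ l ∈ Finset.range n, p l * γ (2 * l + 1) +
        ∑ l ∈ Finset.range n', q l * γ (2 * l)) =
      ∑ k ∈ Finset.range N, (∑ l ∈ Finset.range n, p l * (2 * √3 * conv (2 * l + 1) (2 * k + 1)) +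
        ∑ l ∈ Finset.range n', q l * (2 * √3 * conv (2 * l) (2 * k + 1))) * γ (2 * k + 1) +
      ∑ k ∈ Finset.range N', (∑ l ∈ Finset.range n, p l * (2 * √3 * conv (2 * l + 1) (2 * k)) +
        ∑ l ∈ Finset.range n', q l * (2 * √3 * conv (2 * l) (2 * k))) * γ (2 * k) := by
  have e1 : ∀ l ∈ Finset.range n, 2 * √3 * w * (p l * γ (2 * l + 1)) =
      ∑ k ∈ Finset.range N, p l * (2 * √3 * conv (2 * l + 1) (2 * k + 1)) * γ (2 * k + 1) +
      ∑ k ∈ Finset.range N', p l * (2 * √3 * conv (2 * l + 1) (2 * k)) * γ (2 * k) := by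
    intro l hl
    rw [Finset.mem_range] at hl
    rw [show 2 * √3 * w * (p l * γ (2 * l + 1)) = 2 * √3 * p l * (w * γ (2 * l + 1)) by ring,
      h.apply (N := N) (N' := N') (by omega) (by omega), mul_add, Finset.mul_sum, Finset.mul_sum]
    congr 1 <;> exact Finset.sum_congr rfl fun k _ => by ring
  have e2 : ∀ l ∈ Finset.range n', 2 * √3 * w * (q l * γ (2 * l)) =
      ∑ k ∈ Finset.range N, q l * (2 * √3 * conv (2 * l) (2 * k + 1)) * γ (2 * k + 1) +
      ∑ k ∈ Finset.range N', q l * (2 * √3 * conv (2 * l) (2 * k)) * γ (2 * k) := by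
    intro l hl
    rw [Finset.mem_range] at hl
    rw [show 2 * √3 * w * (q l * γ (2 * l)) = 2 * √3 * q l * (w * γ (2 * l)) by ring,
      h.apply (N := N) (N' := N') (by omega) (by omega), mul_add, Finset.mul_sum, Finset.mul_sum]
    congr 1 <;> exact Finset.sum_congr rfl fun k _ => by ring
  rw [mul_add, Finset.mul_sum, Finset.mul_sum, Finset.sum_congr rfl e1, Finset.sum_congr rfl e2,
    Finset.sum_add_distrib, Finset.sum_add_distrib]
  simp only [add_mul, Finset.sum_add_distrib, Finset.sum_mul]
  rw [Finset.sum_comm (s := Finset.range n) (t := Finset.range N),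
    Finset.sum_comm (s := Finset.range n) (t := Finset.range N'),
    Finset.sum_comm (s := Finset.range n') (t := Finset.range N),
    Finset.sum_comm (s := Finset.range n') (t := Finset.range N')]
  ring

/-- The lower summation limits of the recursions only discard vanishing matrix entries, so each
recursion is a full matrix product. The same holds for b, c and d below. -/
theorem a_succ (n k : ℕ) : a (n + 1) k =
    ∑ l ∈ Finset.range n, c n l * (2 * √3 * conv (2 * l + 1) (2 * k + 1)) +
      ∑ l ∈ Finset.range (n + 1), d n l * (2 * √3 * conv (2 * l) (2 * k + 1)) := by
  rw [a, Finset.mul_sum, sum_Icc_succ_eq_range, sum_Icc_eq_range]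
  · congr 1
    · exact Finset.sum_congr rfl fun l _ => by rw [conv_odd_odd, Nat.add_sub_cancel]; ring
    · exact Finset.sum_congr rfl fun l _ => by rw [conv_even_odd]
  · intro l hl
    rw [← conv_even_odd, conv_eq_zero (by omega)]; simp
  · intro l hl
    have := conv_odd_odd l k
    rw [conv_eq_zero (by omega), mul_zero] at this
    rw [mul_left_comm, ← this, mul_zero]

theorem b_succ (n k : ℕ) : b (n + 1) k =
    ∑ l ∈ Finset.range n, c n l * (2 * √3 * conv (2 * l + 1) (2 * k)) +
      ∑ l ∈ Finset.range (n + 1), d n l * (2 * √3 * conv (2 * l) (2 * k)) := by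
  cases k with
  | zero =>
    rw [b, Finset.mul_sum, Finset.mul_sum, sum_Icc_succ_eq_range, sum_Icc_eq_range]
    · congr 1
      · exact Finset.sum_congr rfl fun l _ => by rw [mul_zero, conv_odd_zero, Nat.add_sub_cancel]; ring
      · exact Finset.sum_congr rfl fun l _ => by rw [mul_zero, conv_even_zero]; ring
    · simp
    · simp
  | succ k =>
    rw [b, Finset.mul_sum, sum_Icc_succ_eq_range, sum_Icc_eq_range]
    · congr 1
      · exact Finset.sum_congr rfl fun l _ => by rw [conv_odd_even, Nat.add_sub_cancel]
      · exact Finset.sum_congr rfl fun l _ => by rw [conv_even_even]; ring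
    · intro l hl
      have := conv_even_even l k
      rw [conv_eq_zero (by omega), mul_zero] at this
      rw [mul_left_comm, ← this, mul_zero]
    · intro l hl
      rw [← conv_odd_even, conv_eq_zero (by omega)]; simp

theorem c_succ (n k : ℕ) : c (n + 1) k =
    ∑ l ∈ Finset.range (n + 1), a (n + 1) l * (2 * √3 * conv (2 * l + 1) (2 * k + 1)) +
      ∑ l ∈ Finset.range (n + 1), b (n + 1) l * (2 * √3 * conv (2 * l) (2 * k + 1)) := by
  rw [c, Finset.mul_sum, sum_Icc_succ_eq_range, sum_Icc_eq_range]
  · congr 1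
    · exact Finset.sum_congr rfl fun l _ => by rw [conv_odd_odd, Nat.add_sub_cancel]; ring
    · exact Finset.sum_congr rfl fun l _ => by rw [conv_even_odd]
  · intro l hl
    rw [← conv_even_odd, conv_eq_zero (by omega)]; simp
  · intro l hl
    have := conv_odd_odd l k
    rw [conv_eq_zero (by omega), mul_zero] at this
    rw [mul_left_comm, ← this, mul_zero]

theorem d_succ (n k : ℕ) : d (n + 1) k =
    ∑ l ∈ Finset.range (n + 1), a (n + 1) l * (2 * √3 * conv (2 * l + 1) (2 * k)) +
      ∑ l ∈ Finset.range (n + 1), b (n + 1) l * (2 * √3 * conv (2 * l) (2 * k)) := by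
  cases k with
  | zero =>
    rw [d, Finset.mul_sum, Finset.mul_sum, sum_Icc_succ_eq_range, sum_Icc_eq_range]
    · congr 1
      · exact Finset.sum_congr rfl fun l _ => by rw [mul_zero, conv_odd_zero, Nat.add_sub_cancel]; ring
      · exact Finset.sum_congr rfl fun l _ => by rw [mul_zero, conv_even_zero]; ring
    · simp
    · simp
  | succ k =>
    rw [d, Finset.mul_sum, sum_Icc_succ_eq_range, sum_Icc_eq_range]
    · congr 1
      · exact Finset.sum_congr rfl fun l _ => by rw [conv_odd_even, Nat.add_sub_cancel]
      · exact Finset.sum_congr rfl fun l _ => by rw [conv_even_even]; ring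
    · intro l hl
      have := conv_even_even l k
      rw [conv_eq_zero (by omega), mul_zero] at this
      rw [mul_left_comm, ← this, mul_zero]
    · intro l hl
      rw [← conv_odd_even, conv_eq_zero (by omega)]; simp

/-- The combination attached to an even number of factors. -/
def combEven (γ : ℕ → ℝ) (n : ℕ) : ℝ :=
  ∑ l ∈ Finset.range n, a n l * γ (2 * l + 1) + ∑ l ∈ Finset.range n, b n l * γ (2 * l)

/-- The combination attached to an odd number of factors. -/
def combOdd (γ : ℕ → ℝ) (n : ℕ) : ℝ :=
  ∑ l ∈ Finset.range n, c n l * γ (2 * l + 1) + ∑ l ∈ Finset.range (n + 1), d n l * γ (2 * l)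

theorem IsConv.combEven_succ {w : ℝ} {γ : ℕ → ℝ} (h : IsConv w γ) (n : ℕ) :
    combEven γ (n + 1) = 2 * √3 * w * combOdd γ n := by
  rw [combOdd, h.step (c n) (d n) (N := n + 1) (N' := n + 1) (by omega) (by omega) (by omega)
    (by omega), combEven]
  simp only [a_succ, b_succ]

/-- The largest odd index 2n + 1 is sent up to 2n + 2, so the even part gains one term here; hence
N' = n + 2. -/
theorem IsConv.combOdd_succ {w : ℝ} {γ : ℕ → ℝ} (h : IsConv w γ) (n : ℕ) :
    combOdd γ (n + 1) = 2 * √3 * w * combEven γ (n + 1) := by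
  rw [combEven, h.step (a (n + 1)) (b (n + 1)) (N := n + 1) (N' := n + 2) (by omega) (by omega)
    (by omega) (by omega), combOdd]
  simp only [c_succ, d_succ]

/-- The start is d_{0,0} γ_0 = √3 w, and two steps multiply by (2√3 w)² = 12 w². -/
theorem IsConv.combOdd_eq {w : ℝ} {γ : ℕ → ℝ} (h : IsConv w γ) (h0 : γ 0 = √3 * w) (n : ℕ) :
    1 / 12 ^ n * (1 / √3) * combOdd γ n = w ^ (2 * n + 1) := by
  have hs : √3 * √3 = 3 := Real.mul_self_sqrt (by norm_num)
  induction n with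
  | zero => simp [combOdd, d, h0]
  | succ n ih =>
    rw [h.combOdd_succ, h.combEven_succ, show 2 * (n + 1) + 1 = 2 * n + 1 + 2 by ring,
      pow_add w, ← ih, pow_succ (12 : ℝ)]
    field_simp
    linear_combination 4 * w ^ 2 * combOdd γ n * hs

theorem IsConv.combEven_eq {w : ℝ} {γ : ℕ → ℝ} (h : IsConv w γ) (h0 : γ 0 = √3 * w) {n : ℕ}
    (hn : n ≠ 0) : 2 / 12 ^ n * combEven γ n = w ^ (2 * n) := by
  obtain ⟨n, rfl⟩ := Nat.exists_eq_succ_of_ne_zero hn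
  have hs : √3 * √3 = 3 := Real.mul_self_sqrt (by norm_num)
  rw [Nat.succ_eq_add_one, h.combEven_succ, show 2 * (n + 1) = 2 * n + 1 + 1 by ring, pow_succ w,
    ← h.combOdd_eq h0, pow_succ (12 : ℝ)]
  field_simp
  linear_combination 4 * w * combOdd γ n * hs

/-- The generating function identity for the transforms implies the convolution identity. -/
theorem isConv_of_series {x : ℝ} (hx : 2 * x - 1 ≠ 0) {γ : ℕ → ℝ}
    (h : (PowerSeries.C x - PowerSeries.C (1 / 2) * cosS 1 - PowerSeries.C (√3 / 2) * sinS 1) *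
        PowerSeries.mk (fun j => γ j / j !) =
      PowerSeries.C (√3 / 2) * cosS 1 - PowerSeries.C (1 / 2) * sinS 1) :
    γ 0 = √3 * (1 / (2 * x - 1)) ∧ IsConv (1 / (2 * x - 1)) γ := by
  have hs : √3 * √3 = 3 := Real.mul_self_sqrt (by norm_num)
  -- The constant coefficients give (x - 1/2) γ_0 = √3/2.
  have h0 : γ 0 = √3 * (1 / (2 * x - 1)) := by
    have := congrArg (PowerSeries.coeff 0) h
    rw [PowerSeries.coeff_mul] at this
    simp only [Finset.Nat.antidiagonal_zero, Finset.sum_singleton, map_sub, PowerSeries.coeff_C_mul,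
      coeff_cosS, coeff_sinS, PowerSeries.coeff_mk, PowerSeries.coeff_C] at this
    simp at this
    field_simp
    linear_combination 2 * this
  refine ⟨h0, ?_⟩
  set w := 1 / (2 * x - 1) with hw
  have hwx : w * (2 * x - 1) = 1 := by rw [hw]; field_simp
  have hD : symbolD ≠ 0 := by
    intro h
    have := congrArg (PowerSeries.coeff 1) h
    rw [symbolD] at this
    simp only [map_add, map_sub, PowerSeries.coeff_C_mul, coeff_cosS, coeff_sinS,
      PowerSeries.coeff_one] at this
    simp at this
  set Γ := PowerSeries.mk (fun j => γ j / j !) with hΓ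
  set N := PowerSeries.mk (fun j => (∑ i ∈ Finset.range (j + 2), conv j i * γ i) / j !) with hN
  have key : symbolD * (PowerSeries.C w * Γ) = symbolD * N := by
    -- This is the hypothesis multiplied by 2w, with 2xw = 1 + w substituted to eliminate x.
    have e1 : symbolD * (PowerSeries.C w * Γ) =
        Γ - PowerSeries.C (γ 0) * (cosS 1 - PowerSeries.C (1 / √3) * sinS 1) := by
      have k1 := C_div_sqrt_three 2 (1 / 2) 1 (by norm_num)
      have k2 := C_div_sqrt_three 2 (√3 / 2) √3 (by ring)
      have k3 : PowerSeries.C w * (2 * PowerSeries.C x - 1) = 1 := by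
        rw [ofNat_eq_C 2, ← map_mul, ← map_one PowerSeries.C, ← map_sub, ← map_mul, hwx]
      have k4 : PowerSeries.C √3 * PowerSeries.C (1 / √3) = 1 := by
        rw [← map_mul, mul_one_div_cancel (by positivity), map_one]
      rw [map_one] at k1
      rw [h0, map_mul, symbolD]
      linear_combination -2 * PowerSeries.C w * h + Γ * k3 - PowerSeries.C w * Γ * cosS 1 * k1
        - PowerSeries.C w * Γ * sinS 1 * k2 + PowerSeries.C w * sinS 1 * k1
        - PowerSeries.C w * cosS 1 * k2 - PowerSeries.C w * sinS 1 * k4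
    -- Since D · `convS i` = v^i/i! for i ≥ 1, the sum over i rebuilds Γ, and the index 0 supplies
    -- the correction. The vanishing entries allow a single range of i for all coefficients up to k.
    have e2 : symbolD * N =
        Γ - PowerSeries.C (γ 0) * (cosS 1 - PowerSeries.C (1 / √3) * sinS 1) := by
      ext k
      have h1 : ∀ p ∈ Finset.HasAntidiagonal.antidiagonal k,
          PowerSeries.coeff p.1 symbolD * PowerSeries.coeff p.2 N =
          ∑ i ∈ Finset.range (k + 2), γ i *
            (PowerSeries.coeff p.1 symbolD * PowerSeries.coeff p.2 (convS i)) := by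
        intro p hp
        rw [Finset.HasAntidiagonal.mem_antidiagonal] at hp
        have h2 : PowerSeries.coeff p.2 N =
            ∑ i ∈ Finset.range (k + 2), γ i * PowerSeries.coeff p.2 (convS i) := by
          rw [hN, PowerSeries.coeff_mk, Finset.sum_div]
          have : ∀ i, conv p.2 i * γ i / (p.2)! = γ i * PowerSeries.coeff p.2 (convS i) := by
            intro i
            have : ((p.2)! : ℝ) ≠ 0 := by positivity
            rw [conv]
            field_simp
          simp only [this]
          refine Finset.sum_subset (Finset.range_mono (by omega)) fun i _ hi => ?_
          rw [coeff_convS_eq_zero (by rw [Finset.mem_range] at hi; omega), mul_zero]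
        rw [h2, Finset.mul_sum]
        exact Finset.sum_congr rfl fun i _ => by ring
      rw [PowerSeries.coeff_mul, Finset.sum_congr rfl h1, Finset.sum_comm]
      simp only [← Finset.mul_sum, ← PowerSeries.coeff_mul]
      rw [Finset.sum_range_succ', symbolD_mul_convS_zero]
      have h3 : ∀ i ∈ Finset.range (k + 1),
          γ (i + 1) * PowerSeries.coeff k (symbolD * convS (i + 1)) =
          if k = i + 1 then γ k / k ! else 0 := by
        intro i _
        rw [symbolD_mul_convS (by omega), mono, PowerSeries.coeff_C_mul, PowerSeries.coeff_X_pow]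
        split_ifs with hk
        · subst hk; ring
        · ring
      rw [Finset.sum_congr rfl h3, map_sub, PowerSeries.coeff_C_mul, hΓ, PowerSeries.coeff_mk]
      simp only [map_add, map_sub, PowerSeries.coeff_one]
      rcases k with _ | k
      · simp
        ring
      · rw [Finset.sum_eq_single_of_mem k (by simp) (fun i _ hi => by rw [if_neg (by omega)])]
        simp
        ring
    rw [e1, e2]
  have := mul_left_cancel₀ hD key
  intro j
  have hj := congrArg (PowerSeries.coeff j) this
  rw [PowerSeries.coeff_C_mul, hΓ, hN, PowerSeries.coeff_mk, PowerSeries.coeff_mk] at hj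
  have : (j ! : ℝ) ≠ 0 := by positivity
  field_simp at hj
  exact hj

end MahlerQ
end

noncomputable section

namespace MahlerQ
open MeasureTheory Set Filter Topology

/-! ## Mittag-Leffler expansion of the tangent -/

theorem mem_integerComplement_of_re {y : ℂ} (h0 : 0 < y.re) (h1 : y.re < 1) :
    y ∈ Complex.integerComplement := by
  rw [Complex.mem_integerComplement_iff]
  rintro ⟨n, rfl⟩
  simp at h0 h1
  have : n < 1 := by exact_mod_cast h1
  omega

theorem hasSum_cot {y : ℂ} (h0 : 0 < y.re) (h1 : y.re < 1) :
    HasSum (fun n : ℕ => 1 / (y - (n + 1)) + 1 / (y + (n + 1)))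
      (Real.pi * Complex.cot (Real.pi * y) - 1 / y) := by
  have hy := mem_integerComplement_of_re h0 h1
  rw [cot_series_rep' hy]
  exact (summable_cotTerm hy).hasSum

theorem cos_ne_zero_of_re {z : ℂ} (h0 : 0 < z.re) (h1 : z.re < Real.pi / 2) :
    Complex.cos z ≠ 0 := by
  intro h
  obtain ⟨k, hk⟩ := Complex.cos_eq_zero_iff.1 h
  have hre := congrArg Complex.re hk
  have e : ((2 * (k : ℂ) + 1) * Real.pi / 2) = (((2 * k + 1) * Real.pi / 2 : ℝ) : ℂ) := by
    push_cast; ring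
  rw [e, Complex.ofReal_re] at hre
  rw [hre] at h0 h1
  have hp := Real.pi_pos
  have h2 : (0 : ℝ) < 2 * k + 1 := by
    by_contra hneg
    nlinarith
  have h3 : (2 * k + 1 : ℝ) < 1 := by
    by_contra hneg
    nlinarith
  have h2' : (0 : ℤ) < 2 * k + 1 := by exact_mod_cast h2
  have h3' : (2 * k + 1 : ℤ) < 1 := by exact_mod_cast h3
  omega

/-- From π cot(πy) - (π/2) cot(πy/2) = -(π/2) tan(πy/2): the poles of the second cotangent are the
even integers, so the odd ones remain. -/
theorem hasSum_tan {y : ℂ} (h0 : 0 < y.re) (h1 : y.re < 1) :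
    HasSum (fun k : ℕ => 1 / (2 * k + 1 - y) - 1 / (2 * k + 1 + y))
      (Real.pi / 2 * Complex.tan (Real.pi * y / 2)) := by
  have hA := hasSum_cot h0 h1
  have hB := (hasSum_cot (y := y / 2) (by simp; linarith) (by simp; linarith)).mul_left (1 / 2)
  have hy0 : y ≠ 0 := by rintro rfl; simp at h0
  have hodd : HasSum (fun k : ℕ => 1 / (y - ((2 * k + 1 : ℕ) + 1)) + 1 / (y + ((2 * k + 1 : ℕ) + 1)))
      (1 / 2 * (Real.pi * Complex.cot (Real.pi * (y / 2)) - 1 / (y / 2))) := by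
    refine hB.congr_fun fun k => ?_
    have e1 : y / 2 - (k + 1) = (y - (2 * k + 1 + 1)) / 2 := by ring
    have e2 : y / 2 + (k + 1) = (y + (2 * k + 1 + 1)) / 2 := by ring
    rw [e1, e2]
    push_cast
    simp only [one_div, inv_div]
    ring
  have heven : Summable (fun k : ℕ => 1 / (y - ((2 * k : ℕ) + 1)) + 1 / (y + ((2 * k : ℕ) + 1))) :=
    hA.summable.comp_injective (i := fun k : ℕ => 2 * k) (fun a b h => by simpa using h)
  have hsum := HasSum.even_add_odd (f := fun n : ℕ => 1 / (y - (n + 1)) + 1 / (y + (n + 1)))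
    heven.hasSum hodd
  have heq := hsum.unique hA
  have hneg := heven.hasSum.neg
  have hs : Complex.sin (Real.pi * y / 2) ≠ 0 := by
    have : Complex.cos (Real.pi / 2 - Real.pi * y / 2) ≠ 0 := by
      apply cos_ne_zero_of_re
      · have : ((Real.pi : ℂ) / 2 - Real.pi * y / 2) = ((Real.pi / 2 : ℝ) : ℂ) - ((Real.pi / 2 : ℝ) : ℂ) * y := by
          push_cast; ring
        rw [this, Complex.sub_re, Complex.re_ofReal_mul, Complex.ofReal_re]
        nlinarith [Real.pi_pos]
      · have : ((Real.pi : ℂ) / 2 - Real.pi * y / 2) = ((Real.pi / 2 : ℝ) : ℂ) - ((Real.pi / 2 : ℝ) : ℂ) * y := by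
          push_cast; ring
        rw [this, Complex.sub_re, Complex.re_ofReal_mul, Complex.ofReal_re]
        nlinarith [Real.pi_pos]
    rwa [Complex.cos_pi_div_two_sub] at this
  have hc : Complex.cos (Real.pi * y / 2) ≠ 0 := by
    have e : (Real.pi * y / 2 : ℂ) = ((Real.pi / 2 : ℝ) : ℂ) * y := by push_cast; ring
    apply cos_ne_zero_of_re <;> rw [e, Complex.re_ofReal_mul] <;> nlinarith [Real.pi_pos]
  have hval : -(∑' k : ℕ, (1 / (y - ((2 * k : ℕ) + 1)) + 1 / (y + ((2 * k : ℕ) + 1)))) =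
      Real.pi / 2 * Complex.tan (Real.pi * y / 2) := by
    have e : (Real.pi : ℂ) * y = 2 * (Real.pi * y / 2) := by ring
    have e' : (Real.pi : ℂ) * (y / 2) = Real.pi * y / 2 := by ring
    rw [e, e', Complex.cot, Complex.cot, Complex.sin_two_mul, Complex.cos_two_mul'] at heq
    rw [Complex.tan]
    set θ := (Real.pi * y / 2 : ℂ)
    have : (∑' k : ℕ, (1 / (y - ((2 * k : ℕ) + 1)) + 1 / (y + ((2 * k : ℕ) + 1)))) =
      Real.pi * ((Complex.cos θ ^ 2 - Complex.sin θ ^ 2) / (2 * Complex.sin θ * Complex.cos θ)) - 1 / y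
      - (1 / 2 * (Real.pi * (Complex.cos θ / Complex.sin θ) - 1 / (y / 2))) := by
      rw [← heq]; ring
    rw [this]
    field_simp
    ring
  rw [← hval]
  refine hneg.congr_fun fun k => ?_
  have e1 : y - ((2 * k : ℕ) + 1) = -(2 * k + 1 - y) := by push_cast; ring
  have e2 : y + ((2 * k : ℕ) + 1) = 2 * k + 1 + y := by push_cast; ring
  rw [e1, e2]
  simp only [one_div, inv_neg]
  ring

/-- The identity tan A + tan B = 2 sin(A + B)/(cos(A + B) + cos(A - B)), where A + B is real and A -
B is imaginary; the latter turns a cosine into cosh. -/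
theorem tan_add_tan_conj {a x : ℝ} (h0 : 0 < a) (h1 : a < 3) :
    Complex.tan (Real.pi * ((a + x * Complex.I) / 3) / 2) +
      Complex.tan (Real.pi * ((a - x * Complex.I) / 3) / 2) =
    2 * (Real.sin (Real.pi * a / 3) /
      (Real.cosh (Real.pi * x / 3) + Real.cos (Real.pi * a / 3)) : ℝ) := by
  set A : ℂ := Real.pi * ((a + x * Complex.I) / 3) / 2 with hA
  set B : ℂ := Real.pi * ((a - x * Complex.I) / 3) / 2 with hB
  have hAre : A.re = Real.pi * a / 6 := by
    have : A = ((Real.pi * a / 6 : ℝ) : ℂ) + ((Real.pi * x / 6 : ℝ) : ℂ) * Complex.I := by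
      rw [hA]; push_cast; ring
    rw [this]; simp
  have hBre : B.re = Real.pi * a / 6 := by
    have : B = ((Real.pi * a / 6 : ℝ) : ℂ) - ((Real.pi * x / 6 : ℝ) : ℂ) * Complex.I := by
      rw [hB]; push_cast; ring
    rw [this]; simp
  have hp := Real.pi_pos
  have cA : Complex.cos A ≠ 0 := cos_ne_zero_of_re (by rw [hAre]; positivity) (by rw [hAre]; nlinarith)
  have cB : Complex.cos B ≠ 0 := cos_ne_zero_of_re (by rw [hBre]; positivity) (by rw [hBre]; nlinarith)
  have e1 : A + B = ((Real.pi * a / 3 : ℝ) : ℂ) := by rw [hA, hB]; push_cast; ring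
  have e2 : A - B = ((Real.pi * x / 3 : ℝ) : ℂ) * Complex.I := by rw [hA, hB]; push_cast; ring
  have s1 := Complex.sin_add A B
  have s2 := Complex.cos_add A B
  have s3 := Complex.cos_sub A B
  rw [e1] at s1 s2
  rw [e2, Complex.cos_mul_I] at s3
  push_cast
  push_cast at s1 s2 s3
  have : Complex.cosh (Real.pi * x / 3) + Complex.cos (Real.pi * a / 3) =
      2 * (Complex.cos A * Complex.cos B) := by
    linear_combination s2 + s3
  rw [this, s1, Complex.tan, Complex.tan]
  field_simp

/-! ## The basic kernels and their cosine transforms -/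

/-- The kernel `sinh (a t) / sinh (3 t)`. -/
def ker (a t : ℝ) : ℝ := Real.sinh (a * t) / Real.sinh (3 * t)

/-- The function `t ^ j sinh (2 t) / sinh (3 t)` for even `j`, with `cosh (2 t)` for odd `j`. -/
def basis (j : ℕ) (t : ℝ) : ℝ :=
  t ^ j * (if Even j then Real.sinh (2 * t) else Real.cosh (2 * t)) / Real.sinh (3 * t)

theorem measurable_ker (a : ℝ) : Measurable (ker a) := by
  unfold ker; fun_prop

theorem measurable_basis (j : ℕ) : Measurable (basis j) := by
  unfold basis
  split_ifs <;> fun_prop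

theorem sinh_three_pos {t : ℝ} (ht : 0 < t) : 0 < Real.sinh (3 * t) :=
  Real.sinh_pos_iff.2 (by positivity)

theorem ker_nonneg {a t : ℝ} (ha : 0 ≤ a) (ht : 0 < t) : 0 ≤ ker a t :=
  div_nonneg (Real.sinh_nonneg_iff.2 (by positivity)) (sinh_three_pos ht).le

theorem basis_nonneg (j : ℕ) {t : ℝ} (ht : 0 < t) : 0 ≤ basis j t := by
  refine div_nonneg (mul_nonneg (by positivity) ?_) (sinh_three_pos ht).le
  split_ifs
  · exact Real.sinh_nonneg_iff.2 (by positivity)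
  · exact (Real.cosh_pos _).le

theorem ker_le_exp {a t : ℝ} (ha' : a ≤ 3) (ht : 0 < t) :
    ker a t ≤ Real.exp (-(3 - a) * t) := by
  rw [ker, div_le_iff₀ (sinh_three_pos ht), Real.sinh_eq, Real.sinh_eq, mul_div_assoc', mul_sub,
    ← Real.exp_add, ← Real.exp_add]
  have e1 : -(3 - a) * t + 3 * t = a * t := by ring
  rw [e1]
  gcongr
  nlinarith

theorem integrableOn_exp_neg {b : ℝ} (hb : 0 < b) :
    IntegrableOn (fun t => Real.exp (-b * t)) (Ioi 0) := exp_neg_integrableOn_Ioi 0 hb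

theorem integrableOn_ker {a : ℝ} (ha : 0 ≤ a) (ha' : a < 3) : IntegrableOn (ker a) (Ioi 0) := by
  refine Integrable.mono' (integrableOn_exp_neg (b := 3 - a) (by linarith))
    (measurable_ker a).aestronglyMeasurable ?_
  refine (ae_restrict_iff' measurableSet_Ioi).2 (Eventually.of_forall fun t ht => ?_)
  rw [Real.norm_of_nonneg (ker_nonneg ha ht)]
  exact ker_le_exp ha'.le ht

/-- Addition formula for sinh(2t + ut), with cosh(ut) and sinh(ut) expanded in powers of u. -/
theorem hasSum_basis (u : ℝ) {t : ℝ} :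
    HasSum (fun j : ℕ => u ^ j / j ! * basis j t) (ker (2 + u) t) := by
  have h1 := (Real.hasSum_cosh (u * t)).mul_right (Real.sinh (2 * t) / Real.sinh (3 * t))
  have h2 := (Real.hasSum_sinh (u * t)).mul_right (Real.cosh (2 * t) / Real.sinh (3 * t))
  have e : ker (2 + u) t = Real.cosh (u * t) * (Real.sinh (2 * t) / Real.sinh (3 * t)) +
      Real.sinh (u * t) * (Real.cosh (2 * t) / Real.sinh (3 * t)) := by
    rw [ker, add_mul, Real.sinh_add]; ring
  rw [e]
  refine HasSum.even_add_odd (h1.congr_fun fun k => ?_) (h2.congr_fun fun k => ?_)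
  · simp [basis, mul_pow]; ring
  · simp [basis, mul_pow]; ring

/-- For u = 1/2 all terms of the generating series are nonnegative, so each is at most the
integrable kernel with a = 5/2. -/
theorem integrableOn_basis (j : ℕ) : IntegrableOn (basis j) (Ioi 0) := by
  refine Integrable.mono' ((integrableOn_ker (a := 2 + 1 / 2) (by norm_num) (by norm_num)).const_mul
    ((j ! : ℝ) * 2 ^ j)) (measurable_basis j).aestronglyMeasurable ?_
  refine (ae_restrict_iff' measurableSet_Ioi).2 (Eventually.of_forall fun t ht => ?_)
  rw [Real.norm_of_nonneg (basis_nonneg j ht)]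
  have := le_hasSum (hasSum_basis (1 / 2) (t := t)) j (fun i _ => by
    have := basis_nonneg i ht; positivity)
  have f : (j ! : ℝ) ≠ 0 := by positivity
  calc basis j t = (j ! : ℝ) * 2 ^ j * ((1 / 2) ^ j / j ! * basis j t) := by
        rw [one_div, inv_pow]; field_simp
    _ ≤ _ := by gcongr

theorem integral_exp_neg_complex {s : ℂ} (hs : 0 < s.re) :
    IntegrableOn (fun t : ℝ => Complex.exp (-s * t)) (Ioi 0) ∧
      ∫ t : ℝ in Ioi 0, Complex.exp (-s * t) = 1 / s := by
  refine ⟨integrableOn_exp_mul_complex_Ioi (by simpa using hs) 0, ?_⟩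
  rw [integral_exp_mul_complex_Ioi (by simpa using hs)]
  simp

theorem integral_sub_add_sub {μ : Measure ℝ} {f g h k : ℝ → ℂ} (hf : Integrable f μ)
    (hg : Integrable g μ) (hh : Integrable h μ) (hk : Integrable k μ) :
    ∫ t, (f t - g t + (h t - k t)) ∂μ =
      (∫ t, f t ∂μ - ∫ t, g t ∂μ) + (∫ t, h t ∂μ - ∫ t, k t ∂μ) := by
  rw [integral_add (f := fun t => f t - g t) (g := fun t => h t - k t) (hf.sub hg) (hh.sub hk),
    integral_sub hf hg, integral_sub hh hk]

theorem hasSum_ker (a : ℝ) {t : ℝ} (ht : 0 < t) :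
    HasSum (fun k : ℕ => Real.exp (-(6 * k + 3 - a) * t) - Real.exp (-(6 * k + 3 + a) * t))
      (ker a t) := by
  have h1 : Real.exp (-6 * t) < 1 := by rw [Real.exp_lt_one_iff]; linarith
  have h := (hasSum_geometric_of_lt_one (Real.exp_pos (-6 * t)).le h1).mul_right
    (Real.exp (-(3 - a) * t) - Real.exp (-(3 + a) * t))
  have e : ker a t = (1 - Real.exp (-6 * t))⁻¹ *
      (Real.exp (-(3 - a) * t) - Real.exp (-(3 + a) * t)) := by
    have h3 : Real.exp (-6 * t) = Real.exp (-3 * t) * Real.exp (-3 * t) := by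
      rw [← Real.exp_add]; ring_nf
    have h4 : Real.exp (3 * t) * Real.exp (-3 * t) = 1 := by
      rw [← Real.exp_add]; ring_nf; simp
    have h5 : Real.exp (-(3 - a) * t) = Real.exp (-3 * t) * Real.exp (a * t) := by
      rw [← Real.exp_add]; ring_nf
    have h6 : Real.exp (-(3 + a) * t) = Real.exp (-3 * t) * Real.exp (-(a * t)) := by
      rw [← Real.exp_add]; ring_nf
    have hne : 1 - Real.exp (-6 * t) ≠ 0 := by linarith
    have hs := (sinh_three_pos ht).ne'
    rw [ker, eq_comm, inv_mul_eq_div, div_eq_div_iff hne hs, h5, h6, h3, Real.sinh_eq, Real.sinh_eq,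
      show -(3 * t) = -3 * t by ring]
    linear_combination (Real.exp (a * t) - Real.exp (-(a * t))) / 2 * h4
  rw [e]
  refine h.congr_fun fun k => ?_
  rw [← Real.exp_nat_mul, mul_sub, ← Real.exp_add, ← Real.exp_add]
  ring_nf

/-- The kernel is a geometric series in e^{-6t}. Termwise integration against the cosine produces
the partial fractions of the tangent at (a ± ix)/3. The terms are nonnegative before the cosine
enters, so their sum, the kernel, justifies the interchange. -/
theorem integral_ker_mul_cos {a : ℝ} (ha : 0 < a) (ha' : a < 3) (x : ℝ) :
    ∫ t in Ioi 0, ker a t * Real.cos (x * t) =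
      Real.pi / 6 * (Real.sin (Real.pi * a / 3) /
        (Real.cosh (Real.pi * x / 3) + Real.cos (Real.pi * a / 3))) := by
  have hterm : ∀ (k : ℕ) (t : ℝ), ((Real.exp (-(6 * k + 3 - a) * t) -
      Real.exp (-(6 * k + 3 + a) * t) : ℝ) : ℂ) * Real.cos (x * t) =
      1 / 2 * ((Complex.exp (-(6 * k + 3 - (a + x * Complex.I)) * t) -
        Complex.exp (-(6 * k + 3 + (a + x * Complex.I)) * t)) +
        (Complex.exp (-(6 * k + 3 - (a - x * Complex.I)) * t) -
        Complex.exp (-(6 * k + 3 + (a - x * Complex.I)) * t))) := by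
    intro k t
    push_cast
    rw [Complex.cos, mul_div_assoc', div_eq_mul_inv, mul_comm _ (2 : ℂ)⁻¹, one_div, sub_mul, mul_add,
      mul_add]
    simp only [← Complex.exp_add]
    ring_nf
  have hint : ∀ k : ℕ, IntegrableOn (fun t : ℝ => ((Real.exp (-(6 * k + 3 - a) * t) -
      Real.exp (-(6 * k + 3 + a) * t) : ℝ) : ℂ) * Real.cos (x * t)) (Ioi 0) ∧
      ∫ t in Ioi 0, ((Real.exp (-(6 * k + 3 - a) * t) -
      Real.exp (-(6 * k + 3 + a) * t) : ℝ) : ℂ) * Real.cos (x * t) =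
      1 / 6 * ((1 / (2 * k + 1 - (a + x * Complex.I) / 3) - 1 / (2 * k + 1 + (a + x * Complex.I) / 3)) +
      (1 / (2 * k + 1 - (a - x * Complex.I) / 3) - 1 / (2 * k + 1 + (a - x * Complex.I) / 3))) := by
    intro k
    have hk : (0 : ℝ) ≤ k := Nat.cast_nonneg k
    have i1 := integral_exp_neg_complex (s := 6 * k + 3 - (a + x * Complex.I)) (by simp; linarith)
    have i2 := integral_exp_neg_complex (s := 6 * k + 3 + (a + x * Complex.I)) (by simp; linarith)
    have i3 := integral_exp_neg_complex (s := 6 * k + 3 - (a - x * Complex.I)) (by simp; linarith)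
    have i4 := integral_exp_neg_complex (s := 6 * k + 3 + (a - x * Complex.I)) (by simp; linarith)
    simp only [hterm]
    refine ⟨((i1.1.sub i2.1).add (i3.1.sub i4.1)).const_mul _, ?_⟩
    rw [integral_const_mul, integral_sub_add_sub i1.1 i2.1 i3.1 i4.1, i1.2, i2.2, i3.2, i4.2]
    have e1 : ∀ w : ℂ, 6 * (k : ℂ) + 3 - w = 3 * (2 * k + 1 - w / 3) := fun w => by ring
    have e2 : ∀ w : ℂ, 6 * (k : ℂ) + 3 + w = 3 * (2 * k + 1 + w / 3) := fun w => by ring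
    simp only [e1, e2, one_div, mul_inv]
    ring
  have hsum := hasSum_integral_of_dominated_convergence (μ := volume.restrict (Ioi 0))
    (F := fun (k : ℕ) (t : ℝ) => ((Real.exp (-(6 * k + 3 - a) * t) -
      Real.exp (-(6 * k + 3 + a) * t) : ℝ) : ℂ) * Real.cos (x * t))
    (f := fun t => ((ker a t * Real.cos (x * t) : ℝ) : ℂ))
    (fun k t => Real.exp (-(6 * k + 3 - a) * t) - Real.exp (-(6 * k + 3 + a) * t))
    (fun k => (hint k).1.aestronglyMeasurable)
    (fun k => (ae_restrict_iff' measurableSet_Ioi).2 (Eventually.of_forall fun t ht => by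
      have h0 : 0 ≤ Real.exp (-(6 * k + 3 - a) * t) - Real.exp (-(6 * k + 3 + a) * t) := by
        rw [sub_nonneg, Real.exp_le_exp]
        have : (0 : ℝ) < t := ht
        nlinarith
      rw [norm_mul, Complex.norm_real, Complex.norm_real, Real.norm_of_nonneg h0, Real.norm_eq_abs]
      exact mul_le_of_le_one_right h0 (Real.abs_cos_le_one _)))
    ((ae_restrict_iff' measurableSet_Ioi).2 (Eventually.of_forall fun t ht =>
      (hasSum_ker a ht).summable))
    ((integrableOn_ker ha.le ha').congr_fun (fun t ht => (hasSum_ker a ht).tsum_eq.symm)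
      measurableSet_Ioi)
    ((ae_restrict_iff' measurableSet_Ioi).2 (Eventually.of_forall fun t ht => by
      have := ((hasSum_ker a ht).mul_right (Real.cos (x * t)))
      have := Complex.hasSum_ofReal.2 this
      simpa only [Complex.ofReal_mul] using this))
  simp only [(hint _).2] at hsum
  have ht1 := hasSum_tan (y := (a + x * Complex.I) / 3) (by simp; linarith) (by simp; linarith)
  have ht2 := hasSum_tan (y := (a - x * Complex.I) / 3) (by simp; linarith) (by simp; linarith)
  have heq := hsum.unique ((ht1.add ht2).mul_left (1 / 6))
  rw [integral_complex_ofReal, ← mul_add, tan_add_tan_conj ha ha'] at heq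
  apply Complex.ofReal_injective
  rw [heq]
  push_cast
  ring

/-- The cosine transform of the even extension of `basis j`. -/
def trans (x : ℝ) (j : ℕ) : ℝ := 2 * ∫ t in Ioi 0, basis j t * Real.cos (x * t)

theorem integrableOn_basis_mul_cos (x : ℝ) (j : ℕ) :
    IntegrableOn (fun t => basis j t * Real.cos (x * t)) (Ioi 0) :=
  (integrableOn_basis j).mul_bdd (c := 1) (by fun_prop)
    (Eventually.of_forall fun t => by simpa using Real.abs_cos_le_one (x * t))

theorem hasSum_trans (x : ℝ) {u : ℝ} (hu : |u| < 1) :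
    HasSum (fun j : ℕ => u ^ j / j ! * trans x j)
      (Real.pi / 3 * (Real.sin (Real.pi * (2 + u) / 3) /
        (Real.cosh (Real.pi * x / 3) + Real.cos (Real.pi * (2 + u) / 3)))) := by
  have hu' := abs_lt.1 hu
  have habs := abs_nonneg u
  have hsum := hasSum_integral_of_dominated_convergence (μ := volume.restrict (Ioi 0))
    (F := fun (j : ℕ) (t : ℝ) => u ^ j / j ! * (basis j t * Real.cos (x * t)))
    (f := fun t => ker (2 + u) t * Real.cos (x * t))
    (fun j t => |u| ^ j / j ! * basis j t)
    (fun j => ((integrableOn_basis_mul_cos x j).const_mul _).aestronglyMeasurable)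
    (fun j => (ae_restrict_iff' measurableSet_Ioi).2 (Eventually.of_forall fun t ht => by
      have h0 := basis_nonneg j ht
      rw [Real.norm_eq_abs, abs_mul, abs_mul, abs_div, abs_pow, abs_of_nonneg h0,
        abs_of_nonneg (by positivity : (0 : ℝ) ≤ j !)]
      gcongr
      exact mul_le_of_le_one_right h0 (Real.abs_cos_le_one _)))
    (Eventually.of_forall fun t => (hasSum_basis |u|).summable)
    ((integrableOn_ker (a := 2 + |u|) (by linarith) (by linarith)).congr
      (Eventually.of_forall fun t => (hasSum_basis |u|).tsum_eq.symm))
    (Eventually.of_forall fun t => by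
      simpa only [mul_assoc] using (hasSum_basis u (t := t)).mul_right (Real.cos (x * t)))
  rw [integral_ker_mul_cos (by linarith) (by linarith)] at hsum
  have h2 := hsum.mul_left 2
  rw [show Real.pi / 3 = 2 * (Real.pi / 6) by ring, mul_assoc]
  refine h2.congr_fun fun j => ?_
  rw [integral_const_mul, trans]
  ring

/-- The normalized transforms. -/
def gam (x : ℝ) (j : ℕ) : ℝ := (3 / Real.pi) ^ (j + 1) * trans x j

theorem hasSum_gam (x : ℝ) {v : ℝ} (hv : |v| < 1) :
    HasSum (fun j : ℕ => v ^ j * (gam x j / j !))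
      ((√3 / 2 * Real.cos v - 1 / 2 * Real.sin v) /
        (Real.cosh (Real.pi * x / 3) - 1 / 2 * Real.cos v - √3 / 2 * Real.sin v)) := by
  have hp := Real.pi_pos
  -- The transform series converges for |u| < 1, that is a = 2 + u < 3, and 3/π < 1 keeps u = 3v/π
  -- in that range.
  have hu : |3 / Real.pi * v| < 1 := by
    rw [abs_mul, abs_of_pos (by positivity)]
    have : 3 / Real.pi ≤ 1 := by rw [div_le_one hp]; exact Real.pi_gt_three.le
    calc 3 / Real.pi * |v| ≤ 1 * |v| := by gcongr
      _ < 1 := by linarith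
  have h := (hasSum_trans x hu).mul_left (3 / Real.pi)
  have e : Real.pi * (2 + 3 / Real.pi * v) / 3 = (Real.pi - Real.pi / 3) + v := by field_simp; ring
  have hval : 3 / Real.pi * (Real.pi / 3 * (Real.sin (Real.pi * (2 + 3 / Real.pi * v) / 3) /
        (Real.cosh (Real.pi * x / 3) + Real.cos (Real.pi * (2 + 3 / Real.pi * v) / 3)))) =
      ((√3 / 2 * Real.cos v - 1 / 2 * Real.sin v) /
        (Real.cosh (Real.pi * x / 3) - 1 / 2 * Real.cos v - √3 / 2 * Real.sin v)) := by
    rw [e, Real.sin_add, Real.cos_add, Real.sin_pi_sub, Real.cos_pi_sub, Real.sin_pi_div_three,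
      Real.cos_pi_div_three, ← mul_assoc, div_mul_div_cancel₀ (by positivity), div_self (by norm_num),
      one_mul]
    congr 1 <;> ring
  rw [hval] at h
  refine h.congr_fun fun j => ?_
  rw [gam, mul_pow, pow_succ]
  ring

/-! ## Comparison of power series -/

/-- The real power series `p` converges to `f v` at `v`. -/
def SumsTo (p : PowerSeries ℝ) (v f : ℝ) : Prop :=
  HasSum (fun n => v ^ n * PowerSeries.coeff n p) f

theorem SumsTo.sub {p q : PowerSeries ℝ} {v f g : ℝ} (hp : SumsTo p v f) (hq : SumsTo q v g) :
    SumsTo (p - q) v (f - g) := by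
  unfold SumsTo at *
  simpa only [map_sub, mul_sub] using HasSum.sub hp hq

theorem SumsTo.mul {p q : PowerSeries ℝ} {v f g : ℝ} (hp : SumsTo p v f) (hq : SumsTo q v g) :
    SumsTo (p * q) v (f * g) := by
  unfold SumsTo at *
  have hp' := hp.summable.norm
  have hq' := hq.summable.norm
  have h := tsum_mul_tsum_eq_tsum_sum_antidiagonal_of_summable_norm hp' hq'
  have hs := (summable_norm_sum_mul_antidiagonal_of_summable_norm hp' hq').of_norm
  rw [hp.tsum_eq, hq.tsum_eq] at h
  rw [h]
  refine hs.hasSum.congr_fun fun n => ?_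
  rw [PowerSeries.coeff_mul, Finset.mul_sum]
  refine Finset.sum_congr rfl fun k hk => ?_
  rw [← Finset.HasAntidiagonal.mem_antidiagonal.1 hk, pow_add]
  ring

theorem sumsTo_C (a v : ℝ) : SumsTo (PowerSeries.C a) v a := by
  unfold SumsTo
  convert hasSum_single (f := fun n => v ^ n * PowerSeries.coeff n (PowerSeries.C a)) 0
    (fun n hn => by simp [PowerSeries.coeff_C, hn]) using 1
  simp

theorem sumsTo_cosS (v : ℝ) : SumsTo (cosS 1) v (Real.cos v) := by
  unfold SumsTo
  rw [← add_zero (Real.cos v)]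
  refine HasSum.even_add_odd ((Real.hasSum_cos v).congr_fun fun k => ?_)
    (hasSum_zero.congr_fun fun k => ?_)
  · rw [coeff_cosS, if_pos (by simp)]
    simp
    ring
  · rw [coeff_cosS, if_neg (by simp), mul_zero]

theorem sumsTo_sinS (v : ℝ) : SumsTo (sinS 1) v (Real.sin v) := by
  unfold SumsTo
  rw [← zero_add (Real.sin v)]
  refine HasSum.even_add_odd (hasSum_zero.congr_fun fun k => ?_)
    ((Real.hasSum_sin v).congr_fun fun k => ?_)
  · rw [coeff_sinS, if_pos (by simp), mul_zero]
  · have : (2 * k + 1) / 2 = k := by omega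
    rw [coeff_sinS, if_neg (by simp), this]
    simp
    ring

theorem eq_of_sumsTo {p q : PowerSeries ℝ} {f : ℝ → ℝ} (hp : ∀ v, |v| < 1 → SumsTo p v (f v))
    (hq : ∀ v, |v| < 1 → SumsTo q v (f v)) : p = q := by
  have key : ∀ r : PowerSeries ℝ, (∀ v, |v| < 1 → SumsTo r v (f v)) →
      HasFPowerSeriesAt f (FormalMultilinearSeries.ofScalars ℝ fun n => PowerSeries.coeff n r) 0 := by
    intro r hr
    rw [hasFPowerSeriesAt_iff]
    filter_upwards [Metric.ball_mem_nhds (0 : ℝ) one_pos] with v hv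
    have := hr v (by simpa using hv)
    simpa [SumsTo, FormalMultilinearSeries.coeff_ofScalars] using this
  have h := (key p hp).eq_formalMultilinearSeries (key q hq)
  ext n
  have := congrArg (fun s => FormalMultilinearSeries.coeff s n) h
  simpa [FormalMultilinearSeries.coeff_ofScalars] using this

theorem isConv_gam (x : ℝ) :
    gam x 0 = √3 * (1 / (2 * Real.cosh (Real.pi * x / 3) - 1)) ∧
      IsConv (1 / (2 * Real.cosh (Real.pi * x / 3) - 1)) (gam x) := by
  have hc := Real.one_le_cosh (Real.pi * x / 3)
  refine isConv_of_series (by linarith) ?_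
  refine eq_of_sumsTo (f := fun v => √3 / 2 * Real.cos v - 1 / 2 * Real.sin v) (fun v hv => ?_)
    fun v _ => ((sumsTo_C _ v).mul (sumsTo_cosS v)).sub ((sumsTo_C _ v).mul (sumsTo_sinS v))
  have hg : SumsTo (PowerSeries.mk fun j => gam x j / j !) v
      ((√3 / 2 * Real.cos v - 1 / 2 * Real.sin v) /
        (Real.cosh (Real.pi * x / 3) - 1 / 2 * Real.cos v - √3 / 2 * Real.sin v)) := by
    unfold SumsTo
    simpa only [PowerSeries.coeff_mk] using hasSum_gam x hv
  have := (((sumsTo_C (Real.cosh (Real.pi * x / 3)) v).sub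
    ((sumsTo_C (1 / 2) v).mul (sumsTo_cosS v))).sub ((sumsTo_C (√3 / 2) v).mul (sumsTo_sinS v))).mul hg
  rwa [mul_div_cancel₀] at this
  intro h0
  -- The denominator is cosh(πx/3) - cos(v - π/3). It could vanish only where cos(v - π/3) = 1,
  -- which would force cos v = 1/2; this is impossible for |v| < 1.
  have hcos : 1 / 2 < Real.cos v := by
    have h1 := Real.one_sub_sq_div_two_le_cos (x := v)
    have h2 := abs_lt.1 hv
    nlinarith
  have hs : √3 * √3 = 3 := Real.mul_self_sqrt (by norm_num)
  nlinarith [Real.sin_sq_add_cos_sq v, sq_nonneg (Real.sin v - √3 / 2), sq_pos_of_pos (sub_pos.2 hcos)]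

end MahlerQ
end

noncomputable section

namespace MahlerQ
open MeasureTheory Set Filter Topology

/-! ## The distribution of one factor -/

/-- One factor of the product, on the unit circle. -/
def factor (θ : ℝ) : ℂ :=
  (Complex.exp (θ * Complex.I) + om) / (Complex.exp (θ * Complex.I) + 1)

/-- The logarithm of the absolute value of one factor. -/
def logFactor (θ : ℝ) : ℝ := Real.log ‖factor θ‖

theorem measurable_factor : Measurable factor := by unfold factor; fun_prop

theorem measurable_logFactor : Measurable logFactor :=
  Real.measurable_log.comp measurable_factor.norm

theorem om_eq : om = -(1 / 2) + √3 / 2 * Complex.I := by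
  have : (2 * Real.pi * Complex.I / 3 : ℂ) = ((Real.pi - Real.pi / 3 : ℝ) : ℂ) * Complex.I := by
    push_cast; ring
  rw [om, this, Complex.exp_mul_I, ← Complex.ofReal_cos, ← Complex.ofReal_sin, Real.cos_pi_sub,
    Real.sin_pi_sub, Real.cos_pi_div_three, Real.sin_pi_div_three]
  push_cast
  ring

/-- Half-angle formulas: |e^{2iz} + ω| = |cos z + √3 sin z| and |e^{2iz} + 1| = 2|cos z|. -/
theorem norm_factor {z : ℝ} (hz : Real.cos z ≠ 0) :
    ‖factor (2 * z)‖ = |1 + √3 * Real.tan z| / 2 := by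
  have hs : √3 * √3 = 3 := Real.mul_self_sqrt (by norm_num)
  have e : Complex.exp ((2 * z : ℝ) * Complex.I) = Real.cos (2 * z) + Real.sin (2 * z) * Complex.I := by
    rw [Complex.exp_mul_I, Complex.ofReal_cos, Complex.ofReal_sin]
  have h1 : Complex.normSq (Complex.exp ((2 * z : ℝ) * Complex.I) + om) =
      (Real.cos z + √3 * Real.sin z) ^ 2 := by
    rw [e, om_eq, Complex.normSq_apply]
    simp only [Complex.add_re, Complex.add_im, Complex.ofReal_re, Complex.ofReal_im, Complex.mul_re,
      Complex.mul_im, Complex.I_re, Complex.I_im, Complex.neg_re, Complex.neg_im]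
    norm_num
    rw [Real.cos_two_mul, Real.sin_two_mul]
    have := Real.sin_sq_add_cos_sq z
    have h2 : Real.sin z ^ 2 = 1 - Real.cos z ^ 2 := by linarith
    linear_combination (4 * Real.cos z ^ 2 - 3) * h2 + (1 / 4 - Real.sin z ^ 2) * hs
  have h2 : Complex.normSq (Complex.exp ((2 * z : ℝ) * Complex.I) + 1) = (2 * Real.cos z) ^ 2 := by
    rw [e, Complex.normSq_apply]
    simp only [Complex.add_re, Complex.add_im, Complex.ofReal_re, Complex.ofReal_im, Complex.mul_re,
      Complex.mul_im, Complex.I_re, Complex.I_im, Complex.one_re, Complex.one_im]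
    norm_num
    rw [Real.cos_two_mul, Real.sin_two_mul]
    have := Real.sin_sq_add_cos_sq z
    have h2 : Real.sin z ^ 2 = 1 - Real.cos z ^ 2 := by linarith
    linear_combination 4 * Real.cos z ^ 2 * h2
  rw [factor, norm_div, Complex.norm_def, Complex.norm_def, h1, h2, Real.sqrt_sq_eq_abs,
    Real.sqrt_sq_eq_abs, ← abs_div, Real.tan_eq_sin_div_cos,
    show (2 : ℝ) = |2| by norm_num, ← abs_div, abs_two]
  congr 1
  field_simp

/-- The two branches of the inverse of `logFactor`. -/
def branch (s t : ℝ) : ℝ := 2 * Real.arctan ((s * (2 * Real.exp t) - 1) / √3)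

theorem logFactor_branch {s : ℝ} (hs : |s| = 1) (t : ℝ) : logFactor (branch s t) = t := by
  rw [logFactor, branch, norm_factor (Real.cos_arctan_pos _).ne', Real.tan_arctan,
    mul_div_cancel₀ _ (by positivity), add_sub_cancel, abs_mul, hs, one_mul,
    abs_of_pos (by positivity), mul_div_cancel_left₀ _ two_ne_zero, Real.log_exp]

/-- With s² = 1, 3 + (2s e^t - 1)² = 4e^t (2 cosh t - s), so the derivative of the arctangent
simplifies. -/
theorem hasDerivAt_branch {s : ℝ} (hs : s ^ 2 = 1) (t : ℝ) :
    HasDerivAt (branch s) (s * (√3 / (2 * Real.cosh t - s))) t := by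
  have h := (((((Real.hasDerivAt_exp t).const_mul 2).const_mul s).sub_const 1).div_const √3).arctan.const_mul 2
  refine h.congr_deriv ?_
  have h3 : √3 ^ 2 = 3 := Real.sq_sqrt (by norm_num)
  have hc := Real.one_le_cosh t
  have hs1 : s ≤ 1 := by nlinarith
  have hpos : 2 * Real.cosh t - s ≠ 0 := by linarith
  have hexp := Real.exp_pos t
  rw [Real.cosh_eq, Real.exp_neg] at hpos ⊢
  have hd : 1 + ((s * (2 * Real.exp t) - 1) / √3) ^ 2 ≠ 0 := by positivity
  have e : 1 + ((s * (2 * Real.exp t) - 1) / √3) ^ 2 =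
      4 / 3 * Real.exp t * (2 * ((Real.exp t + (Real.exp t)⁻¹) / 2) - s) := by
    rw [div_pow, h3]
    field_simp
    linear_combination 4 * Real.exp t ^ 2 * hs
  rw [e]
  have h3' : √3 ≠ 0 := by positivity
  rw [mul_div_assoc', mul_comm (1 / _) , ← sub_eq_zero]
  generalize hX : (2 * ((Real.exp t + (Real.exp t)⁻¹) / 2) - s) = X at *
  field_simp
  linear_combination -4 * s * h3

theorem branch_injective {s : ℝ} (hs : |s| = 1) : Function.Injective (branch s) :=
  fun x y h => by rw [← logFactor_branch hs x, h, logFactor_branch hs y]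

theorem arctan_neg_inv_sqrt_three : Real.arctan (-(1 / √3)) = -(Real.pi / 6) := by
  rw [← Real.tan_pi_div_six, ← Real.tan_neg, Real.arctan_tan] <;> linarith [Real.pi_pos]

theorem image_branch_one : branch 1 '' univ = Ioo (-(Real.pi / 3)) Real.pi := by
  have h3 : (0 : ℝ) < √3 := by positivity
  ext θ
  simp only [image_univ, mem_range, mem_Ioo, branch]
  constructor
  · rintro ⟨t, rfl⟩
    have h1 := Real.arctan_lt_pi_div_two ((1 * (2 * Real.exp t) - 1) / √3)
    have h2 : Real.arctan (-(1 / √3)) < Real.arctan ((1 * (2 * Real.exp t) - 1) / √3) := by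
      apply Real.arctan_strictMono
      rw [← neg_div, div_lt_div_iff_of_pos_right h3]
      linarith [Real.exp_pos t]
    rw [arctan_neg_inv_sqrt_three] at h2
    constructor <;> linarith
  · rintro ⟨h1, h2⟩
    have ht : Real.tan (-(Real.pi / 6)) < Real.tan (θ / 2) :=
      Real.tan_lt_tan_of_lt_of_lt_pi_div_two (by linarith [Real.pi_pos]) (by linarith) (by linarith)
    rw [Real.tan_neg, Real.tan_pi_div_six, ← neg_div, div_lt_iff₀ h3] at ht
    refine ⟨Real.log ((1 + √3 * Real.tan (θ / 2)) / 2), ?_⟩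
    rw [Real.exp_log (by linarith), mul_div_cancel₀ _ two_ne_zero, one_mul, add_sub_cancel_left,
      mul_div_cancel_left₀ _ h3.ne', Real.arctan_tan (by linarith [Real.pi_pos]) (by linarith)]
    ring

theorem image_branch_neg_one : branch (-1) '' univ = Ioo (-Real.pi) (-(Real.pi / 3)) := by
  have h3 : (0 : ℝ) < √3 := by positivity
  ext θ
  simp only [image_univ, mem_range, mem_Ioo, branch]
  constructor
  · rintro ⟨t, rfl⟩
    have h1 := Real.neg_pi_div_two_lt_arctan ((-1 * (2 * Real.exp t) - 1) / √3)
    have h2 : Real.arctan ((-1 * (2 * Real.exp t) - 1) / √3) < Real.arctan (-(1 / √3)) := by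
      apply Real.arctan_strictMono
      rw [← neg_div, div_lt_div_iff_of_pos_right h3]
      linarith [Real.exp_pos t]
    rw [arctan_neg_inv_sqrt_three] at h2
    constructor <;> linarith
  · rintro ⟨h1, h2⟩
    have ht : Real.tan (θ / 2) < Real.tan (-(Real.pi / 6)) :=
      Real.tan_lt_tan_of_lt_of_lt_pi_div_two (by linarith) (by linarith [Real.pi_pos]) (by linarith)
    rw [Real.tan_neg, Real.tan_pi_div_six, ← neg_div, lt_div_iff₀ h3] at ht
    refine ⟨Real.log (-(1 + √3 * Real.tan (θ / 2)) / 2), ?_⟩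
    rw [Real.exp_log (by linarith), mul_div_cancel₀ _ two_ne_zero,
      show -1 * -(1 + √3 * Real.tan (θ / 2)) - 1 = √3 * Real.tan (θ / 2) by ring,
      mul_div_cancel_left₀ _ h3.ne', Real.arctan_tan (by linarith) (by linarith [Real.pi_pos])]
    ring

theorem integral_image_branch {s : ℝ} (hs : |s| = 1) (h : ℝ → ℂ) :
    ∫ θ in branch s '' univ, h (logFactor θ) =
      ∫ t, (√3 / (2 * Real.cosh t - s) : ℝ) • h t := by
  have hs2 : s ^ 2 = 1 := by rw [← sq_abs, hs, one_pow]
  rw [integral_image_eq_integral_abs_deriv_smul MeasurableSet.univ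
    (fun t _ => (hasDerivAt_branch hs2 t).hasDerivWithinAt) (branch_injective hs).injOn,
    Measure.restrict_univ]
  congr 1
  ext t
  have hc := Real.one_le_cosh t
  have hs1 : s ≤ 1 := by nlinarith
  have hpos : 0 < 2 * Real.cosh t - s := by linarith
  rw [logFactor_branch hs, abs_mul, hs, one_mul, abs_of_pos (by positivity)]

/-- Each branch contributes one Jacobian. Their product of denominators is 4 cosh² t - 1 = sinh 3t /
sinh t. At t = 0 the quotient of hyperbolic sines is 0/0, whence the exclusion. -/
theorem density_eq {t : ℝ} (ht : t ≠ 0) :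
    √3 / (2 * Real.cosh t - 1) + √3 / (2 * Real.cosh t + 1) = 2 * √3 * basis 0 |t| := by
  have hb : basis 0 |t| = Real.sinh (2 * t) / Real.sinh (3 * t) := by
    rcases abs_choice t with h | h <;> rw [h] <;> simp [basis]
  have hc := Real.one_le_cosh t
  have hs : Real.sinh t ≠ 0 := by rwa [Ne, Real.sinh_eq_zero]
  have h1 : 2 * Real.cosh t - 1 ≠ 0 := by linarith
  have h2 : 2 * Real.cosh t + 1 ≠ 0 := by linarith
  have e3 : Real.sinh (3 * t) = Real.sinh t * ((2 * Real.cosh t - 1) * (2 * Real.cosh t + 1)) := by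
    rw [Real.sinh_three_mul]
    have := Real.cosh_sq t
    linear_combination -4 * Real.sinh t * this
  rw [hb, e3, Real.sinh_two_mul]
  field_simp
  ring

-- Fourier transforms of even functions and of the law of one factor

theorem integrable_comp_abs {F : ℝ → ℝ} (hF : IntegrableOn F (Ioi 0)) :
    Integrable fun t => F |t| := by
  have h1 : IntegrableOn (fun t => F |t|) (Ioi 0) :=
    hF.congr_fun (fun t (ht : 0 < t) => by rw [abs_of_pos ht]) measurableSet_Ioi
  have h2 : IntegrableOn (fun t => F |t|) (Iio 0) := by
    have := (Measure.measurePreserving_neg (volume : Measure ℝ)).integrableOn_comp_preimage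
      (Homeomorph.neg ℝ).measurableEmbedding (f := fun t => F |t|) (s := Ioi 0)
    rw [neg_preimage, neg_Ioi, neg_zero] at this
    simpa [Function.comp_def] using this.2 h1
  rw [← integrableOn_univ, ← Iic_union_Ioi (a := (0 : ℝ))]
  exact ((integrableOn_Iic_iff_integrableOn_Iio (by simp)).2 h2).union h1

theorem integral_exp_mul_comp_abs {F : ℝ → ℝ} (hF : IntegrableOn F (Ioi 0)) (x : ℝ) :
    ∫ t : ℝ, Complex.exp (x * t * Complex.I) * (F |t| : ℝ) =
      ((2 * ∫ t : ℝ in Ioi 0, F t * Real.cos (x * t) : ℝ) : ℂ) := by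
  have hI : Integrable fun t : ℝ => Complex.exp (x * t * Complex.I) * (F |t| : ℝ) := by
    refine (integrable_comp_abs hF).ofReal.bdd_mul (c := 1) (by fun_prop)
      (Eventually.of_forall fun t => ?_)
    rw [← Complex.ofReal_mul, Complex.norm_exp_ofReal_mul_I]
  have hm : IntegrableOn (fun t : ℝ => Complex.exp (x * t * Complex.I) * (F t : ℝ)) (Ioi 0) :=
    hI.integrableOn.congr_fun (fun t (ht : 0 < t) => by simp only; rw [abs_of_pos ht]) measurableSet_Ioi
  have hm' : IntegrableOn (fun t : ℝ => Complex.exp (-(x * t * Complex.I)) * (F t : ℝ)) (Ioi 0) := by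
    refine Integrable.bdd_mul (c := 1) hF.ofReal (by fun_prop) (Eventually.of_forall fun t => ?_)
    rw [← neg_mul, ← Complex.ofReal_mul, ← Complex.ofReal_neg, Complex.norm_exp_ofReal_mul_I]
  rw [← setIntegral_univ, ← Iic_union_Ioi (a := (0 : ℝ)), setIntegral_union
    (Iic_disjoint_Ioi (le_refl (0 : ℝ))) measurableSet_Ioi hI.integrableOn hI.integrableOn]
  have e1 : ∫ t : ℝ in Iic (0 : ℝ), Complex.exp (x * t * Complex.I) * (F |t| : ℝ) =
      ∫ t : ℝ in Ioi (0 : ℝ), Complex.exp (-(x * t * Complex.I)) * (F t : ℝ) := by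
    have h := integral_comp_neg_Ioi (0 : ℝ)
      (fun t : ℝ => Complex.exp (x * t * Complex.I) * (F |t| : ℝ))
    rw [neg_zero] at h
    rw [← h]
    refine setIntegral_congr_fun measurableSet_Ioi fun t (ht : 0 < t) => ?_
    simp only [abs_neg, abs_of_pos ht]
    push_cast
    ring_nf
  have e2 : ∫ t : ℝ in Ioi (0 : ℝ), Complex.exp (x * t * Complex.I) * (F |t| : ℝ) =
      ∫ t : ℝ in Ioi (0 : ℝ), Complex.exp (x * t * Complex.I) * (F t : ℝ) :=
    setIntegral_congr_fun measurableSet_Ioi fun t (ht : 0 < t) => by simp only [abs_of_pos ht]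
  rw [e1, e2, ← integral_add hm' hm, ← integral_const_mul, ← integral_complex_ofReal]
  congr 1
  ext t
  push_cast
  rw [Complex.cos]
  ring_nf

theorem continuous_exp_mul_I (x : ℝ) : Continuous fun t : ℝ => Complex.exp (x * t * Complex.I) := by
  fun_prop

theorem integrableOn_exp_logFactor (x : ℝ) (s : Set ℝ) (hs : volume s ≠ ⊤) :
    IntegrableOn (fun θ => Complex.exp (x * logFactor θ * Complex.I)) s := by
  have : IsFiniteMeasure (volume.restrict s) := ⟨by simpa using hs.lt_top⟩
  refine Integrable.of_bound (C := 1)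
    ((continuous_exp_mul_I x).measurable.comp measurable_logFactor).aestronglyMeasurable
    (Eventually.of_forall fun t => ?_)
  rw [← Complex.ofReal_mul, Complex.norm_exp_ofReal_mul_I]

/-- The Lebesgue measure on `[0, 2π]`. -/
def circleVol : Measure ℝ := volume.restrict (Icc 0 (2 * Real.pi))

instance : IsFiniteMeasure circleVol := by unfold circleVol; infer_instance

theorem factor_add_two_pi (θ : ℝ) : factor (θ + 2 * Real.pi) = factor θ := by
  have : Complex.exp ((θ + 2 * Real.pi : ℝ) * Complex.I) = Complex.exp (θ * Complex.I) := by
    push_cast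
    rw [add_mul, Complex.exp_add, Complex.exp_two_pi_mul_I, mul_one]
  rw [factor, this, factor]

/-- The characteristic function of the law of `logFactor`. -/
theorem integral_exp_logFactor (x : ℝ) :
    ∫ θ, Complex.exp (x * logFactor θ * Complex.I) ∂circleVol =
      ((2 * Real.pi * (1 / (2 * Real.cosh (Real.pi * x / 3) - 1)) : ℝ) : ℂ) := by
  have hp := Real.pi_pos
  set g : ℝ → ℂ := fun θ => Complex.exp (x * logFactor θ * Complex.I) with hg
  have hper : Function.Periodic g (2 * Real.pi) := fun θ => by
    simp only [hg, logFactor, factor_add_two_pi]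
  -- Periodicity moves the circle to (-π, π], where θ/2 lies in the range of the arctangent (up to
  -- an endpoint) and the two branches apply.
  have h1 : ∫ θ, g θ ∂circleVol = ∫ θ in Ioc (-Real.pi) Real.pi, g θ := by
    rw [circleVol, integral_Icc_eq_integral_Ioc, ← intervalIntegral.integral_of_le (by positivity),
      ← intervalIntegral.integral_of_le (by linarith)]
    have := hper.intervalIntegral_add_eq 0 (-Real.pi)
    rw [zero_add] at this
    rw [this]
    congr 1
    ring
  have hset : (Ioc (-Real.pi) Real.pi : Set ℝ) =ᵐ[volume]
      (branch (-1) '' univ ∪ branch 1 '' univ : Set ℝ) := by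
    rw [image_branch_one, image_branch_neg_one]
    have e1 : (Ioc (-Real.pi) Real.pi : Set ℝ) =
        Ioc (-Real.pi) (-(Real.pi / 3)) ∪ Ioc (-(Real.pi / 3)) Real.pi := by
      rw [Ioc_union_Ioc_eq_Ioc] <;> linarith
    rw [e1]
    exact Ioo_ae_eq_Ioc.symm.union Ioo_ae_eq_Ioc.symm
  have hdisj : Disjoint (branch (-1) '' univ) (branch 1 '' univ) := by
    rw [image_branch_one, image_branch_neg_one, Set.disjoint_left]
    rintro θ ⟨_, h⟩ ⟨h', _⟩
    linarith
  have hm : MeasurableSet (branch 1 '' univ) := by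
    rw [image_branch_one]; exact measurableSet_Ioo
  rw [h1, setIntegral_congr_set hset, setIntegral_union hdisj hm
    (integrableOn_exp_logFactor x _ (by rw [image_branch_neg_one]; simp))
    (integrableOn_exp_logFactor x _ (by rw [image_branch_one]; simp))]
  have i1 := integral_image_branch (s := 1) (by simp) (fun t => Complex.exp (x * t * Complex.I))
  have i2 := integral_image_branch (s := -1) (by simp) (fun t => Complex.exp (x * t * Complex.I))
  rw [i1, i2]
  have hd : ∀ t : ℝ, t ≠ 0 → (√3 / (2 * Real.cosh t - -1) : ℝ) • Complex.exp (x * t * Complex.I) +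
      (√3 / (2 * Real.cosh t - 1) : ℝ) • Complex.exp (x * t * Complex.I) =
      (2 * √3 : ℝ) * (Complex.exp (x * t * Complex.I) * (basis 0 |t| : ℝ)) := by
    intro t ht
    have := density_eq ht
    rw [← add_smul, sub_neg_eq_add, add_comm, this, Complex.real_smul]
    push_cast
    ring
  have hI : Integrable fun t : ℝ => (2 * √3 : ℝ) * (Complex.exp (x * t * Complex.I) *
      (basis 0 |t| : ℝ)) := by
    refine Integrable.const_mul ?_ _
    refine (integrable_comp_abs (integrableOn_basis 0)).ofReal.bdd_mul (c := 1) (by fun_prop)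
      (Eventually.of_forall fun t => ?_)
    rw [← Complex.ofReal_mul, Complex.norm_exp_ofReal_mul_I]
  have hJ : ∀ s : ℝ, |s| = 1 → Integrable fun t : ℝ =>
      (√3 / (2 * Real.cosh t - s) : ℝ) • Complex.exp (x * t * Complex.I) := by
    intro s hs
    have hs2 : s ^ 2 = 1 := by rw [← sq_abs, hs, one_pow]
    have hfin : volume (branch s '' univ) ≠ ⊤ := by
      rcases (abs_eq one_pos.le).1 hs with rfl | rfl
      · rw [image_branch_one]; simp
      · rw [image_branch_neg_one]; simp
    have := (integrableOn_image_iff_integrableOn_abs_deriv_smul MeasurableSet.univ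
      (fun t _ => (hasDerivAt_branch hs2 t).hasDerivWithinAt) (branch_injective hs).injOn
      (fun θ => Complex.exp (x * logFactor θ * Complex.I))).1 (integrableOn_exp_logFactor x _ hfin)
    rw [integrableOn_univ] at this
    refine this.congr (Eventually.of_forall fun t => ?_)
    have hc := Real.one_le_cosh t
    have hs1 : s ≤ 1 := by nlinarith
    have hpos : 0 < 2 * Real.cosh t - s := by linarith
    simp only [logFactor_branch hs, abs_mul, hs, one_mul]
    rw [abs_of_pos (by positivity)]
  rw [← integral_add (hJ (-1) (by simp)) (hJ 1 (by simp))]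
  have : ∫ t : ℝ, ((√3 / (2 * Real.cosh t - -1) : ℝ) • Complex.exp (x * t * Complex.I) +
      (√3 / (2 * Real.cosh t - 1) : ℝ) • Complex.exp (x * t * Complex.I)) =
      ∫ t : ℝ, (2 * √3 : ℝ) * (Complex.exp (x * t * Complex.I) * (basis 0 |t| : ℝ)) := by
    refine integral_congr_ae ?_
    filter_upwards [Measure.ae_ne volume (0 : ℝ)] with t ht using hd t ht
  rw [this, integral_const_mul, integral_exp_mul_comp_abs (integrableOn_basis 0),
    ← Complex.ofReal_mul]
  congr 1
  have h0 := (isConv_gam x).1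
  rw [gam, trans, zero_add, pow_one] at h0
  have hs : √3 * √3 = 3 := Real.mul_self_sqrt (by norm_num)
  have : 2 * ∫ t : ℝ in Ioi 0, basis 0 t * Real.cos (x * t) =
      Real.pi / 3 * (√3 * (1 / (2 * Real.cosh (Real.pi * x / 3) - 1))) := by
    rw [← h0]
    field_simp
  rw [this]
  linear_combination 2 / 3 * Real.pi * (1 / (2 * Real.cosh (Real.pi * x / 3) - 1)) * hs

/-! ## The distribution of the sum of several factors -/

/-- The product of `N` copies of `circleVol`. -/
def torusVol (N : ℕ) : Measure (Fin N → ℝ) := Measure.pi fun _ => circleVol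

instance (N : ℕ) : IsFiniteMeasure (torusVol N) := by unfold torusVol; infer_instance

/-- The sum of the logarithms of `N` factors. -/
def logSum (N : ℕ) (θ : Fin N → ℝ) : ℝ := ∑ j, logFactor (θ j)

theorem measurable_logSum (N : ℕ) : Measurable (logSum N) :=
  Finset.measurable_fun_sum _ fun j _ => measurable_logFactor.comp (measurable_pi_apply j)

theorem charFun_map_logSum (N : ℕ) (x : ℝ) :
    charFun ((torusVol N).map (logSum N)) x =
      (((2 * Real.pi * (1 / (2 * Real.cosh (Real.pi * x / 3) - 1))) ^ N : ℝ) : ℂ) := by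
  rw [charFun_apply_real, integral_map (measurable_logSum N).aemeasurable
    (continuous_exp_mul_I x).measurable.aestronglyMeasurable]
  have : ∀ θ : Fin N → ℝ, Complex.exp (x * (logSum N θ : ℝ) * Complex.I) =
      ∏ j, Complex.exp (x * logFactor (θ j) * Complex.I) := by
    intro θ
    rw [← Complex.exp_sum, logSum]
    push_cast
    rw [Finset.mul_sum, Finset.sum_mul]
  simp only [this]
  rw [torusVol, integral_fintype_prod_eq_prod
    (fun (_ : Fin N) (t : ℝ) => Complex.exp (x * logFactor t * Complex.I))]
  rw [Finset.prod_const, integral_exp_logFactor, Finset.card_univ, Fintype.card_fin]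
  push_cast
  rfl

/-- The kernel with a = 5/2 decays like e^{-t/2}, and t ≤ 4e^{t/4} spends half of that decay. -/
theorem integrableOn_mul_basis (j : ℕ) : IntegrableOn (fun t => t * basis j t) (Ioi 0) := by
  refine Integrable.mono' ((integrableOn_exp_neg (b := 1 / 4) (by norm_num)).const_mul
    (4 * ((j ! : ℝ) * 2 ^ j))) (measurable_id.mul (measurable_basis j)).aestronglyMeasurable ?_
  refine (ae_restrict_iff' measurableSet_Ioi).2 (Eventually.of_forall fun t (ht : 0 < t) => ?_)
  have hb := basis_nonneg j ht
  rw [Real.norm_of_nonneg (by positivity)]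
  have := le_hasSum (hasSum_basis (1 / 2) (t := t)) j (fun i _ => by
    have := basis_nonneg i ht; positivity)
  have hk := ker_le_exp (a := 2 + 1 / 2) (by norm_num) ht
  have hexp := Real.add_one_le_exp (1 / 4 * t)
  have f : (j ! : ℝ) ≠ 0 := by positivity
  calc t * basis j t = (j ! : ℝ) * 2 ^ j * (t * ((1 / 2) ^ j / j ! * basis j t)) := by
        rw [one_div, inv_pow]; field_simp
    _ ≤ (j ! : ℝ) * 2 ^ j * ((4 * Real.exp (1 / 4 * t)) * Real.exp (-(3 - (2 + 1 / 2)) * t)) := by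
        gcongr
        · linarith
        · exact this.trans hk
    _ = 4 * ((j ! : ℝ) * 2 ^ j) * Real.exp (-(1 / 4) * t) := by
        rw [mul_assoc 4 (Real.exp _), ← Real.exp_add]
        ring_nf

/-- The positive and the negative part of a signed density. -/
theorem integral_withDensity_sub {E : Type*} [NormedAddCommGroup E] [NormedSpace ℝ E] {D : ℝ → ℝ}
    (hD : Measurable D) {g : ℝ → E} (hg : AEStronglyMeasurable g volume)
    (h : Integrable fun t => D t • g t) :
    Integrable g (volume.withDensity fun t => ENNReal.ofReal (D t)) ∧
      Integrable g (volume.withDensity fun t => ENNReal.ofReal (-D t)) ∧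
      ∫ t, g t ∂(volume.withDensity fun t => ENNReal.ofReal (D t)) -
        ∫ t, g t ∂(volume.withDensity fun t => ENNReal.ofReal (-D t)) = ∫ t, D t • g t := by
  have hm1 : Measurable fun t => (D t).toNNReal := hD.real_toNNReal
  have hm2 : Measurable fun t => (-D t).toNNReal := hD.neg.real_toNNReal
  have i1 : Integrable fun t => (D t).toNNReal • g t := by
    refine h.mono (hm1.aestronglyMeasurable.smul hg) (Eventually.of_forall fun t => ?_)
    rw [NNReal.smul_def, norm_smul, norm_smul, Real.coe_toNNReal']
    gcongr
    rw [Real.norm_eq_abs, Real.norm_eq_abs, abs_of_nonneg (le_max_right _ _)]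
    exact max_le (le_abs_self _) (abs_nonneg _)
  have i2 : Integrable fun t => (-D t).toNNReal • g t := by
    refine h.mono (hm2.aestronglyMeasurable.smul hg) (Eventually.of_forall fun t => ?_)
    rw [NNReal.smul_def, norm_smul, norm_smul, Real.coe_toNNReal']
    gcongr
    rw [Real.norm_eq_abs, Real.norm_eq_abs, abs_of_nonneg (le_max_right _ _)]
    exact max_le (neg_le_abs _) (abs_nonneg _)
  refine ⟨(integrable_withDensity_iff_integrable_smul hm1).2 i1,
    (integrable_withDensity_iff_integrable_smul hm2).2 i2, ?_⟩
  have e1 := integral_withDensity_eq_integral_smul (μ := volume) hm1 g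
  have e2 := integral_withDensity_eq_integral_smul (μ := volume) hm2 g
  refine (congrArg₂ (· - ·) e1 e2).trans ?_
  rw [← integral_sub i1 i2]
  congr 1
  ext t
  rw [NNReal.smul_def, NNReal.smul_def, ← sub_smul, Real.coe_toNNReal', Real.coe_toNNReal',
    max_zero_sub_max_neg_zero_eq_self]

/-- Integrals with respect to the law of the sum of the factors, given by a density. -/
theorem integral_map_logSum {N : ℕ} {F : ℝ → ℝ} (hF : IntegrableOn F (Ioi 0))
    (htF : IntegrableOn (fun t => t * F t) (Ioi 0)) (hmeas : Measurable F)
    (hchar : ∀ x : ℝ, 2 * ∫ t : ℝ in Ioi 0, F t * Real.cos (x * t) =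
      (1 / (2 * Real.cosh (Real.pi * x / 3) - 1)) ^ N) :
    Integrable (logSum N) (torusVol N) ∧
      ∫ θ, max (logSum N θ) 0 ∂(torusVol N) = (2 * Real.pi) ^ N * ∫ t : ℝ in Ioi 0, t * F t := by
  set D : ℝ → ℝ := fun t => (2 * Real.pi) ^ N * F |t| with hD
  have hDint : Integrable D := (integrable_comp_abs hF).const_mul _
  have hDm : Measurable D := (hmeas.comp measurable_abs).const_mul _
  set p : Measure ℝ := volume.withDensity fun t => ENNReal.ofReal (D t) with hp
  set q : Measure ℝ := volume.withDensity fun t => ENNReal.ofReal (-D t) with hq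
  have : IsFiniteMeasure p := isFiniteMeasure_withDensity_ofReal hDint.2
  have : IsFiniteMeasure q := isFiniteMeasure_withDensity_ofReal hDint.neg.2
  set μ := (torusVol N).map (logSum N) with hμ
  have hexp : ∀ (x : ℝ) (m : Measure ℝ) [IsFiniteMeasure m],
      Integrable (fun t : ℝ => Complex.exp (x * t * Complex.I)) m := fun x m _ =>
    Integrable.of_bound (C := 1) (continuous_exp_mul_I x).measurable.aestronglyMeasurable
      (Eventually.of_forall fun t => by
        rw [← Complex.ofReal_mul, Complex.norm_exp_ofReal_mul_I])
  -- The sign of D is not known, so p and q carry its positive and negative parts. Comparing μ + q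
  -- with p keeps all measures positive and finite, and characteristic functions determine them.
  have hlaw : μ + q = p := by
    refine Measure.ext_of_charFun (funext fun x => ?_)
    have hi : Integrable fun t : ℝ => D t • Complex.exp (x * t * Complex.I) := by
      refine hDint.mono (hDm.aestronglyMeasurable.smul
        (continuous_exp_mul_I x).measurable.aestronglyMeasurable) (Eventually.of_forall fun t => ?_)
      rw [norm_smul, ← Complex.ofReal_mul, Complex.norm_exp_ofReal_mul_I, mul_one]
    obtain ⟨-, -, h⟩ := integral_withDensity_sub hDm
      (continuous_exp_mul_I x).measurable.aestronglyMeasurable hi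
    have hμx := charFun_map_logSum N x
    rw [charFun_apply_real] at hμx
    rw [charFun_apply_real, charFun_apply_real, integral_add_measure (hexp x μ) (hexp x q), hμx,
      ← eq_sub_iff_add_eq, h]
    have e : ∀ t : ℝ, D t • Complex.exp (x * t * Complex.I) =
        ((2 * Real.pi) ^ N : ℝ) * (Complex.exp (x * t * Complex.I) * (F |t| : ℝ)) := by
      intro t
      rw [hD, Complex.real_smul]
      push_cast
      ring
    simp only [e]
    rw [integral_const_mul, integral_exp_mul_comp_abs hF, hchar, ← Complex.ofReal_mul, mul_pow]
  -- Domination by p transfers the first moment, hence integrability of the logarithmic sum, to μ.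
  have hle : μ ≤ p := by rw [← hlaw]; exact Measure.le_add_right le_rfl
  have hDt : Integrable fun t => D t • t := by
    have h1 := (integrable_comp_abs htF).const_mul ((2 * Real.pi) ^ N)
    refine h1.mono (hDm.mul measurable_id).aestronglyMeasurable (Eventually.of_forall fun t => ?_)
    rw [hD, smul_eq_mul, norm_mul, norm_mul, norm_mul, norm_mul, norm_abs_eq_norm]
    exact le_of_eq (by ring)
  obtain ⟨j1, -, -⟩ := integral_withDensity_sub hDm measurable_id.aestronglyMeasurable hDt
  have hDt' : Integrable fun t => D t • max t 0 := by
    refine hDt.mono (hDm.smul (measurable_id.max measurable_const)).aestronglyMeasurable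
      (Eventually.of_forall fun t => ?_)
    rw [norm_smul, norm_smul]
    gcongr
    rw [Real.norm_eq_abs, Real.norm_eq_abs, abs_of_nonneg (le_max_right _ _)]
    exact max_le (le_abs_self _) (abs_nonneg _)
  obtain ⟨k1, k2, k3⟩ := integral_withDensity_sub hDm (g := fun t : ℝ => max t 0)
    (measurable_id.max measurable_const).aestronglyMeasurable hDt'
  have hL := (measurable_logSum N).aemeasurable (μ := torusVol N)
  refine ⟨?_, ?_⟩
  · have : Integrable (fun t : ℝ => t) μ := j1.mono_measure hle
    exact (integrable_map_measure measurable_id.aestronglyMeasurable hL).1 this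
  · have e1 : ∫ θ, max (logSum N θ) 0 ∂(torusVol N) = ∫ t, max t 0 ∂μ :=
      (integral_map hL (measurable_id.max measurable_const).aestronglyMeasurable).symm
    have e2 : ∫ t, max t 0 ∂p = ∫ t, max t 0 ∂μ + ∫ t, max t 0 ∂q := by
      rw [← hlaw, integral_add_measure (k1.mono_measure hle) k2]
    rw [e1, eq_sub_of_add_eq e2.symm]
    refine k3.trans ?_
    rw [← integral_const_mul, ← setIntegral_eq_integral_of_forall_compl_eq_zero (s := Ioi 0)]
    · refine setIntegral_congr_fun measurableSet_Ioi fun t (ht : 0 < t) => ?_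
      simp only [hD, abs_of_pos ht, max_eq_left ht.le, smul_eq_mul]
      ring
    · intro t ht
      rw [max_eq_right (by simpa using ht), smul_zero]

end MahlerQ
end

noncomputable section

namespace MahlerQ
open MeasureTheory Set Filter Topology

/-! ## Jensen's formula in the last variable -/

theorem restrict_Icc_eq_torusVol (N : ℕ) :
    (volume.restrict (Icc (0 : Fin N → ℝ) fun _ => 2 * Real.pi)) = torusVol N := by
  have : Icc (0 : Fin N → ℝ) (fun _ => 2 * Real.pi) =
      Set.pi univ fun _ => Icc (0 : ℝ) (2 * Real.pi) := by
    rw [← pi_univ_Icc]; rfl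
  rw [this, volume_pi, Measure.restrict_pi_pi]
  rfl

theorem countable_exp_eq (z : ℂ) : {ψ : ℝ | Complex.exp (ψ * Complex.I) = z}.Countable := by
  rcases Set.eq_empty_or_nonempty {ψ : ℝ | Complex.exp (ψ * Complex.I) = z} with h | ⟨ψ₀, h₀⟩
  · rw [h]; exact countable_empty
  · refine (countable_range fun n : ℤ => ψ₀ + n * (2 * Real.pi)).mono fun ψ hψ => ?_
    have h : Complex.exp (ψ * Complex.I) = Complex.exp (ψ₀ * Complex.I) := hψ.trans h₀.symm
    obtain ⟨n, hn⟩ := Complex.exp_eq_exp_iff_exists_int.1 h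
    refine ⟨n, ?_⟩
    have h2 : (ψ : ℂ) = ψ₀ + n * (2 * Real.pi) := by
      apply mul_right_cancel₀ Complex.I_ne_zero
      linear_combination hn
    have : ((ψ₀ + n * (2 * Real.pi) : ℝ) : ℂ) = ψ := by rw [h2]; push_cast; ring
    exact_mod_cast this

/-- Poles must be excluded together with zeros, since division by zero also gives the value 0. -/
theorem ae_factor_ne_zero : ∀ᵐ θ ∂circleVol, factor θ ≠ 0 := by
  refine ae_restrict_of_ae ?_
  have h := ((countable_exp_eq (-om)).union (countable_exp_eq (-1))).ae_notMem volume
  filter_upwards [h] with θ hθ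
  simp only [mem_union, mem_ofPred_eq, not_or] at hθ
  exact div_ne_zero (fun h => hθ.1 (eq_neg_of_add_eq_zero_left h))
    (fun h => hθ.2 (eq_neg_of_add_eq_zero_left h))

theorem ae_posLog_prod (N : ℕ) :
    ∀ᵐ θ ∂(torusVol N), Real.posLog ‖∏ j, factor (θ j)‖ = max (logSum N θ) 0 := by
  have h : ∀ᵐ θ ∂(torusVol N), ∀ j, factor (θ j) ≠ 0 :=
    eventually_all.2 fun j => (Measure.tendsto_eval_ae_ae (μ := fun _ : Fin N => circleVol)
      (i := j)).eventually ae_factor_ne_zero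
  filter_upwards [h] with θ hθ
  rw [Real.posLog, norm_prod, Real.log_prod (fun j _ => norm_ne_zero_iff.2 (hθ j)), max_comm]
  rfl

theorem integrable_log_norm_exp_add (a : ℂ) :
    Integrable (fun ψ : ℝ => Real.log ‖Complex.exp (ψ * Complex.I) + a‖) circleVol := by
  have h := circleIntegrable_log_norm_sub_const (a := -a) (c := 0) 1
  rw [CircleIntegrable, intervalIntegrable_iff_integrableOn_Icc_of_le (by positivity)] at h
  simpa [circleMap, circleVol, IntegrableOn] using h

theorem integral_log_norm_exp_add (a : ℂ) :
    ∫ ψ, Real.log ‖Complex.exp (ψ * Complex.I) + a‖ ∂circleVol = 2 * Real.pi * Real.posLog ‖a‖ := by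
  rw [← circleAverage_log_norm_add_const_eq_posLog, Real.circleAverage,
    intervalIntegral.integral_of_le (by positivity), ← integral_Icc_eq_integral_Ioc, smul_eq_mul,
    mul_inv_cancel_left₀ (by positivity)]
  simp [circleMap, circleVol]

/-- Write |log r| = 2 log⁺ r - log r, bound log⁺ of the sum by log 2 + log⁺ |a|, and evaluate the
integral of log r by Jensen. The bound is linear in log⁺ |a|, so it can be integrated over the
remaining torus. -/
theorem integral_abs_log_norm_exp_add_le (a : ℂ) :
    ∫ ψ, ‖Real.log ‖Complex.exp (ψ * Complex.I) + a‖‖ ∂circleVol ≤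
      2 * Real.pi * (2 * Real.log 2 + Real.posLog ‖a‖) := by
  have hI := integrable_log_norm_exp_add a
  have h1 : ∫ ψ, ‖Real.log ‖Complex.exp (ψ * Complex.I) + a‖‖ ∂circleVol ≤
      ∫ ψ, (2 * (Real.log 2 + Real.posLog ‖a‖) -
        Real.log ‖Complex.exp (ψ * Complex.I) + a‖) ∂circleVol := by
    refine integral_mono hI.norm ((integrable_const _).sub hI) fun ψ => ?_
    have h2 : Real.posLog ‖Complex.exp (ψ * Complex.I) + a‖ ≤ Real.log 2 + Real.posLog ‖a‖ := by
      have := Real.posLog_norm_add_le (Complex.exp (ψ * Complex.I)) a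
      rw [Complex.norm_exp_ofReal_mul_I] at this
      simpa [add_comm, add_left_comm] using this
    have h3 : |Real.log ‖Complex.exp (ψ * Complex.I) + a‖| =
        2 * Real.posLog ‖Complex.exp (ψ * Complex.I) + a‖ -
          Real.log ‖Complex.exp (ψ * Complex.I) + a‖ := by
      rw [Real.posLog]
      rcases le_total 0 (Real.log ‖Complex.exp (ψ * Complex.I) + a‖) with h | h
      · rw [abs_of_nonneg h, max_eq_right h]; ring
      · rw [abs_of_nonpos h, max_eq_left h]; ring
    simp only [Real.norm_eq_abs]
    linarith
  refine h1.trans_eq ?_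
  rw [integral_sub (integrable_const _) hI, integral_log_norm_exp_add, integral_const]
  have : circleVol.real univ = 2 * Real.pi := by
    simp [circleVol, Measure.real, ENNReal.toReal_ofReal Real.pi_pos.le]
  rw [this, smul_eq_mul]
  ring

/-- The logarithm of `|Q|` as a function of the last angle and of the other angles. -/
def logQ (N : ℕ) (z : ℝ × (Fin N → ℝ)) : ℝ :=
  Real.log ‖Complex.exp (z.1 * Complex.I) + ∏ j, factor (z.2 j)‖

theorem measurable_logQ (N : ℕ) : Measurable (logQ N) := by
  refine Real.measurable_log.comp (Measurable.norm (Measurable.add (by fun_prop) ?_))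
  exact Finset.measurable_fun_prod _ fun j _ =>
    measurable_factor.comp ((measurable_pi_apply j).comp measurable_snd)

theorem integrable_logQ {N : ℕ} (h : Integrable (logSum N) (torusVol N)) :
    Integrable (logQ N) (circleVol.prod (torusVol N)) := by
  have hpos : Integrable (fun θ => max (logSum N θ) 0) (torusVol N) := h.pos_part
  have hmax : Integrable (fun θ => 2 * Real.pi * (2 * Real.log 2 + max (logSum N θ) 0))
      (torusVol N) := ((integrable_const (2 * Real.log 2)).add hpos).const_mul _
  have hm : AEStronglyMeasurable (fun θ => ∫ ψ, ‖logQ N (ψ, θ)‖ ∂circleVol) (torusVol N) :=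
    ((measurable_logQ N).norm.stronglyMeasurable.integral_prod_left'
      (μ := circleVol)).aestronglyMeasurable
  have hsec : ∀ θ, Integrable (fun ψ => logQ N (ψ, θ)) circleVol := fun θ => by
    simpa only [logQ] using integrable_log_norm_exp_add (∏ j, factor (θ j))
  have hle : ∀ᵐ θ ∂(torusVol N), ‖∫ ψ, ‖logQ N (ψ, θ)‖ ∂circleVol‖ ≤
      2 * Real.pi * (2 * Real.log 2 + max (logSum N θ) 0) := by
    filter_upwards [ae_posLog_prod N] with θ hθ
    rw [Real.norm_of_nonneg (integral_nonneg fun _ => norm_nonneg _), ← hθ]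
    simpa only [logQ] using integral_abs_log_norm_exp_add_le (∏ j, factor (θ j))
  exact (integrable_prod_iff' (measurable_logQ N).aestronglyMeasurable).2
    ⟨Eventually.of_forall hsec, hmax.mono' hm hle⟩

theorem log_norm_Q_torusMap (N : ℕ) (θ : Fin (N + 1) → ℝ) :
    Real.log ‖Q N (torusMap 0 1 θ)‖ =
      logQ N (MeasurableEquiv.piFinSuccAbove (fun _ => ℝ) (Fin.last N) θ) := by
  have : MeasurableEquiv.piFinSuccAbove (fun _ => ℝ) (Fin.last N) θ =
      (θ (Fin.last N), fun j => θ j.castSucc) := by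
    ext j
    · rfl
    · simp [MeasurableEquiv.piFinSuccAbove, Fin.init]
  rw [this]
  simp [logQ, Q, torusMap, factor]

/-- Jensen's formula: reduction to the law of the sum of the logarithms of the factors. -/
theorem mahler_Q_eq {N : ℕ} (h : Integrable (logSum N) (torusVol N)) :
    MahlerConverges (Q N) ∧
      mahler (Q N) = ((2 * Real.pi) ^ N)⁻¹ * ∫ θ, max (logSum N θ) 0 ∂(torusVol N) := by
  have hmp : MeasurePreserving (MeasurableEquiv.piFinSuccAbove (fun _ => ℝ) (Fin.last N))
      (torusVol (N + 1)) (circleVol.prod (torusVol N)) :=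
    measurePreserving_piFinSuccAbove (fun _ : Fin (N + 1) => circleVol) (Fin.last N)
  have hGi := integrable_logQ h
  refine ⟨?_, ?_⟩
  · rw [MahlerConverges, TorusIntegrable, IntegrableOn, restrict_Icc_eq_torusVol]
    simp only [log_norm_Q_torusMap]
    exact hmp.integrable_comp_of_integrable hGi
  · rw [mahler, restrict_Icc_eq_torusVol]
    simp only [log_norm_Q_torusMap]
    have e2 : ∫ z, logQ N z ∂(circleVol.prod (torusVol N)) =
        ∫ θ, 2 * Real.pi * max (logSum N θ) 0 ∂(torusVol N) := by
      rw [integral_prod_symm _ hGi]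
      refine integral_congr_ae ?_
      filter_upwards [ae_posLog_prod N] with θ hθ
      rw [← hθ, ← integral_log_norm_exp_add]
      rfl
    rw [hmp.integral_comp', e2, integral_const_mul, pow_succ, mul_inv, mul_assoc,
      inv_mul_cancel_left₀ (by positivity)]

end MahlerQ
end

noncomputable section

namespace MahlerQ
open MeasureTheory Set Filter Topology

/-! ## Moments of the basic kernels as values of Dirichlet series -/

theorem hasSum_residue (r : ℕ) (hr : r < 6) {q : ℝ} (h0 : 0 ≤ q) (h1 : q < 1) :
    HasSum (fun n : ℕ => if n % 6 = r then q ^ n else 0) (q ^ r * (1 - q ^ 6)⁻¹) := by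
  have hinj : Function.Injective fun k : ℕ => 6 * k + r := fun a b h => by
    simp only at h; omega
  rw [← hinj.hasSum_iff (fun n hn => ?_)]
  · have h := (hasSum_geometric_of_lt_one (by positivity : 0 ≤ q ^ 6)
      (pow_lt_one₀ h0 h1 (by norm_num))).mul_left (q ^ r)
    refine h.congr_fun fun k => ?_
    simp only [Function.comp_apply]
    rw [if_pos (by omega), ← pow_mul, ← pow_add, add_comm]
  · rw [if_neg]
    rintro rfl
    exact hn ⟨n / 6, by simp only; omega⟩

theorem hasSum_char {f : ℕ → ℂ} {e : ℝ}
    (hf : ∀ n : ℕ, f n = ((if n % 6 = 1 then 1 else 0) + e * (if n % 6 = 5 then 1 else 0) : ℝ))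
    {t : ℝ} (ht : 0 < t) :
    HasSum (fun n : ℕ => f n * (Real.exp (-(n : ℝ) * t) : ℂ))
      (((Real.exp (2 * t) + e * Real.exp (-(2 * t))) /
        (Real.exp (3 * t) - Real.exp (-(3 * t))) : ℝ) : ℂ) := by
  have hq : Real.exp (-t) < 1 := by rw [Real.exp_lt_one_iff]; linarith
  have h := (hasSum_residue 1 (by norm_num) (Real.exp_pos (-t)).le hq).add
    ((hasSum_residue 5 (by norm_num) (Real.exp_pos (-t)).le hq).mul_left e)
  have hval : Real.exp (-t) ^ 1 * (1 - Real.exp (-t) ^ 6)⁻¹ +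
      e * (Real.exp (-t) ^ 5 * (1 - Real.exp (-t) ^ 6)⁻¹) =
      (Real.exp (2 * t) + e * Real.exp (-(2 * t))) / (Real.exp (3 * t) - Real.exp (-(3 * t))) := by
    have e1 : Real.exp (2 * t) = (Real.exp (-t) ^ 2)⁻¹ := by
      rw [← Real.exp_nat_mul, ← Real.exp_neg]; push_cast; ring_nf
    have e2 : Real.exp (3 * t) = (Real.exp (-t) ^ 3)⁻¹ := by
      rw [← Real.exp_nat_mul, ← Real.exp_neg]; push_cast; ring_nf
    have e3 : Real.exp (-(2 * t)) = Real.exp (-t) ^ 2 := by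
      rw [← Real.exp_nat_mul]; push_cast; ring_nf
    have e4 : Real.exp (-(3 * t)) = Real.exp (-t) ^ 3 := by
      rw [← Real.exp_nat_mul]; push_cast; ring_nf
    rw [e1, e2, e3, e4]
    have hp := Real.exp_pos (-t)
    set q := Real.exp (-t)
    have h6 : 1 - q ^ 6 ≠ 0 := by
      have := pow_lt_one₀ hp.le hq (show 6 ≠ 0 by norm_num)
      linarith
    have h3 : (q ^ 3)⁻¹ - q ^ 3 ≠ 0 := by
      have : (q ^ 3)⁻¹ - q ^ 3 = (1 - q ^ 6) / q ^ 3 := by field_simp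
      rw [this]
      positivity
    rw [eq_div_iff h3]
    field_simp
  rw [hval] at h
  refine (Complex.hasSum_ofReal.2 h).congr_fun fun n => ?_
  have : Real.exp (-(n : ℝ) * t) = Real.exp (-t) ^ n := by
    rw [← Real.exp_nat_mul]; ring_nf
  rw [hf, this, ← Complex.ofReal_mul]
  congr 1
  split_ifs <;> ring

/-- The kernel is ∑ ψ(n) e^{-nt}, so its Mellin transform at s is Γ(s) L(ψ, s). Here s = m + 2 lies
in the region of absolute convergence. -/
theorem integral_eq_LFunction {ψ : DirichletCharacter ℂ 6} {e : ℝ}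
    (hf : ∀ n : ℕ, ψ n = ((if n % 6 = 1 then 1 else 0) + e * (if n % 6 = 5 then 1 else 0) : ℝ))
    {K : ℝ → ℝ} (hK : ∀ t, K t = (Real.exp (2 * t) + e * Real.exp (-(2 * t))) /
      (Real.exp (3 * t) - Real.exp (-(3 * t)))) (m : ℕ) :
    ((∫ t : ℝ in Ioi 0, t ^ (m + 1) * K t : ℝ) : ℂ) =
      ((m + 1)! : ℂ) * DirichletCharacter.LFunction ψ (m + 2 : ℕ) := by
  have hs : (1 : ℝ) < ((m + 2 : ℕ) : ℂ).re := by
    rw [Complex.natCast_re]; push_cast; linarith [(Nat.cast_nonneg m : (0 : ℝ) ≤ m)]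
  have h := hasSum_mellin (a := fun n : ℕ => ψ n) (p := fun n : ℕ => (n : ℝ))
    (F := fun t => (K t : ℂ)) (s := ((m + 2 : ℕ) : ℂ))
    (fun n => by
      rcases Nat.eq_zero_or_pos n with rfl | hn
      · left; rw [hf]; simp
      · right; exact_mod_cast hn)
    (by linarith)
    (fun t ht => by rw [hK]; exact hasSum_char hf ht)
    (by
      refine Summable.of_nonneg_of_le (fun n => by positivity) (fun n => ?_)
        (Real.summable_one_div_nat_rpow.2 hs)
      gcongr
      exact DirichletCharacter.norm_le_one ψ _)
  have h1 : mellin (fun t => (K t : ℂ)) ((m + 2 : ℕ) : ℂ) =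
      ((∫ t : ℝ in Ioi 0, t ^ (m + 1) * K t : ℝ) : ℂ) := by
    rw [mellin, ← integral_complex_ofReal]
    refine setIntegral_congr_fun measurableSet_Ioi fun t ht => ?_
    have : ((m + 2 : ℕ) : ℂ) - 1 = ((m + 1 : ℕ) : ℂ) := by push_cast; ring
    simp only [this, Complex.cpow_natCast, smul_eq_mul]
    push_cast
    rfl
  rw [← h1, ← h.tsum_eq, DirichletCharacter.LFunction_eq_LSeries ψ hs, LSeries, ← tsum_mul_left]
  refine tsum_congr fun n => ?_
  have hG : Complex.Gamma ((m + 2 : ℕ) : ℂ) = ((m + 1)! : ℂ) := by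
    have := Complex.Gamma_nat_eq_factorial (m + 1)
    rw [← this]; push_cast; ring_nf
  rw [hG, LSeries.term_def]
  split_ifs with hn
  · subst hn
    have : ψ ((0 : ℕ) : ZMod 6) = 0 := by rw [hf]; simp
    rw [this, mul_zero, zero_div]
  · rw [mul_div_assoc]
    push_cast
    rfl

-- The two characters modulo 6 and their moments

theorem trivChar_apply (n : ℕ) : (1 : DirichletCharacter ℂ 6) n =
    ((if n % 6 = 1 then 1 else 0) + 1 * (if n % 6 = 5 then 1 else 0) : ℝ) := by
  have h : ((n : ℕ) : ZMod 6) = ((n % 6 : ℕ) : ZMod 6) := (ZMod.natCast_mod n 6).symm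
  have hlt : n % 6 < 6 := Nat.mod_lt _ (by norm_num)
  rw [h]
  generalize n % 6 = r at *
  interval_cases r
  · rw [MulChar.map_nonunit _ (by decide)]; simp
  · simp
  · rw [MulChar.map_nonunit _ (by decide)]; simp
  · rw [MulChar.map_nonunit _ (by decide)]; simp
  · rw [MulChar.map_nonunit _ (by decide)]; simp
  · rw [MulChar.one_apply (by decide)]; simp

theorem chi_two : chi 2 = -1 := by
  have : quadraticChar (ZMod 3) 2 = -1 := by decide
  simp [chi, MulChar.ringHomComp_apply, this]

/-- The character `chi` at level 6. -/
def chiSix : DirichletCharacter ℂ 6 := DirichletCharacter.changeLevel (by norm_num : 3 ∣ 6) chi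

theorem chiSix_apply (n : ℕ) : chiSix n =
    ((if n % 6 = 1 then 1 else 0) + (-1) * (if n % 6 = 5 then 1 else 0) : ℝ) := by
  have h : ((n : ℕ) : ZMod 6) = ((n % 6 : ℕ) : ZMod 6) := (ZMod.natCast_mod n 6).symm
  have hlt : n % 6 < 6 := Nat.mod_lt _ (by norm_num)
  rw [h]
  generalize n % 6 = r at *
  interval_cases r
  · rw [MulChar.map_nonunit _ (by decide)]; simp
  · simp
  · rw [MulChar.map_nonunit _ (by decide)]; simp
  · rw [MulChar.map_nonunit _ (by decide)]; simp
  · rw [MulChar.map_nonunit _ (by decide)]; simp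
  · have hu : IsUnit ((5 : ℕ) : ZMod 6) := by decide
    obtain ⟨u, hu⟩ := hu
    rw [← hu, chiSix, DirichletCharacter.changeLevel_eq_cast_of_dvd, hu]
    have : (ZMod.cast ((5 : ℕ) : ZMod 6) : ZMod 3) = 2 := by decide
    rw [this, chi_two]
    simp

theorem primeFactors_six : Nat.primeFactors 6 = {2, 3} := by
  rw [show 6 = 2 * 3 by norm_num, Nat.primeFactors_mul (by norm_num) (by norm_num),
    Nat.Prime.primeFactors Nat.prime_two, Nat.Prime.primeFactors Nat.prime_three]
  rfl

/-- cosh 2t / sinh 3t is the sum of e^{-nt} over n prime to 6; the Euler factors of ζ at 2 and 3 are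
removed. -/
theorem integral_mul_basis_odd (h : ℕ) :
    ((∫ t : ℝ in Ioi 0, t * basis (2 * h + 1) t : ℝ) : ℂ) = calC (h + 1) := by
  have hI := integral_eq_LFunction (ψ := 1) trivChar_apply
    (K := fun t => Real.cosh (2 * t) / Real.sinh (3 * t)) (fun t => by
      rw [Real.cosh_eq, Real.sinh_eq, one_mul, div_div_div_cancel_right₀ two_ne_zero]) (2 * h + 1)
  have e : ∀ t : ℝ, t * basis (2 * h + 1) t =
      t ^ (2 * h + 1 + 1) * (Real.cosh (2 * t) / Real.sinh (3 * t)) := by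
    intro t
    simp only [basis]
    rw [if_neg (by simp)]
    ring
  simp only [e]
  have hne : ((2 * h + 1 + 2 : ℕ) : ℂ) ≠ 1 := by
    intro h'
    have : (2 * h + 1 + 2 : ℕ) = 1 := by exact_mod_cast h'
    omega
  have hL : DirichletCharacter.LFunction (1 : DirichletCharacter ℂ 6) =
      DirichletCharacter.LFunctionTrivChar 6 := rfl
  rw [hI, hL, DirichletCharacter.LFunctionTrivChar_eq_mul_riemannZeta hne, primeFactors_six,
    Finset.prod_pair (by norm_num), calC, Complex.cpow_neg, Complex.cpow_neg, Complex.cpow_natCast,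
    Complex.cpow_natCast]
  have e1 : 2 * (h + 1) + 1 = 2 * h + 1 + 2 := by ring
  have e2 : 2 * (h + 1) = 2 * h + 1 + 1 := by ring
  have e3 : (2 * ((h + 1 : ℕ) : ℂ) + 1) = ((2 * h + 1 + 2 : ℕ) : ℂ) := by push_cast; ring
  rw [e3, e1, e2]
  push_cast
  simp only [one_div]
  ring

/-- sinh 2t / sinh 3t carries the character modulo 6 induced by χ₋₃. Since χ₋₃(2) = -1 and χ₋₃(3) =
0, only the factor 1 + 2^{-s} appears. -/
theorem integral_mul_basis_even (h : ℕ) :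
    ((∫ t : ℝ in Ioi 0, t * basis (2 * h) t : ℝ) : ℂ) = calD h := by
  have hI := integral_eq_LFunction (ψ := chiSix) chiSix_apply
    (K := fun t => Real.sinh (2 * t) / Real.sinh (3 * t)) (fun t => by
      rw [Real.sinh_eq, Real.sinh_eq, div_div_div_cancel_right₀ two_ne_zero]; ring_nf) (2 * h)
  have e : ∀ t : ℝ, t * basis (2 * h) t =
      t ^ (2 * h + 1) * (Real.sinh (2 * t) / Real.sinh (3 * t)) := by
    intro t
    simp only [basis]
    rw [if_pos (by simp)]
    ring
  simp only [e]
  have hne : ((2 * h + 2 : ℕ) : ℂ) ≠ 1 := by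
    intro h'
    have : (2 * h + 2 : ℕ) = 1 := by exact_mod_cast h'
    omega
  have hchi3 : chi ((3 : ℕ) : ZMod 3) = 0 := MulChar.map_nonunit _ (by decide)
  have hchi2 : chi ((2 : ℕ) : ZMod 3) = -1 := chi_two
  rw [hI, chiSix, DirichletCharacter.LFunction_changeLevel _ _ (.inr hne), primeFactors_six,
    Finset.prod_pair (by norm_num), hchi2, hchi3, calD, Complex.cpow_neg, Complex.cpow_natCast, L]
  have e3 : (2 * (h : ℂ) + 2) = ((2 * h + 2 : ℕ) : ℂ) := by push_cast; ring
  rw [e3]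
  push_cast
  simp only [one_div]
  ring

end MahlerQ
end

noncomputable section

namespace MahlerQ
open MeasureTheory Set Filter Topology

/-! ## The Mahler measures -/

/-- A linear combination of the members of a family of numbers, sorted by parity of the index. -/
def comb (p q : ℕ → ℝ) (m m' : ℕ) (γ : ℕ → ℝ) : ℝ :=
  ∑ l ∈ Finset.range m, p l * γ (2 * l + 1) + ∑ l ∈ Finset.range m', q l * γ (2 * l)

theorem comb_mul_right (p q : ℕ → ℝ) (m m' : ℕ) (γ : ℕ → ℝ) (y : ℝ) :
    comb p q m m' γ * y = comb p q m m' fun j => γ j * y := by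
  simp only [comb, add_mul, Finset.sum_mul, mul_assoc]

theorem integrableOn_comb (p q : ℕ → ℝ) (m m' : ℕ) {g : ℕ → ℝ → ℝ} {s : Set ℝ}
    (hg : ∀ j, IntegrableOn (g j) s) : IntegrableOn (fun t => comb p q m m' fun j => g j t) s :=
  Integrable.add (integrable_finsetSum _ fun _ _ => (hg _).const_mul _)
    (integrable_finsetSum _ fun _ _ => (hg _).const_mul _)

theorem integral_comb (p q : ℕ → ℝ) (m m' : ℕ) {g : ℕ → ℝ → ℝ} {s : Set ℝ}
    (hg : ∀ j, IntegrableOn (g j) s) :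
    ∫ t in s, (comb p q m m' fun j => g j t) = comb p q m m' fun j => ∫ t in s, g j t := by
  simp only [comb]
  rw [integral_add (integrable_finsetSum _ fun _ _ => (hg _).const_mul _)
    (integrable_finsetSum _ fun _ _ => (hg _).const_mul _),
    integral_finsetSum _ fun _ _ => (hg _).const_mul _,
    integral_finsetSum _ fun _ _ => (hg _).const_mul _]
  simp only [integral_const_mul]

/-- If the powers of the characteristic function are a combination of the basic transforms, then
the Mahler measure is the corresponding combination of the moments of the basic kernels. -/
theorem mahler_eq_of_comb {N m m' : ℕ} {p q : ℕ → ℝ} {e : ℝ}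
    (h : ∀ x, e * comb p q m m' (gam x) = (1 / (2 * Real.cosh (Real.pi * x / 3) - 1)) ^ N) :
    MahlerConverges (Q N) ∧ (mahler (Q N) : ℂ) = e *
      (∑ h ∈ Finset.Icc 1 m, (p (h - 1) : ℂ) * (3 / (Real.pi : ℂ)) ^ (2 * h) * calC h
        + ∑ h ∈ Finset.range m', (q h : ℂ) * (3 / (Real.pi : ℂ)) ^ (2 * h + 1) * calD h) := by
  set B : ℕ → ℝ → ℝ := fun j t => (3 / Real.pi) ^ (j + 1) * basis j t with hB
  set F : ℝ → ℝ := fun t => e * comb p q m m' fun j => B j t with hF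
  have hBi : ∀ j, IntegrableOn (B j) (Ioi 0) := fun j => (integrableOn_basis j).const_mul _
  have hBt : ∀ j, IntegrableOn (fun t => B j t * t) (Ioi 0) := fun j => by
    refine IntegrableOn.congr_fun ((integrableOn_mul_basis j).const_mul ((3 / Real.pi) ^ (j + 1)))
      (fun t _ => ?_) measurableSet_Ioi
    simp only [hB]
    ring
  have hBc : ∀ x j, IntegrableOn (fun t => B j t * Real.cos (x * t)) (Ioi 0) := fun x j => by
    refine IntegrableOn.congr_fun
      ((integrableOn_basis_mul_cos x j).const_mul ((3 / Real.pi) ^ (j + 1)))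
      (fun t _ => ?_) measurableSet_Ioi
    simp only [hB]
    ring
  have hBm : ∀ j, Measurable (B j) := fun j => (measurable_basis j).const_mul _
  have hFm : Measurable F := by
    refine Measurable.const_mul (Measurable.add ?_ ?_) e
    all_goals exact Finset.measurable_fun_sum _ fun _ _ => (hBm _).const_mul _
  have hFt : ∀ t, t * F t = e * comb p q m m' fun j => B j t * t := fun t => by
    rw [← comb_mul_right, hF]
    ring
  have hFc : ∀ x t, F t * Real.cos (x * t) =
      e * comb p q m m' fun j => B j t * Real.cos (x * t) := fun x t => by
    rw [← comb_mul_right, hF]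
    ring
  have hchar : ∀ x, 2 * ∫ t in Ioi 0, F t * Real.cos (x * t) =
      (1 / (2 * Real.cosh (Real.pi * x / 3) - 1)) ^ N := fun x => by
    simp only [hFc]
    rw [← h, integral_const_mul, integral_comb p q m m' (hBc x), mul_left_comm, mul_comm 2,
      comb_mul_right]
    congr 2
    funext j
    simp only [hB, gam, trans, mul_assoc, integral_const_mul]
    ring
  have hint : IntegrableOn (fun t => t * F t) (Ioi 0) := by
    simp only [hFt]
    exact (integrableOn_comb p q m m' hBt).const_mul e
  obtain ⟨hi, hv⟩ := integral_map_logSum (F := F)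
    ((integrableOn_comb p q m m' hBi).const_mul e) hint hFm hchar
  obtain ⟨hc, hm⟩ := mahler_Q_eq hi
  refine ⟨hc, ?_⟩
  have hmom : ∀ j, ∫ t in Ioi 0, B j t * t =
      (3 / Real.pi) ^ (j + 1) * ∫ t in Ioi 0, t * basis j t := fun j => by
    rw [← integral_const_mul]
    congr 1
    funext t
    simp only [hB]
    ring
  rw [hm, hv, inv_mul_cancel_left₀ (by positivity)]
  simp only [hFt]
  rw [integral_const_mul, integral_comb p q m m' hBt]
  simp only [hmom, comb]
  rw [← Finset.Ico_add_one_right_eq_Icc, Finset.sum_Ico_eq_sum_range]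
  push_cast
  simp only [← integral_mul_basis_even, ← integral_mul_basis_odd, add_comm 1, Nat.add_sub_cancel,
    Nat.mul_add, mul_assoc, mul_one]

theorem mahler_even {n : ℕ} (hn : 1 ≤ n) :
    MahlerConverges (Q (2 * n)) ∧ (mahler (Q (2 * n)) : ℂ) = 2 / 12 ^ n *
      (∑ h ∈ Finset.Icc 1 n, (a n (h - 1) : ℂ) * (3 / (Real.pi : ℂ)) ^ (2 * h) * calC h
        + ∑ h ∈ Finset.range n, (b n h : ℂ) * (3 / (Real.pi : ℂ)) ^ (2 * h + 1) * calD h) := by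
  have h := mahler_eq_of_comb (N := 2 * n) (m := n) (m' := n) (p := a n) (q := b n)
    (e := 2 / 12 ^ n) fun x => (isConv_gam x).2.combEven_eq (isConv_gam x).1 (by omega)
  simpa using h

theorem mahler_odd (n : ℕ) :
    MahlerConverges (Q (2 * n + 1)) ∧ (mahler (Q (2 * n + 1)) : ℂ) = 1 / 12 ^ n *
      (1 / ((√3 : ℝ) : ℂ) * ∑ h ∈ Finset.Icc 1 n,
          (c n (h - 1) : ℂ) * (3 / (Real.pi : ℂ)) ^ (2 * h) * calC h
        + 1 / ((√3 : ℝ) : ℂ) * ∑ h ∈ Finset.range (n + 1),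
          (d n h : ℂ) * (3 / (Real.pi : ℂ)) ^ (2 * h + 1) * calD h) := by
  have h := mahler_eq_of_comb (N := 2 * n + 1) (m := n) (m' := n + 1) (p := c n) (q := d n)
    (e := 1 / 12 ^ n * (1 / √3)) fun x => (isConv_gam x).2.combOdd_eq (isConv_gam x).1 n
  refine ⟨h.1, ?_⟩
  rw [h.2, ← mul_add, ← mul_assoc]
  push_cast
  rfl

theorem mahlerConverges_Q {N : ℕ} (hN : 1 ≤ N) : MahlerConverges (Q N) := by
  rcases Nat.even_or_odd' N with ⟨n, rfl | rfl⟩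
  · exact (mahler_even (by omega)).1
  · exact (mahler_odd n).1

end MahlerQ
end

noncomputable section

namespace MahlerQ
open MeasureTheory Set Filter Topology

/-! ## The first coefficients -/

theorem recPoly_zero (m : ℝ) (g : ℕ → ℝ[X]) : recPoly m g 0 = g 0 := by
  rw [recPoly_eq, show (Finset.Icc 2 (0 + 1)).filter Odd = ∅ by decide]
  simp

theorem recPoly_one (m : ℝ) (g : ℕ → ℝ[X]) : recPoly m g 1 = g 1 := by
  rw [recPoly_eq, show (Finset.Icc 2 (1 + 1)).filter Odd = ∅ by decide]
  simp

/-- The homogeneous part begins with j = 3, so it is absent for k ≤ 1 and reduces to one term for k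
= 2. -/
theorem recPoly_two (m : ℝ) (g : ℕ → ℝ[X]) :
    recPoly m g 2 = Polynomial.C (m ^ 2 / 3) * g 0 + g 2 := by
  rw [recPoly_eq, show (Finset.Icc 2 (2 + 1)).filter Odd = {3} by decide, Finset.sum_singleton,
    ← mul_assoc, ← Polynomial.C_mul, show 2 + 1 - 3 = 0 by rfl, recPoly_zero]
  congr 3
  norm_num
  ring

theorem filter_even_two : (Finset.range (0 + 2)).filter Even = {0} := by decide
theorem filter_even_three : (Finset.range (1 + 2)).filter Even = {0, 2} := by decide
theorem filter_even_four : (Finset.range (2 + 2)).filter Even = {0, 2} := by decide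
theorem filter_odd_two : (Finset.range (0 + 2)).filter Odd = {1} := by decide
theorem filter_odd_three : (Finset.range (1 + 2)).filter Odd = {1} := by decide
theorem filter_odd_four : (Finset.range (2 + 2)).filter Odd = {1, 3} := by decide

open Polynomial in
theorem facA_one_one : facA 1 1 = 1 := by
  norm_num [facA, oddCoeff, polyS, polyQ, recPoly_one, filter_odd_three, finsetSum_coeff, coeff_X_pow,
    -map_mul, -map_pow, -map_neg, -map_sub, -map_add, -map_div₀, Nat.choose]

open Polynomial in
theorem facB_zero_one : facB 0 1 = 2 := by
  norm_num [facB, oddCoeff, polyR, polyP, recPoly_zero, filter_even_two, finsetSum_coeff, coeff_X_pow,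
    -map_mul, -map_pow, -map_neg, -map_sub, -map_add, -map_div₀, Nat.choose]

open Polynomial in
theorem facB_one_one : facB 1 1 = 1 := by
  norm_num [facB, oddCoeff, polyR, polyP, recPoly_two, filter_even_two, filter_even_four, finsetSum_coeff, coeff_X_pow,
    -map_mul, -map_pow, -map_neg, -map_sub, -map_add, -map_div₀, Nat.choose]

open Polynomial in
theorem facB_one_two : facB 1 2 = 2 / 3 := by
  norm_num [facB, oddCoeff, polyR, polyP, recPoly_two, filter_even_two, filter_even_four, finsetSum_coeff, coeff_X_pow,
    -map_mul, -map_pow, -map_neg, -map_sub, -map_add, -map_div₀, Nat.choose]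

open Polynomial in
theorem facC_one_one : facC 1 1 = 1 := by
  norm_num [facC, evenCoeff, polyR, polyP, recPoly_one, filter_even_three, finsetSum_coeff, coeff_X_pow,
    -map_mul, -map_pow, -map_neg, -map_sub, -map_add, -map_div₀, Nat.choose]

open Polynomial in
theorem facD_zero_one : facD 0 1 = 0 := by
  norm_num [facD, evenCoeff, polyS, polyQ, recPoly_zero, filter_odd_two, finsetSum_coeff, coeff_X_pow,
    -map_mul, -map_pow, -map_neg, -map_sub, -map_add, -map_div₀, Nat.choose]

open Polynomial in
theorem facD_one_one : facD 1 1 = 1 := by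
  norm_num [facD, evenCoeff, polyS, polyQ, recPoly_two, filter_odd_two, filter_odd_four, finsetSum_coeff, coeff_X_pow,
    -map_mul, -map_pow, -map_neg, -map_sub, -map_add, -map_div₀, Nat.choose]

open Polynomial in
theorem facE_one : facE 1 = 4 := by
  norm_num [facE, evenCoeff, polyR, polyP, polyY, polyZ, recPoly_one, filter_even_three, finsetSum_coeff, coeff_X_pow,
    -map_mul, -map_pow, -map_neg, -map_sub, -map_add, -map_div₀, Nat.choose]

open Polynomial in
theorem facG_zero : facG 0 = 1 := by
  norm_num [facG, evenCoeff, polyS, polyQ, recPoly_zero, filter_odd_two, finsetSum_coeff, coeff_X_pow,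
    -map_mul, -map_pow, -map_neg, -map_sub, -map_add, -map_div₀, Nat.choose]

open Polynomial in
theorem facG_one : facG 1 = 2 / 3 := by
  norm_num [facG, evenCoeff, polyS, polyQ, recPoly_two, filter_odd_two, filter_odd_four, finsetSum_coeff, coeff_X_pow,
    -map_mul, -map_pow, -map_neg, -map_sub, -map_add, -map_div₀, Nat.choose]

theorem d_zero_zero : d 0 0 = 1 := by rw [d]

theorem a_one_zero : a 1 0 = 2 := by
  simp [a, d_zero_zero, facB_zero_one]

theorem b_one_zero : b 1 0 = 2 / √3 := by
  simp [b, d_zero_zero, facG_zero]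

theorem c_one_zero : c 1 0 = 2 * √3 := by
  have hs : √3 * √3 = 3 := Real.mul_self_sqrt (by norm_num)
  simp [c, a_one_zero, b_one_zero, facA_one_one, facB_zero_one]
  field_simp
  linear_combination -hs

theorem d_one_zero : d 1 0 = 4 := by
  have hs : √3 * √3 = 3 := Real.mul_self_sqrt (by norm_num)
  simp [d, a_one_zero, b_one_zero, facE_one, facG_zero]
  field_simp
  nlinarith [hs]

theorem d_one_one : d 1 1 = 2 := by
  simp [d, a_one_zero, facC_one_one]

theorem a_two_zero : a 2 0 = 12 := by
  have : Finset.Icc 0 1 = {0, 1} := by decide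
  simp [a, c_one_zero, d_one_zero, d_one_one, facA_one_one, facB_zero_one, facB_one_one, this]
  field_simp
  norm_num

theorem a_two_one : a 2 1 = 4 / 3 := by
  simp [a, d_one_one, facB_one_two]
  norm_num

theorem b_two_zero : b 2 0 = 56 / (3 * √3) := by
  have hs : √3 * √3 = 3 := Real.mul_self_sqrt (by norm_num)
  have : Finset.Icc 0 1 = {0, 1} := by decide
  simp [b, c_one_zero, d_one_zero, d_one_one, facE_one, facG_zero, facG_one, this]
  field_simp
  linear_combination 8 * hs

theorem b_two_one : b 2 1 = 8 / √3 := by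
  have hs : √3 * √3 = 3 := Real.mul_self_sqrt (by norm_num)
  have : Finset.Icc 0 1 = {0, 1} := by decide
  simp [b, c_one_zero, d_one_zero, d_one_one, facC_one_one, facD_zero_one, facD_one_one, this]
  field_simp
  linear_combination 2 * hs

end MahlerQ
end

noncomputable section

namespace MahlerQ
open MeasureTheory Set Filter Topology

/-! ## Derivatives at negative integers -/

/-- At a zero of the trigonometric factor h, the product rule leaves only g h'; the derivative of g,
which contains Γ and the L-function, never enters. -/
theorem deriv_eq_of_reflection {f g h : ℂ → ℂ} {s h' : ℂ}
    (hfun : ∀ᶠ z in 𝓝 s, f (1 - z) = g z * h z) (hg : DifferentiableAt ℂ g s)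
    (hh : HasDerivAt h h' s) (h0 : h s = 0) : deriv f (1 - s) = -(g s * h') := by
  have h1 : HasDerivAt (fun z => f (1 - z)) (g s * h') s := by
    have := hg.hasDerivAt.mul hh
    rw [h0, mul_zero, zero_add] at this
    exact this.congr_of_eventuallyEq hfun
  have h2 : HasDerivAt (fun z => f (1 - z)) (g s * h') (1 - (1 - s)) := by rwa [sub_sub_cancel]
  have h3 := h2.comp_const_sub 1 (1 - s)
  simp only [sub_sub_cancel] at h3
  exact h3.deriv

theorem ne_neg_natCast_of_re_pos {z : ℂ} (hz : 1 < z.re) (n : ℕ) : z ≠ -n := by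
  rintro rfl
  simp at hz
  linarith [(Nat.cast_nonneg n : (0 : ℝ) ≤ n)]

theorem eventually_one_lt_re {m : ℕ} (hm : 2 ≤ m) : ∀ᶠ z : ℂ in 𝓝 (m : ℂ), 1 < z.re := by
  refine (isOpen_lt continuous_const Complex.continuous_re).mem_nhds ?_
  rw [mem_ofPred_eq, Complex.natCast_re]
  exact_mod_cast hm

theorem differentiableAt_two_pi_cpow (s : ℂ) :
    DifferentiableAt ℂ (fun z : ℂ => (2 * (Real.pi : ℂ)) ^ (-z)) s :=
  differentiableAt_id.neg.const_cpow (.inl (by simp [Real.pi_ne_zero]))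

theorem differentiableAt_Gamma_natCast {m : ℕ} (hm : 2 ≤ m) :
    DifferentiableAt ℂ Complex.Gamma (m : ℂ) :=
  Complex.differentiableAt_Gamma _ (ne_neg_natCast_of_re_pos (eventually_one_lt_re hm).self_of_nhds)

theorem deriv_riemannZeta {m : ℕ} (hm : 2 ≤ m) (hc : Complex.cos (Real.pi * m / 2) = 0) :
    deriv riemannZeta (1 - m) = 2 * (2 * Real.pi) ^ (-(m : ℂ)) * Complex.Gamma m *
      riemannZeta m * (Complex.sin (Real.pi * m / 2) * (Real.pi / 2)) := by
  have hm1 : (m : ℂ) ≠ 1 := by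
    rw [Ne, Nat.cast_eq_one]; omega
  have h := deriv_eq_of_reflection (f := riemannZeta) (s := m)
    (g := fun z => 2 * (2 * Real.pi) ^ (-z) * Complex.Gamma z * riemannZeta z)
    (h := fun z => Complex.cos (Real.pi * z / 2))
    (h' := -Complex.sin (Real.pi * m / 2) * (Real.pi / 2))
    (by
      filter_upwards [eventually_one_lt_re hm] with z hz
      rw [riemannZeta_one_sub (ne_neg_natCast_of_re_pos hz) (by rintro rfl; simp at hz)]
      ring)
    ((((differentiableAt_two_pi_cpow _).const_mul 2).mul (differentiableAt_Gamma_natCast hm)).mul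
      (differentiableAt_riemannZeta hm1))
    (by
      have h1 : HasDerivAt (fun z : ℂ => Real.pi * z / 2) (Real.pi / 2) (m : ℂ) := by
        simpa using ((hasDerivAt_id (m : ℂ)).const_mul (Real.pi : ℂ)).div_const 2
      exact h1.ccos) hc
  rw [h]
  ring

theorem deriv_zeta_neg_two : deriv riemannZeta (-2) = -riemannZeta 3 / (4 * (Real.pi : ℂ) ^ 2) := by
  have e : (Real.pi : ℂ) * (3 : ℕ) / 2 = Real.pi / 2 + Real.pi := by push_cast; ring
  have h := deriv_riemannZeta (m := 3) (by norm_num)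
    (by rw [e, Complex.cos_add_pi, Complex.cos_pi_div_two, neg_zero])
  have hG : Complex.Gamma (3 : ℂ) = 2 :=
    (Complex.Gamma_ofNat_eq_factorial 2).trans (by norm_num [Nat.factorial])
  rw [e, Complex.sin_add_pi, Complex.sin_pi_div_two, Complex.cpow_neg, Complex.cpow_natCast] at h
  norm_num [hG] at h
  rw [h]
  have := Complex.ofReal_ne_zero.2 Real.pi_ne_zero
  field_simp
  ring

theorem deriv_zeta_neg_four :
    deriv riemannZeta (-4) = 3 * riemannZeta 5 / (4 * (Real.pi : ℂ) ^ 4) := by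
  have e : (Real.pi : ℂ) * (5 : ℕ) / 2 = Real.pi / 2 + 2 * Real.pi := by push_cast; ring
  have h := deriv_riemannZeta (m := 5) (by norm_num)
    (by rw [e, Complex.cos_add_two_pi, Complex.cos_pi_div_two])
  have hG : Complex.Gamma (5 : ℂ) = 24 :=
    (Complex.Gamma_ofNat_eq_factorial 4).trans (by norm_num [Nat.factorial])
  rw [e, Complex.sin_add_two_pi, Complex.sin_pi_div_two, Complex.cpow_neg,
    Complex.cpow_natCast] at h
  norm_num [hG] at h
  rw [h]
  have := Complex.ofReal_ne_zero.2 Real.pi_ne_zero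
  field_simp
  ring

-- Gauss sum and functional equation for χ₋₃

theorem stdAddChar_two_sub_one :
    ZMod.stdAddChar (2 : ZMod 3) - ZMod.stdAddChar (1 : ZMod 3) = -(((√3 : ℝ) : ℂ) * Complex.I) := by
  have h1 := ZMod.stdAddChar_coe (N := 3) 1
  have h2 := ZMod.stdAddChar_coe (N := 3) (-1)
  have e : ((-1 : ℤ) : ZMod 3) = 2 := by decide
  rw [e] at h2
  rw [Int.cast_one] at h1
  have hs : Complex.sin (2 * Real.pi / 3) = ((√3 / 2 : ℝ) : ℂ) := by
    have : Real.sin (2 * Real.pi / 3) = √3 / 2 := by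
      rw [show 2 * Real.pi / 3 = Real.pi - Real.pi / 3 by ring, Real.sin_pi_sub,
        Real.sin_pi_div_three]
    rw [← this]; push_cast; ring_nf
  have hexp := Complex.two_sin (2 * Real.pi / 3)
  rw [h1, h2]
  have e1 : 2 * (Real.pi : ℂ) * Complex.I * ((-1 : ℤ) : ℂ) / ((3 : ℕ) : ℂ) =
      -(2 * Real.pi / 3) * Complex.I := by push_cast; ring
  have e2 : 2 * (Real.pi : ℂ) * Complex.I * ((1 : ℤ) : ℂ) / ((3 : ℕ) : ℂ) =
      2 * Real.pi / 3 * Complex.I := by push_cast; ring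
  rw [e1, e2]
  rw [hs] at hexp
  push_cast at hexp
  linear_combination Complex.I * hexp + (Complex.exp (-(2 * Real.pi / 3) * Complex.I) -
    Complex.exp (2 * Real.pi / 3 * Complex.I)) * Complex.I_sq

/-- A primitive character is an eigenfunction of the finite Fourier transform up to conjugation.
This one is real, and its eigenvalue is -i√3. -/
theorem dft_chi : ZMod.dft (chi : ZMod 3 → ℂ) = fun j => -(((√3 : ℝ) : ℂ) * Complex.I) * chi j := by
  have h0 : chi (0 : ZMod 3) = 0 := MulChar.map_nonunit _ (by decide)
  have hu : (Finset.univ : Finset (ZMod 3)) = {0, 1, 2} := by decide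
  have h1 : (-1 : ZMod 3) = 2 := by decide
  have h2 : (-2 : ZMod 3) = 1 := by decide
  have h3 : (2 * 2 : ZMod 3) = 1 := by decide
  have n1 : (0 : ZMod 3) ∉ ({1, 2} : Finset (ZMod 3)) := by decide
  have n2 : (1 : ZMod 3) ∉ ({2} : Finset (ZMod 3)) := by decide
  funext j
  rw [ZMod.dft_apply, hu, Finset.sum_insert n1, Finset.sum_insert n2, Finset.sum_singleton, h0,
    chi_two, map_one, ← stdAddChar_two_sub_one]
  have hj : j = 0 ∨ j = 1 ∨ j = 2 := by revert j; decide
  rcases hj with rfl | rfl | rfl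
  · simp [h0]
  · simp [h1, h2, sub_eq_add_neg]
  · simp [h1, h2, h3, chi_two, ← sub_eq_add_neg]

theorem chi_neg (j : ZMod 3) : chi (-j) = -chi j := by
  have : chi (-1) = -1 := by
    rw [show (-1 : ZMod 3) = 2 by decide, chi_two]
  rw [← neg_one_mul, map_mul, this, neg_one_mul]

theorem LFunction_const_mul (k : ℂ) (Φ : ZMod 3 → ℂ) (s : ℂ) :
    ZMod.LFunction (fun j => k * Φ j) s = k * ZMod.LFunction Φ s := by
  simp only [ZMod.LFunction, Finset.mul_sum]
  refine Finset.sum_congr rfl fun j _ => ?_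
  ring

/-- The general functional equation has two exponentials, weighted by the transforms of χ and of x ↦
χ(-x). Oddness makes these opposite, so the exponentials combine into a sine. -/
theorem L_one_sub {s : ℂ} (hs : ∀ n : ℕ, s ≠ -n) :
    L (1 - s) = 3 ^ (s - 1) * (2 * Real.pi) ^ (-s) * Complex.Gamma s * (2 * ((√3 : ℝ) : ℂ)) *
      L s * Complex.sin (Real.pi * s / 2) := by
  have h0 : chi (0 : ZMod 3) = 0 := MulChar.map_nonunit _ (by decide)
  have h := ZMod.LFunction_one_sub (chi : ZMod 3 → ℂ) hs (.inl h0)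
  have hneg : (fun x : ZMod 3 => chi (-x)) = fun x => (-1) * chi x := by
    funext x; rw [chi_neg, neg_one_mul]
  have hdn : ZMod.dft (fun x : ZMod 3 => (-1) * chi x) =
      fun j => ((√3 : ℝ) : ℂ) * Complex.I * chi j := by
    have : (fun x : ZMod 3 => (-1) * chi x) = (-1 : ℂ) • (chi : ZMod 3 → ℂ) := rfl
    rw [this, map_smul, dft_chi]
    funext j
    simp
  rw [hneg, hdn, dft_chi, LFunction_const_mul, LFunction_const_mul] at h
  have hexp := Complex.two_sin (Real.pi * s / 2)
  have e1 : (Real.pi : ℂ) * Complex.I * s / 2 = Real.pi * s / 2 * Complex.I := by ring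
  have e2 : -(Real.pi : ℂ) * Complex.I * s / 2 = -(Real.pi * s / 2) * Complex.I := by ring
  rw [e1, e2] at h
  rw [L, DirichletCharacter.LFunction, h, L, DirichletCharacter.LFunction]
  push_cast
  linear_combination (-(3 : ℂ) ^ (s - 1) * (2 * Real.pi) ^ (-s) * Complex.Gamma s *
    ((√3 : ℝ) : ℂ) * ZMod.LFunction chi s) * hexp

theorem chi_ne_one : chi ≠ 1 := by
  intro h
  have h2 := chi_two
  rw [h, MulChar.one_apply (by decide)] at h2
  norm_num at h2

theorem deriv_L {m : ℕ} (hm : 2 ≤ m) (hs : Complex.sin (Real.pi * m / 2) = 0) :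
    deriv L (1 - m) = -(3 ^ ((m : ℂ) - 1) * (2 * Real.pi) ^ (-(m : ℂ)) * Complex.Gamma m *
      (2 * ((√3 : ℝ) : ℂ)) * L m * (Complex.cos (Real.pi * m / 2) * (Real.pi / 2))) :=
  deriv_eq_of_reflection (f := L) (s := m)
    (g := fun z => 3 ^ (z - 1) * (2 * Real.pi) ^ (-z) * Complex.Gamma z * (2 * ((√3 : ℝ) : ℂ)) *
      L z)
    (h := fun z => Complex.sin (Real.pi * z / 2))
    (by
      filter_upwards [eventually_one_lt_re hm] with z hz
      exact L_one_sub (ne_neg_natCast_of_re_pos hz))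
    ((((((differentiableAt_id.sub_const 1).const_cpow (.inl (by norm_num))).mul
      (differentiableAt_two_pi_cpow _)).mul (differentiableAt_Gamma_natCast hm)).mul_const _).mul
      (DirichletCharacter.differentiable_LFunction chi_ne_one _))
    (by
      have h1 : HasDerivAt (fun z : ℂ => Real.pi * z / 2) (Real.pi / 2) (m : ℂ) := by
        simpa using ((hasDerivAt_id (m : ℂ)).const_mul (Real.pi : ℂ)).div_const 2
      exact h1.csin) hs

theorem deriv_L_neg_one : deriv L (-1) = 3 * ((√3 : ℝ) : ℂ) / (4 * Real.pi) * L 2 := by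
  have e : (Real.pi : ℂ) * (2 : ℕ) / 2 = Real.pi := by push_cast; ring
  have h := deriv_L (m := 2) (by norm_num) (by rw [e, Complex.sin_pi])
  have e3 : ((2 : ℕ) : ℂ) - 1 = (1 : ℕ) := by push_cast; ring
  rw [e, Complex.cos_pi, Complex.cpow_neg, Complex.cpow_natCast, e3, Complex.cpow_natCast] at h
  have hG : Complex.Gamma (2 : ℂ) = 1 :=
    (Complex.Gamma_ofNat_eq_factorial 1).trans (by norm_num [Nat.factorial])
  norm_num [hG] at h
  rw [h]
  have := Complex.ofReal_ne_zero.2 Real.pi_ne_zero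
  field_simp
  ring

theorem deriv_L_neg_three :
    deriv L (-3) = -(81 * ((√3 : ℝ) : ℂ) / (8 * (Real.pi : ℂ) ^ 3) * L 4) := by
  have e : (Real.pi : ℂ) * (4 : ℕ) / 2 = 2 * Real.pi := by push_cast; ring
  have h := deriv_L (m := 4) (by norm_num) (by rw [e, Complex.sin_two_pi])
  have e3 : ((4 : ℕ) : ℂ) - 1 = (3 : ℕ) := by push_cast; ring
  rw [e, Complex.cos_two_pi, Complex.cpow_neg, Complex.cpow_natCast, e3, Complex.cpow_natCast] at h
  have hG : Complex.Gamma (4 : ℂ) = 6 :=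
    (Complex.Gamma_ofNat_eq_factorial 3).trans (by norm_num [Nat.factorial])
  norm_num [hG] at h
  rw [h]
  have := Complex.ofReal_ne_zero.2 Real.pi_ne_zero
  field_simp
  ring

/-! ## The first four Mahler measures -/

theorem calC_one : calC 1 = 91 / 54 * riemannZeta 3 := by
  norm_num [calC, Nat.factorial]

theorem calC_two : calC 2 = 3751 / 162 * riemannZeta 5 := by
  norm_num [calC, Nat.factorial]

theorem calD_zero : calD 0 = 5 / 4 * L 2 := by
  norm_num [calD, Nat.factorial]

theorem calD_one : calD 1 = 51 / 8 * L 4 := by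
  norm_num [calD, Nat.factorial]

theorem sqrt_three_sq : ((√3 : ℝ) : ℂ) ^ 2 = 3 := by
  rw [← Complex.ofReal_pow, Real.sq_sqrt (by norm_num)]; norm_num

/-- Normal form that leaves √3 only in numerators, so that `ring` can close the explicit
evaluations. -/
theorem inv_sqrt_three : ((√3 : ℝ) : ℂ)⁻¹ = ((√3 : ℝ) : ℂ) * 3⁻¹ := by
  have h : ((√3 : ℝ) : ℂ) ≠ 0 := by
    rw [Complex.ofReal_ne_zero]; positivity
  field_simp
  exact sqrt_three_sq.symm

theorem mahler_Q_one : (mahler (Q 1) : ℂ) = 5 * ((√3 : ℝ) : ℂ) / (4 * Real.pi) * L 2 := by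
  have h := (mahler_odd 0).2
  norm_num [d_zero_zero, calD_zero] at h
  rw [h]
  simp only [div_eq_mul_inv, mul_inv, inv_sqrt_three]
  ring

theorem mahler_Q_two : (mahler (Q 2) : ℂ) =
    91 / (18 * (Real.pi : ℂ) ^ 2) * riemannZeta 3
      + 5 / (4 * ((√3 : ℝ) : ℂ) * Real.pi) * L 2 := by
  have h := (mahler_even (n := 1) le_rfl).2
  norm_num [a_one_zero, b_one_zero, calD_zero, calC_one] at h
  rw [h]
  simp only [div_eq_mul_inv, mul_inv, inv_sqrt_three]
  ring

theorem mahler_Q_three : (mahler (Q 3) : ℂ) =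
    91 / (36 * (Real.pi : ℂ) ^ 2) * riemannZeta 3
      + 5 / (4 * ((√3 : ℝ) : ℂ) * Real.pi) * L 2
      + 153 * ((√3 : ℝ) : ℂ) / (16 * (Real.pi : ℂ) ^ 3) * L 4 := by
  have h := (mahler_odd 1).2
  norm_num [c_one_zero, d_one_zero, d_one_one, calD_zero, calC_one, calD_one,
    Finset.sum_range_succ] at h
  rw [h]
  simp only [div_eq_mul_inv, mul_inv, inv_sqrt_three]
  -- The coefficient c_{1,0} = 2√3 meets the prefactor 1/√3, so a square of √3 remains in the ζ(3)
  -- term.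
  linear_combination (91 / 108 * (Real.pi : ℂ)⁻¹ ^ 2 * riemannZeta 3) * sqrt_three_sq

theorem mahler_Q_four : (mahler (Q 4) : ℂ) =
    91 / (36 * (Real.pi : ℂ) ^ 2) * riemannZeta 3
      + 3751 / (108 * (Real.pi : ℂ) ^ 4) * riemannZeta 5
      + 35 / (36 * ((√3 : ℝ) : ℂ) * Real.pi) * L 2
      + 51 * ((√3 : ℝ) : ℂ) / (8 * (Real.pi : ℂ) ^ 3) * L 4 := by
  have h := (mahler_even (n := 2) one_le_two).2
  norm_num [a_two_zero, a_two_one, b_two_zero, b_two_one, calD_zero, calC_one, calD_one, calC_two,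
    Finset.sum_range_succ, Finset.sum_Icc_succ_top] at h
  rw [h]
  simp only [div_eq_mul_inv, mul_inv, inv_sqrt_three]
  ring

end MahlerQ
end



theorem theorem1 :
    -- the integrals defining the Mahler measures converge absolutely
    (∀ n : ℕ, 1 ≤ n → MahlerQ.MahlerConverges (MahlerQ.Q n)) ∧
    -- an even number of factors
    (∀ n : ℕ, 1 ≤ n →
      (MahlerQ.mahler (MahlerQ.Q (2 * n)) : ℂ) =
        2 / 12 ^ n *
          (∑ h ∈ Finset.Icc 1 n,
              (MahlerQ.a n (h - 1) : ℂ) * (3 / (Real.pi : ℂ)) ^ (2 * h) * MahlerQ.calC h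
            + ∑ h ∈ Finset.range n,
              (MahlerQ.b n h : ℂ) * (3 / (Real.pi : ℂ)) ^ (2 * h + 1) * MahlerQ.calD h)) ∧
    -- an odd number of factors
    (∀ n : ℕ,
      (MahlerQ.mahler (MahlerQ.Q (2 * n + 1)) : ℂ) =
        1 / 12 ^ n *
          (1 / ((√3 : ℝ) : ℂ) * ∑ h ∈ Finset.Icc 1 n,
              (MahlerQ.c n (h - 1) : ℂ) * (3 / (Real.pi : ℂ)) ^ (2 * h) * MahlerQ.calC h
            + 1 / ((√3 : ℝ) : ℂ) * ∑ h ∈ Finset.range (n + 1),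
              (MahlerQ.d n h : ℂ) * (3 / (Real.pi : ℂ)) ^ (2 * h + 1) * MahlerQ.calD h)) ∧
    -- one factor
    ((MahlerQ.mahler (MahlerQ.Q 1) : ℂ) =
        5 * ((√3 : ℝ) : ℂ) / (4 * Real.pi) * MahlerQ.L 2 ∧
      (MahlerQ.mahler (MahlerQ.Q 1) : ℂ) = 5 / 3 * deriv MahlerQ.L (-1)) ∧
    -- two factors
    ((MahlerQ.mahler (MahlerQ.Q 2) : ℂ) =
        91 / (18 * (Real.pi : ℂ) ^ 2) * riemannZeta 3
          + 5 / (4 * ((√3 : ℝ) : ℂ) * Real.pi) * MahlerQ.L 2 ∧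
      (MahlerQ.mahler (MahlerQ.Q 2) : ℂ) =
        -(182 / 9) * deriv riemannZeta (-2) + 5 / 9 * deriv MahlerQ.L (-1)) ∧
    -- three factors
    ((MahlerQ.mahler (MahlerQ.Q 3) : ℂ) =
        91 / (36 * (Real.pi : ℂ) ^ 2) * riemannZeta 3
          + 5 / (4 * ((√3 : ℝ) : ℂ) * Real.pi) * MahlerQ.L 2
          + 153 * ((√3 : ℝ) : ℂ) / (16 * (Real.pi : ℂ) ^ 3) * MahlerQ.L 4 ∧
      (MahlerQ.mahler (MahlerQ.Q 3) : ℂ) =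
        -(91 / 9) * deriv riemannZeta (-2) + 5 / 9 * deriv MahlerQ.L (-1)
          - 17 / 18 * deriv MahlerQ.L (-3)) ∧
    -- four factors
    ((MahlerQ.mahler (MahlerQ.Q 4) : ℂ) =
        91 / (36 * (Real.pi : ℂ) ^ 2) * riemannZeta 3
          + 3751 / (108 * (Real.pi : ℂ) ^ 4) * riemannZeta 5
          + 35 / (36 * ((√3 : ℝ) : ℂ) * Real.pi) * MahlerQ.L 2
          + 51 * ((√3 : ℝ) : ℂ) / (8 * (Real.pi : ℂ) ^ 3) * MahlerQ.L 4 ∧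
      (MahlerQ.mahler (MahlerQ.Q 4) : ℂ) =
        -(91 / 9) * deriv riemannZeta (-2) + 3751 / 81 * deriv riemannZeta (-4)
          + 35 / 81 * deriv MahlerQ.L (-1) - 17 / 27 * deriv MahlerQ.L (-3)) := by
  refine ⟨fun n hn => MahlerQ.mahlerConverges_Q hn, fun n hn => (MahlerQ.mahler_even hn).2,
    fun n => (MahlerQ.mahler_odd n).2, ⟨MahlerQ.mahler_Q_one, ?_⟩, ⟨MahlerQ.mahler_Q_two, ?_⟩,
    ⟨MahlerQ.mahler_Q_three, ?_⟩, ⟨MahlerQ.mahler_Q_four, ?_⟩⟩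
  · rw [MahlerQ.mahler_Q_one, MahlerQ.deriv_L_neg_one]
    ring
  · rw [MahlerQ.mahler_Q_two, MahlerQ.deriv_L_neg_one, MahlerQ.deriv_zeta_neg_two]
    simp only [div_eq_mul_inv, mul_inv, MahlerQ.inv_sqrt_three]
    ring
  · rw [MahlerQ.mahler_Q_three, MahlerQ.deriv_L_neg_one, MahlerQ.deriv_zeta_neg_two,
      MahlerQ.deriv_L_neg_three]
    simp only [div_eq_mul_inv, mul_inv, MahlerQ.inv_sqrt_three]
    ring
  · rw [MahlerQ.mahler_Q_four, MahlerQ.deriv_L_neg_one, MahlerQ.deriv_zeta_neg_two,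
      MahlerQ.deriv_L_neg_three, MahlerQ.deriv_zeta_neg_four]
    simp only [div_eq_mul_inv, mul_inv, MahlerQ.inv_sqrt_three]
    ring
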